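/- Let $P\subset\mathbb R^2$ be a Euclidean polygon with $q\ge 0$ obstacles: $P$ is the closed region bounded by a simple closed polygon, with the open interiors of $q$ simple closed polygons (the obstacles) removed, where the closed regions bounded by the obstacles are pairwise disjoint and contained in the interior of the outer polygon. Let $K(P)$ be the set of corners of $P$ (the vertices of the outer polygon and of all obstacles), let $p=|K(P)|$, and for $v\in K(P)$ let $\alpha(v)$ be the angle of $P$ at $v$, i.e. the angular measure of the set of directions at $v$ pointing into the interior of $P$. (Corners with $\alpha(v)=\pi$ are allowed.) The billiard flow orbit of a point $z\in P$ and a unit direction $u$ pointing into the interior of $P$ moves with unit speed along straight segments in the interior of $P$, is reflected (angle of incidence equals angle of reflection) at interior points of the sides, and stops when it arrives at a corner; an orbit that arrives at a corner is called singular, and its length is the time of arrival. For $z\in P$, $v\in K(P)$ and $l\ge 0$ let $gc_z(l;v)$ be the number of billiard orbits that start at $z$ and arrive at $v$ by time $l$, and let $gc_z(l)=\sum_{v\in K(P)}gc_z(l;v)$ be the number of singular billiard orbits of length at most $l$ starting at $z$. Then, for every $l\ge 0$, the numbers $gc_z(l;v)$ are finite for all $z\in P$ and $v\in K(P)$; for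 every $K\subseteq K(P)$ the function $z\mapsto\sum_{v\in K}gc_z(l;v)$ is integrable on $P$ with respect to Lebesgue measure $dz$, and $$2\int_P\sum_{v\in K}gc_z(l;v)\,dz=\Big(\sum_{v\in K}\alpha(v)\Big)\,l^2 .$$ In particular $z\mapsto gc_z(l)$ is integrable on $P$ and $$2\int_P gc_z(l)\,dz=\pi\,(p+2q-2)\,l^2 .$$ -/

import Mathlib

open MeasureTheory Set

noncomputable section

namespace Billiard

/-- The Euclidean plane. -/
abbrev Plane : Type := EuclideanSpace ℝ (Fin 2)

/-- A simple (that is, non-self-intersecting) closed polygon in the plane: the closed curve that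
runs along the half-open edges `[v i, v (i + 1))` in cyclic order is injective.
Interior angles equal to `π` are allowed. -/
structure SimplePolygon where
  /-- number of vertices -/
  n : ℕ
  three_le : 3 ≤ n
  /-- the vertices, in cyclic order -/
  poly : Polygon Plane n
  injective : ∀ i j : Fin n, ∀ s ∈ Ico (0 : ℝ) 1, ∀ t ∈ Ico (0 : ℝ) 1,
    poly.edgePath ℝ i s = poly.edgePath ℝ j t → i = j ∧ s = t

namespace SimplePolygon

/-- The polygonal closed curve itself. -/
def curve (γ : SimplePolygon) : Set Plane := γ.poly.boundary ℝ

/-- The open region enclosed by the curve: the points off the curve whose connected component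
in the complement of the curve is bounded. -/
def inside (γ : SimplePolygon) : Set Plane :=
  {x | x ∈ γ.curveᶜ ∧ Bornology.IsBounded (connectedComponentIn γ.curveᶜ x)}

/-- The closed region bounded by the curve. -/
def region (γ : SimplePolygon) : Set Plane := γ.curve ∪ γ.inside

/-- The set of vertices. -/
def vertexSet (γ : SimplePolygon) : Finset Plane := Finset.univ.image γ.poly.vertices

end SimplePolygon

/-- A Euclidean polygon with obstacles (a billiard table): a closed polygonal region from which
the open interiors of `q` polygonal obstacles have been removed. The obstacles
are pairwise disjoint and lie strictly inside the outer polygon. -/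
structure Table where
  /-- the outer boundary polygon -/
  outer : SimplePolygon
  /-- number of obstacles -/
  q : ℕ
  /-- the obstacles -/
  obstacle : Fin q → SimplePolygon
  obstacle_subset : ∀ i, (obstacle i).region ⊆ outer.inside
  obstacle_disjoint : ∀ i j, i ≠ j → Disjoint (obstacle i).region (obstacle j).region

namespace Table

/-- The closed planar set `P`. -/
def carrier (P : Table) : Set Plane := P.outer.region \ ⋃ i, (P.obstacle i).inside

/-- `γ` is one of the `q + 1` boundary polygons of `P`. -/
def IsBoundaryPolygon (P : Table) (γ : SimplePolygon) : Prop :=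
  γ = P.outer ∨ ∃ i, γ = P.obstacle i

/-- The segment from `a` to `b` is a side of `P`. -/
def IsSide (P : Table) (a b : Plane) : Prop :=
  ∃ γ : SimplePolygon, P.IsBoundaryPolygon γ ∧
    ∃ i : Fin γ.n, a = γ.poly i ∧ b = γ.poly (finRotate γ.n i)

/-- The set `K(P)` of all corners of `P`: those of the outer polygon and those of the obstacles. -/
def corners (P : Table) : Finset Plane :=
  open Classical in P.outer.vertexSet ∪ Finset.univ.biUnion fun i => (P.obstacle i).vertexSet

/-- The unit vector with polar angle `θ`. -/
def dir (θ : ℝ) : Plane := !₂[Real.cos θ, Real.sin θ]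

/-- The angle `α(v)` of `P` at `v`: the angular measure of the set of directions that point
from `v` into the interior of `P`. -/
def angle (P : Table) (v : Plane) : ℝ :=
  volume.real {θ : ℝ | θ ∈ Ioc (-Real.pi) Real.pi ∧
    ∃ ε > 0, ∀ s ∈ Ioo (0 : ℝ) ε, v + s • dir θ ∈ interior P.carrier}

/-- The point moving from `x` with velocity `u` stays in the interior of `P` during the open
time interval `(0, t)`. (For `x` on the boundary of `P`, this forces `u` to point into `P`.) -/
def FreeFlight (P : Table) (x u : Plane) (t : ℝ) : Prop :=
  0 < t ∧ ∀ s ∈ Ioo (0 : ℝ) t, x + s • u ∈ interior P.carrier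

/-- `P.OrbitReaches v x u t`: the billiard flow orbit that starts at the point `x` with velocity
`u` arrives at the point `v` at time `t`. Between collisions the orbit moves along straight
segments in the interior of `P`. At an interior point of a side `[a, b]` the velocity is reflected
in the direction of the side; an orbit is not continued beyond a corner. -/
inductive OrbitReaches (P : Table) (v : Plane) : Plane → Plane → ℝ → Prop
  | arrive (x u : Plane) (t : ℝ) (hfree : P.FreeFlight x u t) (hv : x + t • u = v) :
      OrbitReaches P v x u t
  | bounce (x u a b : Plane) (t t' : ℝ) (hfree : P.FreeFlight x u t) (hside : P.IsSide a b)
      (hmem : x + t • u ∈ openSegment ℝ a b)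
      (hnext : OrbitReaches P v (x + t • u) ((Submodule.span ℝ {b - a}).reflection u) t') :
      OrbitReaches P v x u (t + t')

/-- The unit directions of the billiard orbits that start at `z` and wind up at `v` by time `l`. -/
def singularDirections (P : Table) (z : Plane) (l : ℝ) (v : Plane) : Set Plane :=
  {u | ‖u‖ = 1 ∧ ∃ t ≤ l, P.OrbitReaches v z u t}

/-- `gc_z(l; v)`: the number of billiard flow orbits that start at `z` and wind up at `v` by
time `l`. -/
def gcAt (P : Table) (z : Plane) (l : ℝ) (v : Plane) : ℕ := (P.singularDirections z l v).ncard

/-- `gc_z(l)`: the number of singular billiard flow orbits of length at most `l` that start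
at `z`. -/
def gc (P : Table) (z : Plane) (l : ℝ) : ℕ := ∑ v ∈ P.corners, P.gcAt z l v

end Table

end Billiard

end

/-! Fix a corner `v` and reverse time: an orbit from `z` that arrives at `v` by time `l` is an orbit
that leaves `v` and is at `z` at some time at most `l` (`Orbit.reverse`). So the integral over `z`
measures, with multiplicity, the ground covered up to time `l` by the fan of orbits leaving `v`. For
a fixed list `w` of sides, reflecting the table instead of the orbit makes all orbits with itinerary
`w` straight, by an isometry that depends on `w` alone (`Orbit.unfold_eq`). Hence the set `source`
of starting points with itinerary `w` has the same area as a set `reach` of points `v + t u` in the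
plane (`volume_source`). For different itineraries the sets `reach` are disjoint, because direction
and time determine the itinerary. Together they fill the circular sector of radius `l` and opening
`α(v)` up to a null set, because only finitely many directions from `v` run into a corner
(`volume_iUnion_reach`). That sector has area `α(v) l² / 2`.

The sums involved are finite for two reasons. The number of bounces is bounded in terms of the
length (`exists_bounce_bound`): near a corner `c` the angle between `x - c` and the velocity drops
by a fixed amount on each flight between sides. And for a given itinerary at most one direction
leads from `z` to `v`. So on the interior of the table `gcAt` is a finite sum of indicators of sets
`source`.

The geometry of the table is derived from the definition of the inside by bounded components. Each
side of a simple polygon lies in one component (`exists_side_component`); the side below a lowest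
vertex is unbounded, and the other is bounded because the winding number jumps across an edge
(`winding_jump`). Hopf's argument gives the sum of the exterior angles (`sum_turn`). The resulting
sectors at boundary points identify `angle`, allow orbits to be continued after a bounce, and give
the total angle `π (p + 2q - 2)`: the outer polygon contributes `(n - 2) π`, an obstacle with `n`
vertices `2πn - (n - 2) π`. -/

namespace Billiard

/-! ### Arguments of secants and the sum of exterior angles -/

open scoped Pointwise

/-- The argument of a quotient is the difference of the arguments, if that is a principal value. -/
lemma arg_div_eq_sub {x y : ℂ} (hx : x ≠ 0) (hy : y ≠ 0)
    (h : x.arg - y.arg ∈ Ioc (-Real.pi) Real.pi) : (x / y).arg = x.arg - y.arg := by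
  rw [← Complex.arg_coe_angle_toReal_eq_arg, Complex.arg_div_coe_angle hx hy, ← Real.Angle.coe_sub,
    Real.Angle.toReal_coe_eq_self_iff]
  exact h

/-- A compact convex set of complex numbers that avoids `0` lies in an open half-plane. -/
lemma exists_halfPlane {S : Set ℂ} (hc : Convex ℝ S) (hk : IsCompact S) (h0 : (0 : ℂ) ∉ S) :
    ∃ w : ℂ, ∀ z ∈ S, 0 < (z * w).re := by
  obtain ⟨f, u, hu, hf⟩ := geometric_hahn_banach_point_closed hc hk.isClosed h0
  refine ⟨⟨f 1, -f Complex.I⟩, fun z hz => ?_⟩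
  have h1 : f z = z.re * f 1 + z.im * f Complex.I := by
    conv_lhs => rw [← Complex.re_add_im z]
    have h2 : (z.re : ℂ) + z.im * Complex.I = z.re • (1 : ℂ) + z.im • Complex.I := by simp
    rw [h2, map_add, map_smul, map_smul]; simp
  have := hf z hz
  simp only [map_zero] at hu
  simp only [Complex.mul_re]
  linarith

/-- Multiplication by `w` moves both arguments into `(-π/2, π/2)`, so their difference is again a
principal value. -/
lemma arg_div_of_halfPlane {p q w : ℂ} (hp : 0 < (p * w).re) (hq : 0 < (q * w).re) :
    (q / p).arg = (q * w).arg - (p * w).arg := by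
  have hw : w ≠ 0 := by rintro rfl; simp at hp
  have hp0 : p * w ≠ 0 := by intro h; simp [h] at hp
  have hq0 : q * w ≠ 0 := by intro h; simp [h] at hq
  rw [← mul_div_mul_right q p hw]
  apply arg_div_eq_sub hq0 hp0
  have h1 := abs_lt.1 (Complex.abs_arg_lt_pi_div_two_iff.2 (Or.inl hp))
  have h2 := abs_lt.1 (Complex.abs_arg_lt_pi_div_two_iff.2 (Or.inl hq))
  constructor <;> linarith [h1.1, h1.2, h2.1, h2.2]

/-- For disjoint segments the angles swept by the secants add up. -/
lemma arg_secant_square {a a' b b' : ℂ} (h : Disjoint (segment ℝ a a') (segment ℝ b b')) :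
    ((a' - b) / (a - b)).arg + ((a' - b') / (a' - b)).arg =
      ((a - b') / (a - b)).arg + ((a' - b') / (a - b')).arg := by
  have hk : ∀ x y : ℂ, IsCompact (segment ℝ x y) := fun x y => by
    rw [segment_eq_image_lineMap]
    exact isCompact_Icc.image AffineMap.lineMap_continuous
  obtain ⟨w, hw⟩ := exists_halfPlane ((convex_segment a a').sub (convex_segment b b'))
    (by rw [sub_eq_add_neg]; exact (hk a a').add (hk b b').neg) (by
      rintro ⟨x, hx, y, hy, hxy⟩
      exact h.ne_of_mem hx hy (sub_eq_zero.1 hxy))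
  have key : ∀ x ∈ segment ℝ a a', ∀ y ∈ segment ℝ b b', 0 < ((x - y) * w).re :=
    fun x hx y hy => hw _ (sub_mem_sub hx hy)
  have ha := left_mem_segment ℝ a a'
  have ha' := right_mem_segment ℝ a a'
  have hb := left_mem_segment ℝ b b'
  have hb' := right_mem_segment ℝ b b'
  rw [arg_div_of_halfPlane (key a ha b hb) (key a' ha' b hb),
    arg_div_of_halfPlane (key a' ha' b hb) (key a' ha' b' hb'),
    arg_div_of_halfPlane (key a ha b hb) (key a ha b' hb'),
    arg_div_of_halfPlane (key a ha b' hb') (key a' ha' b' hb')]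
  ring

/-- If `0` is not between `p` and `r`, then `p`, `r` and `p + r` share an open half-plane, where
arguments subtract. This is the step at the diagonal in Hopf's argument. -/
lemma arg_add_triangle {p r : ℂ} (h : (0 : ℂ) ∉ segment ℝ p r) :
    ((p + r) / p).arg + (r / (p + r)).arg = (r / p).arg := by
  obtain ⟨w, hw⟩ := exists_halfPlane (convex_segment p r) (by
    rw [segment_eq_image_lineMap]
    exact isCompact_Icc.image AffineMap.lineMap_continuous) h
  have hp := hw _ (left_mem_segment ℝ p r)
  have hr := hw _ (right_mem_segment ℝ p r)
  have hpr : 0 < ((p + r) * w).re := by rw [add_mul, Complex.add_re]; linarith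
  rw [arg_div_of_halfPlane hp hpr, arg_div_of_halfPlane hpr hr, arg_div_of_halfPlane hp hr]
  ring

/-- The bi-infinite `n`-periodic sequence of vertices of a simple closed polygon in `ℂ`. -/
structure IsSimpleLoop (n : ℕ) (V : ℤ → ℂ) : Prop where
  three_le : 3 ≤ n
  periodic : ∀ i, V (i + n) = V i
  inj : ∀ i j : ℤ, ∀ s ∈ Ico (0 : ℝ) 1, ∀ t ∈ Ico (0 : ℝ) 1,
    V i + s * (V (i + 1) - V i) = V j + t * (V (j + 1) - V j) → (n : ℤ) ∣ i - j ∧ s = t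

namespace IsSimpleLoop

variable {n : ℕ} {V : ℤ → ℂ}

lemma shift (h : IsSimpleLoop n V) (k : ℤ) : IsSimpleLoop n fun i => V (i + k) where
  three_le := h.three_le
  periodic i := by rw [add_right_comm]; exact h.periodic _
  inj i j s hs t ht e := by
    rw [add_right_comm i 1 k, add_right_comm j 1 k] at e
    simpa using h.inj (i + k) (j + k) s hs t ht e

lemma eq_of_dvd (h : IsSimpleLoop n V) {i j : ℤ} (hd : (n : ℤ) ∣ i - j) : V i = V j := by
  have hp : Function.Periodic V (n : ℤ) := h.periodic
  obtain ⟨k, hk⟩ := hd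
  have : i = j + k * n := by linarith
  rw [this]; exact hp.int_mul k j

/-- The end of an edge is the start of the next one, so admitting the parameter `1` adds only
coincidences at a common vertex. -/
lemma inj_closed (h : IsSimpleLoop n V) {i j : ℤ} {s t : ℝ} (hs : s ∈ Icc (0 : ℝ) 1)
    (ht : t ∈ Icc (0 : ℝ) 1)
    (e : V i + s * (V (i + 1) - V i) = V j + t * (V (j + 1) - V j)) :
    ((n : ℤ) ∣ i - j ∧ s = t) ∨ ((n : ℤ) ∣ i + 1 - j ∧ s = 1 ∧ t = 0) ∨
      ((n : ℤ) ∣ i - (j + 1) ∧ s = 0 ∧ t = 1) := by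
  have h0 : (0 : ℝ) ∈ Ico (0 : ℝ) 1 := by simp
  rcases hs.2.lt_or_eq with hs1 | rfl <;> rcases ht.2.lt_or_eq with ht1 | rfl
  · exact Or.inl (h.inj i j s ⟨hs.1, hs1⟩ t ⟨ht.1, ht1⟩ e)
  · have := h.inj i (j + 1) s ⟨hs.1, hs1⟩ 0 h0 (by rw [e]; push_cast; ring)
    exact Or.inr (Or.inr ⟨this.1, this.2, rfl⟩)
  · have := h.inj (i + 1) j 0 h0 t ⟨ht.1, ht1⟩ (by rw [← e]; push_cast; ring)
    exact Or.inr (Or.inl ⟨this.1, rfl, this.2.symm⟩)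
  · have := h.inj (i + 1) (j + 1) 0 h0 0 h0 (by
      have : V (i + 1) = V (j + 1) := by linear_combination (norm := (push_cast; ring)) e
      rw [this]; push_cast; ring)
    exact Or.inl ⟨by simpa using this.1, rfl⟩

lemma reverse (h : IsSimpleLoop n V) : IsSimpleLoop n fun i => V (-i) where
  three_le := h.three_le
  periodic i := by
    refine h.eq_of_dvd ⟨-1, by ring⟩
  inj i j s hs t ht e := by
    -- Edge `i` of the reversed loop is edge `-(i + 1)` of `V` run backwards. Its parameter `1 - s`
    -- lies in `(0, 1]`, hence the use of `inj_closed`.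
    have e' : V (-(i + 1)) + ((1 - s : ℝ) : ℂ) * (V (-(i + 1) + 1) - V (-(i + 1))) =
        V (-(j + 1)) + ((1 - t : ℝ) : ℂ) * (V (-(j + 1) + 1) - V (-(j + 1))) := by
      rw [show -(i + 1) + 1 = -i by ring, show -(j + 1) + 1 = -j by ring]
      push_cast
      linear_combination e
    rcases h.inj_closed (s := 1 - s) (t := 1 - t) ⟨by linarith [hs.2], by linarith [hs.1]⟩
      ⟨by linarith [ht.2], by linarith [ht.1]⟩ e' with ⟨h1, h2⟩ | ⟨_, _, h2⟩ | ⟨_, h2, _⟩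
    · refine ⟨?_, by linarith⟩
      rw [show i - j = -(-(i + 1) - -(j + 1)) by ring, dvd_neg]; exact h1
    · linarith [ht.2]
    · linarith [hs.2]

lemma ne_succ (h : IsSimpleLoop n V) (i : ℤ) : V i ≠ V (i + 1) := by
  intro e
  have := (h.inj i (i + 1) 0 (by simp) 0 (by simp) (by simpa using e)).1
  have h3 := h.three_le
  have h1 : (n : ℤ) ∣ 1 := by rw [← dvd_neg]; simpa using this
  have := Int.le_of_dvd one_pos h1
  omega

lemma edge_ne_zero (h : IsSimpleLoop n V) (i : ℤ) : V (i + 1) - V i ≠ 0 :=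
  sub_ne_zero.2 (h.ne_succ i).symm

lemma dvd_of_eq (h : IsSimpleLoop n V) {i j : ℤ} (e : V i = V j) : (n : ℤ) ∣ i - j :=
  (h.inj i j 0 (by simp) 0 (by simp) (by simpa using e)).1

lemma not_dvd (_h : IsSimpleLoop n V) {k : ℤ} (h0 : 0 < k) (hk : k < n) : ¬ (n : ℤ) ∣ k :=
  fun hd => by have := Int.le_of_dvd h0 hd; omega

lemma mem_segment_iff {i : ℤ} {x : ℂ} : x ∈ segment ℝ (V i) (V (i + 1)) ↔
    ∃ s ∈ Icc (0 : ℝ) 1, V i + s * (V (i + 1) - V i) = x := by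
  rw [segment_eq_image']
  simp

lemma disjoint_segment (h : IsSimpleLoop n V) {i j : ℤ} (h0 : ¬ (n : ℤ) ∣ i - j)
    (h1 : ¬ (n : ℤ) ∣ i + 1 - j) (h2 : ¬ (n : ℤ) ∣ i - (j + 1)) :
    Disjoint (segment ℝ (V i) (V (i + 1))) (segment ℝ (V j) (V (j + 1))) := by
  rw [Set.disjoint_left]
  intro x hx hx'
  obtain ⟨s, hs, e⟩ := mem_segment_iff.1 hx
  obtain ⟨t, ht, e'⟩ := mem_segment_iff.1 hx'
  rcases h.inj_closed hs ht (e.trans e'.symm) with h | h | h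
  · exact h0 h.1
  · exact h1 h.1
  · exact h2 h.1

/-- Consecutive edges do not point in opposite directions. -/
lemma zero_notMem_segment (h : IsSimpleLoop n V) (j : ℤ) :
    (0 : ℂ) ∉ segment ℝ (V (j + 1) - V j) (V (j + 1 + 1) - V (j + 1)) := by
  rw [segment_eq_image']
  rintro ⟨s, hs, e⟩
  have e' : V (j + 1) + (s : ℂ) * (V (j + 1 + 1) - V (j + 1)) =
      V j + s * (V (j + 1) - V j) := by
    simp only [Complex.real_smul] at e
    linear_combination e
  have h3 := h.three_le
  rcases h.inj_closed hs hs e' with h' | h' | h'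
  · exact h.not_dvd one_pos (by omega) (by simpa using h'.1)
  · linarith [h'.2.1, h'.2.2]
  · linarith [h'.2.1, h'.2.2]

/-- The exterior angle at the vertex `j`. -/
noncomputable def turn (V : ℤ → ℂ) (j : ℤ) : ℝ := ((V (j + 1) - V j) / (V j - V (j - 1))).arg

lemma pred_edge_ne_zero (h : IsSimpleLoop n V) (i : ℤ) : V i - V (i - 1) ≠ 0 := by
  simpa using h.edge_ne_zero (i - 1)

lemma turn_lt_pi (h : IsSimpleLoop n V) (j : ℤ) : turn V j < Real.pi := by
  refine lt_of_le_of_ne (Complex.arg_le_pi _) fun e => ?_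
  rw [turn, Complex.arg_eq_pi_iff] at e
  have h1 := h.zero_notMem_segment (j - 1)
  rw [sub_add_cancel] at h1
  apply h1
  set p := V j - V (j - 1) with hp
  set r := V (j + 1) - V j with hr
  have hp0 : p ≠ 0 := h.pred_edge_ne_zero j
  set c := (r / p).re
  have hrc : r = c * p := by
    rw [← div_eq_iff hp0]
    exact Complex.ext (by simp [c]) (by simp [e.2])
  have hc : c < 0 := e.1
  rw [segment_eq_image']
  -- The solution `s` of `p + s (c p - p) = 0`.
  refine ⟨1 / (1 - c), ⟨by apply div_nonneg <;> linarith, by rw [div_le_one] <;> linarith⟩, ?_⟩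
  have : (1 - c : ℂ) ≠ 0 := by exact_mod_cast (by linarith : (1 - c) ≠ 0)
  simp only [hrc, Complex.real_smul]
  push_cast
  field_simp
  ring

lemma neg_pi_lt_turn (V : ℤ → ℂ) (j : ℤ) : -Real.pi < turn V j := Complex.neg_pi_lt_arg _

section Hopf

/-- A lift of the argument of the secant `V i - V j` of a simple loop. -/
noncomputable def secantLift (V : ℤ → ℂ) (i j : ℕ) : ℝ :=
  ∑ k ∈ Finset.range j, turn V (k + 1) +
    ∑ m ∈ Finset.Ico (j + 1) i, ((V (m + 1) - V j) / (V m - V j)).arg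

lemma secantLift_succ_left {i j : ℕ} (hij : j < i) :
    secantLift V (i + 1) j = secantLift V i j + ((V (i + 1) - V j) / (V i - V j)).arg := by
  rw [secantLift, secantLift, Finset.sum_Ico_succ_top (by omega), add_assoc]

/-- The lift does not depend on the path along which it is summed: triangles at the diagonal
(`arg_add_triangle`) and squares off it (`arg_secant_square`) close up. The condition `hi'` excludes
only the pair `(n, 0)`, whose secant is zero. -/
lemma secantLift_succ_right (h : IsSimpleLoop n V) {i j : ℕ} (hij : j + 1 < i)
    (hi : i ≤ n) (hi' : i < n ∨ 0 < j) :
    secantLift V i (j + 1) = secantLift V i j + ((V i - V (j + 1)) / (V i - V j)).arg := by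
  induction i, hij using Nat.le_induction with
  | base =>
    change secantLift V (j + 1 + 1) (j + 1) = secantLift V (j + 1 + 1) j + _
    rw [secantLift_succ_left (i := j + 1) (j := j) (by omega)]
    have key := arg_add_triangle (h.zero_notMem_segment j)
    have h1 : secantLift V (j + 1) j = ∑ k ∈ Finset.range j, turn V (k + 1) := by
      simp [secantLift]
    have h2 : secantLift V (j + 1 + 1) (j + 1) = ∑ k ∈ Finset.range (j + 1), turn V (k + 1) := by
      simp [secantLift]
    rw [h1, h2, Finset.sum_range_succ, turn]
    have e : V (j + 1) - V j + (V (j + 1 + 1) - V (j + 1)) = V (j + 1 + 1) - V j := by ring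
    rw [e] at key
    push_cast
    rw [add_sub_cancel_right]
    linarith
  | succ i hle ih =>
    rw [secantLift_succ_left (by omega), secantLift_succ_left (by omega),
      ih (by omega) (by omega)]
    have hd := h.disjoint_segment (i := i) (j := j)
      (h.not_dvd (by lia) (by lia))
      (h.not_dvd (by lia) (by lia))
      (h.not_dvd (by lia) (by lia))
    have := arg_secant_square hd
    push_cast at this ⊢
    linarith

/-- With `z` the quotient of the two edge vectors that leave vertex `0`, the three terms are the two
steps around the degenerate pair `(n, 0)` and the turn at vertex `0`. -/
lemma arg_closing {z : ℂ} (hz : 0 < z.im) :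
    ((z - 1) / z).arg + (-1 / (z - 1)).arg + (-1 / z).arg = 2 * Real.pi - 2 * z.arg := by
  have h1 : ∀ w : ℂ, 0 < w.im → (-1 / w).arg = Real.pi - w.arg := fun w hw => by
    have hw0 : w ≠ 0 := by rintro rfl; simp at hw
    have h2 := Complex.arg_nonneg_iff.2 hw.le
    rw [arg_div_eq_sub (by simp) hw0, Complex.arg_neg_one]
    rw [Complex.arg_neg_one]
    constructor <;> linarith [Complex.arg_le_pi w, Real.pi_pos]
  have hz1 : 0 < (z - 1).im := by simpa using hz
  have hz0 : z ≠ 0 := by rintro rfl; simp at hz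
  have hz10 : z - 1 ≠ 0 := by intro e; rw [e] at hz1; simp at hz1
  have a1 := Complex.arg_nonneg_iff.2 hz.le
  have a2 := Complex.arg_nonneg_iff.2 hz1.le
  have b1 : z.arg < Real.pi := lt_of_le_of_ne (Complex.arg_le_pi z) fun e => by
    rw [Complex.arg_eq_pi_iff] at e; linarith [e.2]
  rw [h1 _ hz, h1 _ hz1, arg_div_eq_sub hz10 hz0]
  · ring
  · constructor <;> linarith [Complex.arg_le_pi (z - 1)]

/-- **Umlaufsatz** for polygons: the exterior angles of a simple polygon that is traversed
counterclockwise add up to `2π`. The vertex `0` is a lowest one. -/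
theorem sum_turn (h : IsSimpleLoop n V)
    (hlow : ∀ j : ℕ, 0 < j → j < n → 0 ≤ (V j - V 0).arg ∧ (V j - V 0).arg < Real.pi)
    (hleft : 0 < ((V (-1) - V 0) / (V 1 - V 0)).im) :
    ∑ j ∈ Finset.range n, turn V j = 2 * Real.pi := by
  have h3 := h.three_le
  have hn1 : V (n - 1 : ℕ) = V (-1) := h.eq_of_dvd ⟨1, by push_cast [show 1 ≤ n by omega]; ring⟩
  have hn : V (n : ℕ) = V 0 := h.eq_of_dvd ⟨1, by ring⟩
  have hne : ∀ j : ℕ, 0 < j → j < n → V j - V 0 ≠ 0 := fun j h0 hj e =>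
    h.not_dvd (k := j) (by omega) (by omega) (by simpa using h.dvd_of_eq (sub_eq_zero.1 e))
  have hdiv : ∀ i j : ℕ, 0 < i → i < n → 0 < j → j < n →
      ((V i - V 0) / (V j - V 0)).arg = (V i - V 0).arg - (V j - V 0).arg :=
    fun i j hi hi' hj hj' => arg_div_eq_sub (hne i hi hi') (hne j hj hj')
      ⟨by linarith [hlow i hi hi', hlow j hj hj'], by linarith [hlow i hi hi', hlow j hj hj']⟩
  -- On the diagonal the secants are the edges, so the lift is a partial sum of turns. It is now
  -- evaluated along the other two sides of the triangle of index pairs.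
  have s1 : secantLift V n (n - 1) = ∑ k ∈ Finset.range (n - 1), turn V (k + 1) := by
    rw [secantLift, show n - 1 + 1 = n by omega]; simp
  -- The secants between vertex `m` and vertex `n`, which is `0` again, are up to sign those from
  -- `0` to `m`. By `hlow` the latter have arguments in `[0, π)`, so the increments telescope
  -- without a jump by `2π`. The same holds in `row`.
  have col : ∀ m : ℕ, 1 ≤ m → m < n → secantLift V n m - secantLift V n 1 =
      (V m - V 0).arg - (V 1 - V 0).arg := by
    intro m hm
    induction m, hm using Nat.le_induction with
    | base => intro _; simp
    | succ m hm ih =>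
      intro hmn
      rw [h.secantLift_succ_right (by omega) le_rfl (Or.inr (by omega)), hn]
      have e := hdiv (m + 1) m (by omega) hmn (by omega) (by omega)
      have : (V 0 - V (m + 1)) / (V 0 - V m) = (V (m + 1 : ℕ) - V 0) / (V m - V 0) := by
        rw [← neg_sub (V (m + 1)), ← neg_sub (V m), neg_div_neg_eq]; push_cast; rfl
      rw [this, e]
      have := ih (by omega)
      linarith
  have row : ∀ m : ℕ, 1 ≤ m → m < n → secantLift V m 0 =
      (V m - V 0).arg - (V 1 - V 0).arg := by
    intro m hm
    induction m, hm using Nat.le_induction with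
    | base => intro _; simp [secantLift]
    | succ m hm ih =>
      intro hmn
      rw [secantLift_succ_left (by omega), ih (by omega)]
      have e := hdiv (m + 1) m (by omega) hmn (by omega) (by omega)
      push_cast at e ⊢
      rw [e]; ring
  have c1 := col (n - 1) (by omega) (by omega)
  have r1 := row (n - 1) (by omega) (by omega)
  -- The detour around the pair `(n, 0)`: from `(n - 1, 0)` to `(n - 1, 1)` and on to `(n, 1)`.
  have st1 := h.secantLift_succ_right (i := n - 1) (j := 0) (by omega) (by omega)
    (Or.inl (by omega))
  have st2 : secantLift V (n - 1 + 1) 1 = _ := secantLift_succ_left (V := V) (i := n - 1) (j := 1)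
    (by omega)
  have hnn : ((n - 1 : ℕ) : ℤ) + 1 = n := by omega
  have e1 := hdiv (n - 1) 1 (by omega) (by omega) (by omega) (by omega)
  rw [show n - 1 + 1 = n by omega, hnn, hn, hn1] at st2
  rw [hn1] at st1 c1 r1 e1
  have hsum : ∑ j ∈ Finset.range n, turn V j =
      turn V 0 + ∑ k ∈ Finset.range (n - 1), turn V (k + 1) := by
    conv_lhs => rw [show n = n - 1 + 1 by omega, Finset.sum_range_succ']
    push_cast; ring
  have hb0 : V (-1) - V 0 ≠ 0 := by rw [← hn1]; exact hne _ (by omega) (by omega)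
  have ha0 : V 1 - V 0 ≠ 0 := by exact_mod_cast hne 1 (by omega) (by omega)
  have cl := arg_closing hleft
  have hba : (V (-1) - V 1) = (V (-1) - V 0) - (V 1 - V 0) := by ring
  have hz1 : (V (-1) - V 0) - (V 1 - V 0) ≠ 0 := by
    rw [← hba]; intro e
    exact h.not_dvd (k := 2) (by omega) (by omega)
      (by rw [← dvd_neg]; exact_mod_cast h.dvd_of_eq (sub_eq_zero.1 e))
  have q1 : (((V (-1) - V 0) / (V 1 - V 0)) - 1) / ((V (-1) - V 0) / (V 1 - V 0)) =
      (V (-1) - V 1) / (V (-1) - V 0) := by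
    rw [hba]; field_simp
  have q2 : -1 / (((V (-1) - V 0) / (V 1 - V 0)) - 1) = (V 0 - V 1) / (V (-1) - V 1) := by
    rw [hba, div_sub_one ha0, div_div_eq_mul_div, ← neg_sub (V 1) (V 0)]; ring
  have q3 : -1 / ((V (-1) - V 0) / (V 1 - V 0)) = (V 1 - V 0) / (V 0 - V (-1)) := by
    rw [div_div_eq_mul_div, ← neg_sub (V (-1)) (V 0), div_neg]; ring
  rw [q1, q2, q3] at cl
  have ht0 : turn V 0 = ((V 1 - V 0) / (V 0 - V (-1))).arg := by simp [turn]
  rw [hsum, ht0, ← s1]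
  push_cast at *
  linarith

end Hopf

end IsSimpleLoop

end Billiard

/-! ### Neighbourhoods of vertices and edges of a simple loop -/

namespace Billiard

open Filter Topology

namespace IsSimpleLoop

variable {n : ℕ} {V : ℤ → ℂ}

/-- The closed curve that runs through the vertices `V i` in cyclic order. -/
def loopCurve (V : ℤ → ℂ) : Set ℂ := ⋃ i, segment ℝ (V i) (V (i + 1))

/-- The polar angle of the edge from `V j` to `V (j + 1)`. -/
noncomputable def edgeArg (V : ℤ → ℂ) (j : ℤ) : ℝ := (V (j + 1) - V j).arg

lemma segment_eq_of_dvd (h : IsSimpleLoop n V) {i j : ℤ} (hd : (n : ℤ) ∣ i - j) :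
    segment ℝ (V i) (V (i + 1)) = segment ℝ (V j) (V (j + 1)) := by
  rw [h.eq_of_dvd hd, h.eq_of_dvd (i := i + 1) (j := j + 1) (by simpa using hd)]

lemma isClosed_segment (x y : ℂ) : IsClosed (segment ℝ x y) := by
  rw [segment_eq_image_lineMap]
  exact (isCompact_Icc.image AffineMap.lineMap_continuous).isClosed

lemma n_pos (h : IsSimpleLoop n V) : (0 : ℤ) < n := by have := h.three_le; omega

lemma loopCurve_eq (h : IsSimpleLoop n V) :
    loopCurve V = ⋃ i ∈ Finset.range n, segment ℝ (V i) (V (i + 1)) := by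
  apply subset_antisymm
  · refine iUnion_subset fun i => ?_
    have h0 := Int.emod_nonneg i h.n_pos.ne'
    have h1 := Int.emod_lt_of_pos i h.n_pos
    have e : ((i % n).toNat : ℤ) = i % n := Int.toNat_of_nonneg h0
    rw [h.segment_eq_of_dvd (i := i) (j := (i % n).toNat)
      (by rw [e]; exact Int.dvd_self_sub_emod)]
    exact subset_biUnion_of_mem (u := fun i : ℕ => segment ℝ (V i) (V (i + 1)))
      (Finset.mem_coe.2 (Finset.mem_range.2 (by omega)))
  · exact iUnion₂_subset fun i _ => subset_iUnion (fun i => segment ℝ (V i) (V (i + 1))) (i : ℤ)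

/-- Near a point only the edges through that point appear. -/
lemma eventually_mem_segment (h : IsSimpleLoop n V) (x : ℂ) :
    ∀ᶠ y in 𝓝 x, ∀ i, y ∈ segment ℝ (V i) (V (i + 1)) → x ∈ segment ℝ (V i) (V (i + 1)) := by
  have key : ∀ᶠ y in 𝓝 x, ∀ i ∈ Finset.Ico (0 : ℤ) n, y ∈ segment ℝ (V i) (V (i + 1)) →
      x ∈ segment ℝ (V i) (V (i + 1)) := by
    rw [Filter.eventually_all_finset]
    intro i _
    by_cases hx : x ∈ segment ℝ (V i) (V (i + 1))
    · exact Eventually.of_forall fun _ _ => hx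
    · filter_upwards [(isClosed_segment _ _).isOpen_compl.mem_nhds hx] with y hy hy'
      exact absurd hy' hy
  filter_upwards [key] with y hy i hi
  have hd : (n : ℤ) ∣ i - i % n := Int.dvd_self_sub_emod
  rw [h.segment_eq_of_dvd hd] at hi ⊢
  exact hy _ (Finset.mem_Ico.2 ⟨Int.emod_nonneg i h.n_pos.ne', Int.emod_lt_of_pos i h.n_pos⟩) hi

lemma vertex_mem_segment (h : IsSimpleLoop n V) {i j : ℤ}
    (hm : V j ∈ segment ℝ (V i) (V (i + 1))) :
    (n : ℤ) ∣ i - j ∨ (n : ℤ) ∣ i - (j - 1) := by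
  obtain ⟨s, hs, e⟩ := mem_segment_iff.1 hm
  rcases h.inj_closed (j := j) (t := 0) hs (by simp) (by simpa using e) with h' | h' | h'
  · exact Or.inl h'.1
  · right; convert h'.1 using 1; ring
  · norm_num at h'

lemma edge_eq (_h : IsSimpleLoop n V) (j : ℤ) :
    V (j + 1) - V j = ‖V (j + 1) - V j‖ * Complex.exp (edgeArg V j * Complex.I) :=
  (Complex.norm_mul_exp_arg_mul_I _).symm

lemma norm_edge_pos (h : IsSimpleLoop n V) (j : ℤ) : 0 < ‖V (j + 1) - V j‖ :=
  norm_pos_iff.2 (h.edge_ne_zero j)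

/-- The angles `edgeArg V j` and `edgeArg V (j - 1) + turn V j` agree only modulo `2π`, so they are
compared after exponentiation. -/
lemma exp_edgeArg (h : IsSimpleLoop n V) (j : ℤ) :
    Complex.exp (edgeArg V j * Complex.I) =
      Complex.exp (edgeArg V (j - 1) * Complex.I) * Complex.exp (turn V j * Complex.I) := by
  have h1 := h.edge_eq j
  have h2 := h.edge_eq (j - 1)
  rw [sub_add_cancel] at h2
  have h3 : (V (j + 1) - V j) / (V j - V (j - 1)) = ‖(V (j + 1) - V j) / (V j - V (j - 1))‖ *
    Complex.exp (turn V j * Complex.I) := (Complex.norm_mul_exp_arg_mul_I _).symm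
  have p1 : (‖V (j + 1) - V j‖ : ℂ) ≠ 0 := by simpa using h.edge_ne_zero j
  have p2 : (‖V j - V (j - 1)‖ : ℂ) ≠ 0 := by simpa using h.pred_edge_ne_zero j
  rw [div_eq_iff (h.pred_edge_ne_zero j), norm_div, h1] at h3
  rw [h2] at h3
  simp only [norm_mul, Complex.norm_exp_ofReal_mul_I, Complex.norm_real, norm_norm,
    mul_one] at h3
  push_cast at h3
  field_simp at h3
  rw [h3, mul_comm, mul_comm Complex.I, mul_comm Complex.I]

/-- `ε = ±1` distinguishes the two sides of an oriented edge. -/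
lemma exp_side {ε : ℝ} (hε : ε = 1 ∨ ε = -1) (φ θ : ℝ) :
    Complex.exp ((φ + ε * θ : ℝ) * Complex.I) =
      Complex.exp (φ * Complex.I) * (Real.cos θ + ε * Real.sin θ * Complex.I) := by
  push_cast
  rw [add_mul, Complex.exp_add]
  congr 1
  rcases hε with rfl | rfl
  · simp [Complex.exp_mul_I]
  · have := Complex.exp_mul_I (-θ : ℂ)
    rw [Complex.cos_neg, Complex.sin_neg] at this
    push_cast
    rw [neg_one_mul, this]
    ring

lemma cos_eq_of_mul_eq {ε s c θ : ℝ} (hε : ε = 1 ∨ ε = -1) (hs : 0 < s)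
    (e : (s : ℂ) * (Real.cos θ + ε * Real.sin θ * Complex.I) = c) :
    Real.sin θ = 0 ∧ s * Real.cos θ = c := by
  have h1 := congrArg Complex.re e
  have h2 := congrArg Complex.im e
  simp [-Complex.ofReal_cos, -Complex.ofReal_sin] at h1 h2
  refine ⟨?_, h1⟩
  rcases h2 with h2 | h2 | h2
  · exact absurd h2 hs.ne'
  · rcases hε with rfl | rfl <;> norm_num at h2
  · exact h2

/-- Near `V j` only the two edges at `V j` matter. Measured from the outgoing edge towards the side
`ε`, they lie at the angles `0` and `π - ε * turn V j`, and the sector is strictly between. -/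
lemma sector_notMem_curve (h : IsSimpleLoop n V) {ε : ℝ} (hε : ε = 1 ∨ ε = -1) (j : ℤ) :
    ∃ r > (0 : ℝ), ∀ s ∈ Ioo (0 : ℝ) r, ∀ θ ∈ Ioo (0 : ℝ) (Real.pi - ε * turn V j),
      V j + s * Complex.exp ((edgeArg V j + ε * θ : ℝ) * Complex.I) ∈ (loopCurve V)ᶜ := by
  obtain ⟨r, hr, hball⟩ := Metric.eventually_nhds_iff.1 (h.eventually_mem_segment (V j))
  refine ⟨r, hr, fun s hs θ hθ hmem => ?_⟩
  obtain ⟨i, hi⟩ := mem_iUnion.1 hmem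
  have hd : dist (V j + s * Complex.exp ((edgeArg V j + ε * θ : ℝ) * Complex.I)) (V j) < r := by
    rw [dist_self_add_left, norm_mul, Complex.norm_exp_ofReal_mul_I]
    simpa [abs_of_pos hs.1] using hs.2
  have hε2 : ε * ε = 1 := by rcases hε with rfl | rfl <;> norm_num
  have hετ : |ε * turn V j| < Real.pi := by
    have h1 : |turn V j| < Real.pi := abs_lt.2 ⟨neg_pi_lt_turn V j, h.turn_lt_pi j⟩
    rcases hε with rfl | rfl <;> simpa using h1
  rw [abs_lt] at hετ
  rcases h.vertex_mem_segment (hball hd i hi) with hij | hij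
  · rw [h.segment_eq_of_dvd hij] at hi
    obtain ⟨u, hu, e⟩ := mem_segment_iff.1 hi
    rw [h.edge_eq j, exp_side hε] at e
    have e2 := mul_right_cancel₀ (Complex.exp_ne_zero (edgeArg V j * Complex.I))
      (show (s * (Real.cos θ + ε * Real.sin θ * Complex.I)) *
        Complex.exp (edgeArg V j * Complex.I) =
        ((u * ‖V (j + 1) - V j‖ : ℝ) : ℂ) * Complex.exp (edgeArg V j * Complex.I) by
          push_cast at e ⊢; linear_combination -e)
    obtain ⟨h1, h2⟩ := cos_eq_of_mul_eq hε hs.1 e2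
    have h3 : 0 ≤ Real.cos θ := by
      have : 0 ≤ s * Real.cos θ := h2 ▸ mul_nonneg hu.1 (norm_nonneg _)
      exact nonneg_of_mul_nonneg_right this hs.1
    have h4 : Real.cos θ = 1 := by nlinarith [Real.sin_sq_add_cos_sq θ]
    have := (Real.cos_eq_one_iff_of_lt_of_lt (by linarith [hθ.1, Real.pi_pos])
      (by linarith [hθ.2])).1 h4
    exact hθ.1.ne' this
  · rw [h.segment_eq_of_dvd hij] at hi
    obtain ⟨u, hu, e⟩ := mem_segment_iff.1 hi
    have e0 := h.edge_eq (j - 1)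
    rw [sub_add_cancel] at e e0
    have e1 : Complex.exp ((edgeArg V j + ε * θ : ℝ) * Complex.I) =
        Complex.exp (edgeArg V (j - 1) * Complex.I) * (Real.cos (θ + ε * turn V j) +
          ε * Real.sin (θ + ε * turn V j) * Complex.I) := by
      rw [← exp_side hε]
      have : edgeArg V (j - 1) + ε * (θ + ε * turn V j) =
        edgeArg V (j - 1) + turn V j + ε * θ := by linear_combination turn V j * hε2
      rw [this]
      push_cast
      rw [add_mul, Complex.exp_add, h.exp_edgeArg j, add_mul _ _ Complex.I, Complex.exp_add,
        add_mul _ _ Complex.I, Complex.exp_add]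
    have e2 := mul_right_cancel₀ (Complex.exp_ne_zero (edgeArg V (j - 1) * Complex.I))
      (show (s * (Real.cos (θ + ε * turn V j) + ε * Real.sin (θ + ε * turn V j) * Complex.I)) *
        Complex.exp (edgeArg V (j - 1) * Complex.I) =
        (((u - 1) * ‖V j - V (j - 1)‖ : ℝ) : ℂ) * Complex.exp (edgeArg V (j - 1) * Complex.I) by
          push_cast
          rw [e1] at e
          push_cast at e
          linear_combination -e + (u - 1) * e0)
    obtain ⟨h1, h2⟩ := cos_eq_of_mul_eq hε hs.1 e2
    have h3 : Real.cos (θ + ε * turn V j) ≤ 0 := by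
      have : s * Real.cos (θ + ε * turn V j) ≤ 0 :=
        h2 ▸ mul_nonpos_of_nonpos_of_nonneg (by linarith [hu.2]) (norm_nonneg _)
      exact nonpos_of_mul_nonpos_right this hs.1
    -- The bounds on `θ` put the angle shifted by `π` into `(0, 2π)`, where the cosine is never `1`.
    have h4 : Real.cos (θ + ε * turn V j + Real.pi) = 1 := by
      rw [Real.cos_add_pi]
      nlinarith [Real.sin_sq_add_cos_sq (θ + ε * turn V j)]
    have := (Real.cos_eq_one_iff_of_lt_of_lt (by linarith [hθ.1, Real.pi_pos])
      (by linarith [hθ.2])).1 h4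
    linarith [hθ.1, hετ.1]

lemma edge_point_mem (h : IsSimpleLoop n V) {j : ℤ} {ρ : ℝ}
    (hρ : ρ ∈ Ioo 0 ‖V (j + 1) - V j‖) {i : ℤ}
    (hm : V j + ρ * Complex.exp (edgeArg V j * Complex.I) ∈ segment ℝ (V i) (V (i + 1))) :
    (n : ℤ) ∣ i - j := by
  obtain ⟨s, hs, e⟩ := mem_segment_iff.1 hm
  have hd := h.norm_edge_pos j
  have hd' : (‖V (j + 1) - V j‖ : ℂ) ≠ 0 := by exact_mod_cast hd.ne'
  have e0 := h.edge_eq j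
  have h1 : 0 < ρ / ‖V (j + 1) - V j‖ := div_pos hρ.1 hd
  have h2 : ρ / ‖V (j + 1) - V j‖ < 1 := (div_lt_one hd).2 hρ.2
  rcases h.inj_closed (j := j) (t := ρ / ‖V (j + 1) - V j‖) hs ⟨h1.le, h2.le⟩ (by
    rw [e, h.edge_eq j]
    simp only [norm_mul, Complex.norm_exp_ofReal_mul_I, Complex.norm_real, norm_norm, mul_one]
    push_cast
    field_simp) with h' | h' | h'
  · exact h'.1
  · exact absurd h'.2.2 h1.ne'
  · exact absurd h'.2.2 h2.ne

/-- A point on the line through an edge cannot be moved off it and stay on it. -/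
lemma offset_notMem_segment (h : IsSimpleLoop n V) (j : ℤ) (ρ t : ℝ) (ht : t ≠ 0) :
    V j + (ρ + t * Complex.I) * Complex.exp (edgeArg V j * Complex.I) ∉
      segment ℝ (V j) (V (j + 1)) := by
  intro hm
  obtain ⟨u, hu, e⟩ := mem_segment_iff.1 hm
  rw [h.edge_eq j] at e
  have e2 := mul_right_cancel₀ (Complex.exp_ne_zero (edgeArg V j * Complex.I))
    (show (ρ + t * Complex.I) * Complex.exp (edgeArg V j * Complex.I) =
      ((u * ‖V (j + 1) - V j‖ : ℝ) : ℂ) * Complex.exp (edgeArg V j * Complex.I) by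
        push_cast; linear_combination -e)
  have := congrArg Complex.im e2
  simp at this
  exact ht this

lemma halfDisc_notMem_curve (h : IsSimpleLoop n V) {ε : ℝ} (hε : ε = 1 ∨ ε = -1) (j : ℤ)
    {ρ : ℝ} (hρ : ρ ∈ Ioo 0 ‖V (j + 1) - V j‖) :
    ∃ r > (0 : ℝ), ∀ s ∈ Ioo (0 : ℝ) r, ∀ θ ∈ Ioo (0 : ℝ) Real.pi,
      V j + ρ * Complex.exp (edgeArg V j * Complex.I) +
        s * Complex.exp ((edgeArg V j + ε * θ : ℝ) * Complex.I) ∈ (loopCurve V)ᶜ := by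
  obtain ⟨r, hr, hball⟩ := Metric.eventually_nhds_iff.1
    (h.eventually_mem_segment (V j + ρ * Complex.exp (edgeArg V j * Complex.I)))
  refine ⟨r, hr, fun s hs θ hθ hmem => ?_⟩
  obtain ⟨i, hi⟩ := mem_iUnion.1 hmem
  have hd : dist (V j + ρ * Complex.exp (edgeArg V j * Complex.I) +
      s * Complex.exp ((edgeArg V j + ε * θ : ℝ) * Complex.I))
      (V j + ρ * Complex.exp (edgeArg V j * Complex.I)) < r := by
    rw [dist_self_add_left, norm_mul, Complex.norm_exp_ofReal_mul_I]
    simpa [abs_of_pos hs.1] using hs.2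
  have hij := h.edge_point_mem hρ (hball hd i hi)
  rw [h.segment_eq_of_dvd hij, exp_side hε] at hi
  have hsin := Real.sin_pos_of_pos_of_lt_pi hθ.1 hθ.2
  refine h.offset_notMem_segment j (ρ + s * Real.cos θ) (ε * (s * Real.sin θ)) ?_ ?_
  · have := mul_pos hs.1 hsin
    rcases hε with rfl | rfl <;> simp <;> exact ⟨hs.1.ne', hsin.ne'⟩
  · convert hi using 1
    push_cast
    ring

/-- Parallel translates of a piece of an edge avoid the curve. -/
lemma eventually_strip (h : IsSimpleLoop n V) {ε : ℝ} (hε : ε = 1 ∨ ε = -1) (j : ℤ)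
    {ρ₁ ρ₂ : ℝ} (h₁ : ρ₁ ∈ Ioo 0 ‖V (j + 1) - V j‖) (h₂ : ρ₂ ∈ Ioo 0 ‖V (j + 1) - V j‖) :
    ∀ᶠ t : ℝ in 𝓝[>] 0, ∀ ρ ∈ uIcc ρ₁ ρ₂,
      V j + (ρ + (ε * t : ℝ) * Complex.I) * Complex.exp (edgeArg V j * Complex.I) ∈
        (loopCurve V)ᶜ := by
  set K := (fun ρ : ℝ => V j + ρ * Complex.exp (edgeArg V j * Complex.I)) '' uIcc ρ₁ ρ₂
  have hK : IsCompact K := isCompact_uIcc.image (by fun_prop)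
  -- The other edges form a closed set disjoint from the compact piece `K`, so small translates of
  -- `K` miss them. Edge `j` itself is missed because a translate leaves its line.
  set E := ⋃ i ∈ (Finset.range n).filter fun i : ℕ => ¬ (n : ℤ) ∣ i - j,
    segment ℝ (V i) (V (i + 1))
  have hE : IsClosed E := isClosed_biUnion_finset fun i _ => isClosed_segment _ _
  have hsub : uIcc ρ₁ ρ₂ ⊆ Ioo 0 ‖V (j + 1) - V j‖ := by
    rw [uIcc]; exact (Icc_subset_Ioo (lt_min h₁.1 h₂.1) (max_lt h₁.2 h₂.2))
  have hKE : K ⊆ Eᶜ := by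
    rintro _ ⟨ρ, hρ, rfl⟩ hmem
    simp only [E, mem_iUnion, Finset.mem_filter] at hmem
    obtain ⟨i, ⟨_, hi⟩, hmem⟩ := hmem
    exact hi (h.edge_point_mem (hsub hρ) hmem)
  obtain ⟨δ, hδ, hthick⟩ := hK.exists_thickening_subset_open hE.isOpen_compl hKE
  filter_upwards [Ioo_mem_nhdsGT hδ] with t ht ρ hρ hmem
  have hx : V j + (ρ + (ε * t : ℝ) * Complex.I) * Complex.exp (edgeArg V j * Complex.I) ∉ E := by
    apply hthick
    rw [Metric.mem_thickening_iff]
    refine ⟨_, ⟨ρ, hρ, rfl⟩, ?_⟩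
    rw [dist_eq_norm, show ∀ a b c d : ℂ, a + (b + c) * d - (a + b * d) = c * d by intros; ring,
      norm_mul, Complex.norm_exp_ofReal_mul_I]
    rcases hε with rfl | rfl <;> simpa [abs_of_pos ht.1] using ht.2
  rw [h.loopCurve_eq] at hmem
  simp only [mem_iUnion] at hmem
  obtain ⟨i, hi, hmem⟩ := hmem
  by_cases hij : (n : ℤ) ∣ i - j
  · rw [h.segment_eq_of_dvd hij] at hmem
    refine h.offset_notMem_segment j ρ (ε * t) ?_ hmem
    rcases hε with rfl | rfl <;> simp [ht.1.ne']
  · exact hx (mem_biUnion (x := i) (Finset.mem_coe.2 (Finset.mem_filter.2 ⟨hi, hij⟩)) hmem)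

end IsSimpleLoop

end Billiard

/-! ### Each side of a simple loop lies in one component -/

namespace Billiard

open Filter Topology

namespace IsSimpleLoop

variable {n : ℕ} {V : ℤ → ℂ}

/-- The component of the complement of the curve that contains `x`. -/
def comp (V : ℤ → ℂ) (x : ℂ) : Set ℂ := connectedComponentIn (loopCurve V)ᶜ x

lemma comp_eq {S : Set ℂ} (hS : IsPreconnected S) (hSU : S ⊆ (loopCurve V)ᶜ) {x y : ℂ}
    (hx : x ∈ S) (hy : y ∈ S) : comp V x = comp V y :=
  connectedComponentIn_eq (hS.subset_connectedComponentIn hx hSU hy)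

/-- The region is the continuous image of a rectangle of polar coordinates, hence connected. -/
lemma exists_comp_of_polar {c : ℂ} {φ ε r a : ℝ} (hr : 0 < r) (ha : 0 < a)
    (hU : ∀ s ∈ Ioo 0 r, ∀ θ ∈ Ioo 0 a,
      c + s * Complex.exp ((φ + ε * θ : ℝ) * Complex.I) ∈ (loopCurve V)ᶜ) :
    ∃ C, ∀ s ∈ Ioo 0 r, ∀ θ ∈ Ioo 0 a,
      c + s * Complex.exp ((φ + ε * θ : ℝ) * Complex.I) ∈ C ∧
      comp V (c + s * Complex.exp ((φ + ε * θ : ℝ) * Complex.I)) = C := by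
  set f : ℝ × ℝ → ℂ := fun p => c + p.1 * Complex.exp ((φ + ε * p.2 : ℝ) * Complex.I)
  have hpre : IsPreconnected (f '' (Ioo 0 r ×ˢ Ioo 0 a)) :=
    (isPreconnected_Ioo.prod isPreconnected_Ioo).image f (by fun_prop)
  have hsub : f '' (Ioo 0 r ×ˢ Ioo 0 a) ⊆ (loopCurve V)ᶜ := by
    rintro _ ⟨p, hp, rfl⟩; exact hU _ hp.1 _ hp.2
  have h0 : f (r / 2, a / 2) ∈ f '' (Ioo 0 r ×ˢ Ioo 0 a) :=
    mem_image_of_mem f ⟨⟨by simpa, by simpa⟩, ⟨by simpa, by simpa⟩⟩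
  refine ⟨comp V (f (r / 2, a / 2)), fun s hs θ hθ => ?_⟩
  have h1 : f (s, θ) ∈ f '' (Ioo 0 r ×ˢ Ioo 0 a) := mem_image_of_mem f ⟨hs, hθ⟩
  have h2 := comp_eq hpre hsub h1 h0
  exact ⟨h2 ▸ mem_connectedComponentIn (hsub h1), h2⟩

/-- The point at signed distance `ε * t` from the edge `j`. -/
noncomputable def offset (V : ℤ → ℂ) (ε : ℝ) (j : ℤ) (ρ t : ℝ) : ℂ :=
  V j + (ρ + (ε * t : ℝ) * Complex.I) * Complex.exp (edgeArg V j * Complex.I)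

/-- As `t` decreases to `0` the polar coordinates of `ρ + t i` tend to `(ρ, 0)`, so points slightly
off an edge enter every sector that begins at this edge, however thin. -/
lemma eventually_polar {r a ρ : ℝ} (ha : 0 < a) (hρ : ρ ∈ Ioo 0 r) :
    ∀ᶠ t : ℝ in 𝓝[>] 0, ∃ s ∈ Ioo 0 r, ∃ θ ∈ Ioo 0 a, ρ = s * Real.cos θ ∧
      t = s * Real.sin θ := by
  have h1 : Tendsto (fun t : ℝ => (ρ + t * Complex.I : ℂ)) (𝓝[>] 0) (𝓝 (ρ : ℂ)) := by
    have : ContinuousAt (fun t : ℝ => (ρ + t * Complex.I : ℂ)) 0 := by fun_prop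
    simpa using this.tendsto.mono_left nhdsWithin_le_nhds
  have h2 := h1.norm
  have h3 := (Complex.continuousAt_arg (x := (ρ : ℂ)) (by simp [hρ.1])).tendsto.comp h1
  rw [Complex.arg_ofReal_of_nonneg hρ.1.le] at h3
  have hρn : ‖(ρ : ℂ)‖ < r := by simpa [abs_of_pos hρ.1] using hρ.2
  filter_upwards [h2.eventually_lt_const hρn, h3.eventually_lt_const ha,
    self_mem_nhdsWithin] with t t1 t2 (t3 : 0 < t)
  set z : ℂ := ρ + t * Complex.I
  have hre : z.re = ρ := by simp [z]
  have him : z.im = t := by simp [z]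
  have hz : z ≠ 0 := by intro e; rw [e] at him; simp at him; exact t3.ne him
  refine ⟨‖z‖, ⟨norm_pos_iff.2 hz, t1⟩, z.arg, ⟨?_, t2⟩, ?_, ?_⟩
  · refine lt_of_le_of_ne (Complex.arg_nonneg_iff.2 (by rw [him]; exact t3.le)) fun e => ?_
    have := Complex.norm_mul_sin_arg z
    rw [← e, him] at this; simp at this; exact t3.ne this
  · rw [Complex.norm_mul_cos_arg, hre]
  · rw [Complex.norm_mul_sin_arg, him]

lemma pi_sub_turn_pos (h : IsSimpleLoop n V) {ε : ℝ} (hε : ε = 1 ∨ ε = -1) (j : ℤ) :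
    0 < Real.pi - ε * turn V j := by
  have h1 := h.turn_lt_pi j
  have h2 := neg_pi_lt_turn V j
  rcases hε with rfl | rfl <;> linarith

/-- All points close to the curve on one of its sides lie in one component. -/
theorem exists_side_component (h : IsSimpleLoop n V) {ε : ℝ} (hε : ε = 1 ∨ ε = -1) :
    ∃ C : Set ℂ,
      (∀ j, ∃ r > (0 : ℝ), ∀ s ∈ Ioo (0 : ℝ) r, ∀ θ ∈ Ioo (0 : ℝ) (Real.pi - ε * turn V j),
        V j + s * Complex.exp ((edgeArg V j + ε * θ : ℝ) * Complex.I) ∈ C ∧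
        comp V (V j + s * Complex.exp ((edgeArg V j + ε * θ : ℝ) * Complex.I)) = C) ∧
      ∀ j, ∀ ρ ∈ Ioo 0 ‖V (j + 1) - V j‖, ∃ r > (0 : ℝ), ∀ s ∈ Ioo (0 : ℝ) r,
        ∀ θ ∈ Ioo (0 : ℝ) Real.pi,
        V j + ρ * Complex.exp (edgeArg V j * Complex.I) +
          s * Complex.exp ((edgeArg V j + ε * θ : ℝ) * Complex.I) ∈ C ∧
        comp V (V j + ρ * Complex.exp (edgeArg V j * Complex.I) +
          s * Complex.exp ((edgeArg V j + ε * θ : ℝ) * Complex.I)) = C := by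
  have sec : ∀ j, ∃ r > (0 : ℝ), ∃ C, ∀ s ∈ Ioo (0 : ℝ) r,
      ∀ θ ∈ Ioo (0 : ℝ) (Real.pi - ε * turn V j),
        V j + s * Complex.exp ((edgeArg V j + ε * θ : ℝ) * Complex.I) ∈ C ∧
        comp V (V j + s * Complex.exp ((edgeArg V j + ε * θ : ℝ) * Complex.I)) = C := fun j => by
    obtain ⟨r, hr, hU⟩ := h.sector_notMem_curve hε j
    exact ⟨r, hr, exists_comp_of_polar hr (h.pi_sub_turn_pos hε j) hU⟩
  choose r hr C hC using sec
  have strip : ∀ j, ∀ ρ₁ ∈ Ioo 0 ‖V (j + 1) - V j‖, ∀ ρ₂ ∈ Ioo 0 ‖V (j + 1) - V j‖,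
      ∀ᶠ t : ℝ in 𝓝[>] 0, comp V (offset V ε j ρ₁ t) = comp V (offset V ε j ρ₂ t) := by
    intro j ρ₁ h₁ ρ₂ h₂
    filter_upwards [h.eventually_strip hε j h₁ h₂] with t ht
    refine comp_eq (S := (fun ρ : ℝ => offset V ε j ρ t) '' uIcc ρ₁ ρ₂) ?_ ?_ ?_ ?_
    · exact isPreconnected_uIcc.image _ (by unfold offset; fun_prop)
    · rintro _ ⟨ρ, hρ, rfl⟩; exact ht ρ hρ
    · exact mem_image_of_mem _ left_mem_uIcc
    · exact mem_image_of_mem _ right_mem_uIcc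
  -- Points close to the edge belong to the sector at `V j` just after its start and to the sector
  -- at `V (j + 1)` just before its end. A parallel segment from `strip` joins the two.
  have start : ∀ j, ∃ ρ ∈ Ioo 0 ‖V (j + 1) - V j‖,
      ∀ᶠ t : ℝ in 𝓝[>] 0, comp V (offset V ε j ρ t) = C j := by
    intro j
    have hm : 0 < min (r j) ‖V (j + 1) - V j‖ := lt_min (hr j) (h.norm_edge_pos j)
    have hρ : min (r j) ‖V (j + 1) - V j‖ / 2 ∈ Ioo 0 (r j) :=
      ⟨by linarith, by linarith [min_le_left (r j) ‖V (j + 1) - V j‖]⟩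
    refine ⟨_, ⟨hρ.1, by linarith [min_le_right (r j) ‖V (j + 1) - V j‖]⟩, ?_⟩
    filter_upwards [eventually_polar (h.pi_sub_turn_pos hε j) hρ] with t ⟨s, hs, θ, hθ, e1, e2⟩
    rw [← (hC j s hs θ hθ).2, offset, exp_side hε, e1, e2]
    congr 2
    push_cast; ring
  have terminal : ∀ j, ∃ ρ ∈ Ioo 0 ‖V (j + 1) - V j‖,
      ∀ᶠ t : ℝ in 𝓝[>] 0, comp V (offset V ε j ρ t) = C (j + 1) := by
    intro j
    have hm : 0 < min (r (j + 1)) ‖V (j + 1) - V j‖ := lt_min (hr _) (h.norm_edge_pos j)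
    have hρ : min (r (j + 1)) ‖V (j + 1) - V j‖ / 2 ∈ Ioo 0 (r (j + 1)) :=
      ⟨by linarith, by linarith [min_le_left (r (j + 1)) ‖V (j + 1) - V j‖]⟩
    set ρ := min (r (j + 1)) ‖V (j + 1) - V j‖ / 2
    refine ⟨‖V (j + 1) - V j‖ - ρ, ⟨?_, by linarith [hρ.1]⟩, ?_⟩
    · simp only [ρ]; linarith [min_le_right (r (j + 1)) ‖V (j + 1) - V j‖]
    filter_upwards [eventually_polar (h.pi_sub_turn_pos hε (j + 1)) hρ] with
      t ⟨s, hs, θ, hθ, e1, e2⟩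
    -- At `V (j + 1)` the angle `θ` is measured from the incoming edge, which is the other boundary
    -- ray of the sector.
    rw [← (hC (j + 1) s hs (Real.pi - ε * turn V (j + 1) - θ)
      ⟨by linarith [hθ.2], by linarith [hθ.1]⟩).2, offset]
    congr 1
    have hε2 : ε * ε = 1 := by rcases hε with rfl | rfl <;> norm_num
    have e3 : Complex.exp ((edgeArg V (j + 1) +
        ε * (Real.pi - ε * turn V (j + 1) - θ) : ℝ) * Complex.I) =
        Complex.exp (edgeArg V j * Complex.I) *
          -(Real.cos θ - ε * Real.sin θ * Complex.I) := by
      have a1 : (edgeArg V (j + 1) + ε * (Real.pi - ε * turn V (j + 1) - θ) : ℝ) =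
        (edgeArg V (j + 1) - turn V (j + 1) : ℝ) + ε * (Real.pi - θ) := by
        linear_combination -turn V (j + 1) * hε2
      have a2 := h.exp_edgeArg (j + 1)
      rw [add_sub_cancel_right] at a2
      have a3 : Complex.exp ((edgeArg V (j + 1) - turn V (j + 1) : ℝ) * Complex.I) =
          Complex.exp (edgeArg V j * Complex.I) := by
        push_cast
        rw [sub_mul, Complex.exp_sub, a2, mul_div_assoc, div_self (Complex.exp_ne_zero _), mul_one]
      rw [a1, exp_side hε, a3, Real.cos_pi_sub, Real.sin_pi_sub]
      push_cast; ring
    rw [e3, e2]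
    have e4 := h.edge_eq j
    rw [e1]
    push_cast
    linear_combination -e4
  have hdisc : ∀ j, ∀ ρ ∈ Ioo 0 ‖V (j + 1) - V j‖, ∃ r > (0 : ℝ), ∃ C,
      (∀ s ∈ Ioo (0 : ℝ) r, ∀ θ ∈ Ioo (0 : ℝ) Real.pi,
        V j + ρ * Complex.exp (edgeArg V j * Complex.I) +
          s * Complex.exp ((edgeArg V j + ε * θ : ℝ) * Complex.I) ∈ C ∧
        comp V (V j + ρ * Complex.exp (edgeArg V j * Complex.I) +
          s * Complex.exp ((edgeArg V j + ε * θ : ℝ) * Complex.I)) = C) ∧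
      ∀ᶠ t : ℝ in 𝓝[>] 0, comp V (offset V ε j ρ t) = C := by
    intro j ρ hρ
    obtain ⟨r, hr, hU⟩ := h.halfDisc_notMem_curve hε j hρ
    obtain ⟨C, hC⟩ := exists_comp_of_polar hr Real.pi_pos hU
    refine ⟨r, hr, C, hC, ?_⟩
    filter_upwards [Ioo_mem_nhdsGT hr] with t ht
    rw [← (hC t ht (Real.pi / 2) ⟨by linarith [Real.pi_pos], by linarith [Real.pi_pos]⟩).2,
      exp_side hε, offset]
    congr 1
    simp
    ring
  have step : ∀ j, C j = C (j + 1) := by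
    intro j
    obtain ⟨ρ₁, h₁, c₁⟩ := start j
    obtain ⟨ρ₂, h₂, c₂⟩ := terminal j
    obtain ⟨t, t1, t2, t3⟩ := (c₁.and (c₂.and (strip j ρ₁ h₁ ρ₂ h₂))).exists
    rw [← t1, t3, t2]
  have all : ∀ j, C j = C 0 := by
    intro j
    induction j using Int.induction_on with
    | zero => rfl
    | succ i ih => rw [← step, ih]
    | pred i ih => rw [step, sub_add_cancel, ih]
  refine ⟨C 0, fun j => ⟨r j, hr j, fun s hs θ hθ => all j ▸ hC j s hs θ hθ⟩, fun j ρ hρ => ?_⟩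
  obtain ⟨r', hr', C', hC', c₁⟩ := hdisc j ρ hρ
  obtain ⟨ρ₂, h₂, c₂⟩ := start j
  obtain ⟨t, t1, t2, t3⟩ := (c₁.and (c₂.and (strip j ρ hρ ρ₂ h₂))).exists
  have : C' = C 0 := by rw [← t1, t3, t2, all]
  exact ⟨r', hr', this ▸ hC'⟩

end IsSimpleLoop

end Billiard

/-! ### The winding number -/

namespace Billiard

open Filter Topology

namespace IsSimpleLoop

variable {n : ℕ} {V : ℤ → ℂ}

/-- `2π` times the winding number of the loop about `x`. -/
noncomputable def winding (n : ℕ) (V : ℤ → ℂ) (x : ℂ) : ℝ :=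
  ∑ j ∈ Finset.range n, ((V (j + 1) - x) / (V j - x)).arg

lemma vertex_mem_loopCurve (V : ℤ → ℂ) (j : ℤ) : V j ∈ loopCurve V :=
  mem_iUnion.2 ⟨j, left_mem_segment ℝ _ _⟩

/-- The quotient lies on the branch cut of `arg` only if `a - x` and `b - x` point in opposite
directions or one vanishes, that is, if `x` is on the segment. -/
lemma continuousAt_arg_div {a b x : ℂ} (hx : x ∉ segment ℝ a b) :
    ContinuousAt (fun x => ((b - x) / (a - x)).arg) x := by
  have ha : a - x ≠ 0 := fun e => hx (by rw [← sub_eq_zero.1 e]; exact left_mem_segment ℝ _ _)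
  have hs : (b - x) / (a - x) ∈ Complex.slitPlane := by
    rw [Complex.mem_slitPlane_iff]
    by_contra! hc
    obtain ⟨h1, h2⟩ := hc
    set z := (b - x) / (a - x) with hz
    have hzr : z = (z.re : ℂ) := Complex.ext (by simp) (by simp [h2])
    have e : b - x = z.re * (a - x) := by rw [← hzr, hz, div_mul_cancel₀ _ ha]
    apply hx
    have hk : 0 < 1 - z.re := by linarith
    refine ⟨-z.re / (1 - z.re), 1 / (1 - z.re), div_nonneg (by linarith) hk.le,
      div_nonneg one_pos.le hk.le, by field_simp; ring, ?_⟩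
    have hk' : (1 - z.re : ℂ) ≠ 0 := by exact_mod_cast hk.ne'
    simp only [Complex.real_smul]
    push_cast
    field_simp
    linear_combination e
  exact ContinuousAt.comp (f := fun x => (b - x) / (a - x)) (Complex.continuousAt_arg hs)
    (by fun_prop (disch := exact ha))

lemma continuousOn_winding (n : ℕ) (V : ℤ → ℂ) : ContinuousOn (winding n V) (loopCurve V)ᶜ := by
  intro x hx
  refine ContinuousAt.continuousWithinAt (tendsto_finsetSum _ fun j _ => ?_)
  exact continuousAt_arg_div fun hm => hx (mem_iUnion.2 ⟨j, hm⟩)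

/-- Modulo `2π` each summand is a difference of consecutive arguments, and the sum telescopes around
the loop. -/
lemma winding_eq_int (h : IsSimpleLoop n V) {x : ℂ} (hx : x ∈ (loopCurve V)ᶜ) :
    ∃ k : ℤ, winding n V x = k * (2 * Real.pi) := by
  have hne : ∀ j, V j - x ≠ 0 := fun j e =>
    hx (sub_eq_zero.1 e ▸ vertex_mem_loopCurve V j)
  have h1 : ((winding n V x : ℝ) : Real.Angle) = 0 := by
    have e0 : ((winding n V x : ℝ) : Real.Angle) =
        ∑ j ∈ Finset.range n, ((((V (j + 1) - x) / (V j - x)).arg : ℝ) : Real.Angle) :=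
      map_sum Real.Angle.coeHom _ _
    have e1 : ∀ j ∈ Finset.range n,
        ((((V (j + 1) - x) / (V j - x)).arg : ℝ) : Real.Angle) =
          ((V ((j + 1 : ℕ) : ℤ) - x).arg : Real.Angle) - ((V (j : ℤ) - x).arg : Real.Angle) :=
      fun j _ => by rw [Complex.arg_div_coe_angle (hne _) (hne _)]; push_cast; rfl
    rw [e0, Finset.sum_congr rfl e1,
      Finset.sum_range_sub (fun j : ℕ => ((V (j : ℤ) - x).arg : Real.Angle)),
      h.eq_of_dvd (i := n) (j := (0 : ℕ)) (by simp), sub_self]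
  obtain ⟨k, hk⟩ := Real.Angle.coe_eq_zero_iff.1 h1
  exact ⟨k, by rw [← hk]; simp⟩

/-- A continuous function with integer values is constant on a connected set. -/
lemma winding_eq_of_mem_comp (h : IsSimpleLoop n V) {x y : ℂ} (hy : y ∈ comp V x) :
    winding n V y = winding n V x := by
  have hx : x ∈ (loopCurve V)ᶜ := connectedComponentIn_nonempty_iff.1 ⟨y, hy⟩
  have hd : IsDiscrete (range ((↑) : ℤ → ℝ)) :=
    Int.isClosedEmbedding_coe_real.isEmbedding.isDiscrete_range
  have hc : ContinuousOn (fun z => winding n V z / (2 * Real.pi)) (comp V x) :=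
    ((continuousOn_winding n V).mono (connectedComponentIn_subset _ _)).div_const _
  have hm : MapsTo (fun z => winding n V z / (2 * Real.pi)) (comp V x) (range ((↑) : ℤ → ℝ)) := by
    intro z hz
    obtain ⟨k, hk⟩ := h.winding_eq_int (connectedComponentIn_subset _ _ hz)
    exact ⟨k, by simp only [hk]; field_simp⟩
  have := isPreconnected_connectedComponentIn.constant_of_mapsTo hd hc hm hy
    (mem_connectedComponentIn hx)
  simpa [div_left_inj' (by positivity : 2 * Real.pi ≠ 0)] using this

lemma tendsto_winding_cobounded (n : ℕ) (V : ℤ → ℂ) :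
    Tendsto (winding n V) (Bornology.cobounded ℂ) (𝓝 0) := by
  have : Tendsto (winding n V) (Bornology.cobounded ℂ) (𝓝 (∑ _j ∈ Finset.range n, (0 : ℝ))) := by
    refine tendsto_finsetSum _ fun j _ => ?_
    have h1 : Tendsto (fun x => (1 : ℂ) + (V (j + 1) - V j) * (V j - x)⁻¹)
        (Bornology.cobounded ℂ) (𝓝 1) := by
      have := ((tendsto_inv₀_cobounded.comp (tendsto_const_sub_cobounded (V j))).const_mul
        (V (j + 1) - V j)).const_add (1 : ℂ)
      simpa using this
    have h2 := (Complex.continuousAt_arg (x := 1) (by simp)).tendsto.comp h1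
    rw [Complex.arg_one] at h2
    refine h2.congr' ?_
    have hne : ∀ᶠ x in Bornology.cobounded ℂ, x ≠ V j := by
      have : {V j}ᶜ ∈ Bornology.cobounded ℂ := Bornology.isBounded_singleton
      exact this
    filter_upwards [hne] with x hx
    have : V j - x ≠ 0 := sub_ne_zero.2 hx.symm
    simp only [Function.comp]
    congr 1
    field_simp
    ring
  simpa using this

/-- An unbounded component contains points so far out that the value is below `2π` in absolute
value, and it is a multiple of `2π`. -/
lemma winding_eq_zero (h : IsSimpleLoop n V) {x : ℂ}
    (hx : ¬ Bornology.IsBounded (comp V x)) : winding n V x = 0 := by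
  have h1 : ∀ᶠ y in Bornology.cobounded ℂ, |winding n V y| < 2 * Real.pi := by
    have := (tendsto_winding_cobounded n V).abs
    rw [abs_zero] at this
    exact this.eventually_lt_const (by positivity)
  have h2 : ∃ y ∈ comp V x, |winding n V y| < 2 * Real.pi := by
    by_contra! hc
    refine hx (Bornology.IsBounded.subset (t := {y | |winding n V y| < 2 * Real.pi}ᶜ) ?_ ?_)
    · exact Bornology.isBounded_compl_iff.2 (Bornology.isCobounded_def.2 h1)
    · intro y hy hy'
      exact absurd hy' (not_lt.2 (hc y hy))
  obtain ⟨y, hy, hlt⟩ := h2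
  rw [← h.winding_eq_of_mem_comp hy]
  obtain ⟨k, hk⟩ := h.winding_eq_int (connectedComponentIn_subset _ _ hy)
  rw [hk, abs_mul, abs_of_pos (by positivity : 0 < 2 * Real.pi)] at hlt
  have : |(k : ℝ)| < 1 := by
    by_contra! hc
    nlinarith [Real.pi_pos]
  have hk0 : k = 0 := Int.abs_lt_one_iff.1 (by exact_mod_cast this)
  rw [hk, hk0]; simp

/-- The winding number jumps when the loop is crossed. -/
lemma winding_jump (h : IsSimpleLoop n V) {ρ : ℝ} (hρ : ρ = ‖V 1 - V 0‖ / 2) :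
    Tendsto (fun t => winding n V (offset V 1 0 ρ t) - winding n V (offset V (-1) 0 ρ t))
      (𝓝[>] 0) (𝓝 (2 * Real.pi)) := by
  have hρ0 : 0 < ρ := by rw [hρ]; have := h.norm_edge_pos 0; simp at this; simpa
  set e := Complex.exp (edgeArg V 0 * Complex.I) with he
  have he0 : e ≠ 0 := Complex.exp_ne_zero _
  have hedge : V 1 - V 0 = 2 * ρ * e := by
    have := h.edge_eq 0
    simp only [zero_add] at this
    rw [this, hρ]; push_cast; simp [edgeArg]; ring_nf; simp [e, edgeArg]
  have hc : ∀ ε : ℝ, Tendsto (offset V ε 0 ρ) (𝓝[>] 0) (𝓝 (V 0 + ρ * e)) := by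
    intro ε
    have : ContinuousAt (offset V ε 0 ρ) 0 := by unfold offset; fun_prop
    have h1 := this.tendsto.mono_left (nhdsWithin_le_nhds (s := Ioi 0))
    simpa [offset] using h1
  have hρm : ρ ∈ Ioo 0 ‖V (0 + 1) - V 0‖ := ⟨hρ0, by simp only [zero_add]; linarith⟩
  obtain ⟨m, rfl⟩ : ∃ m, n = m + 1 := ⟨n - 1, by have := h.three_le; omega⟩
  have hother : ∀ ε, Tendsto (fun t => ∑ j ∈ Finset.range m,
      ((V ((j + 1 : ℕ) + 1) - offset V ε 0 ρ t) / (V (j + 1 : ℕ) - offset V ε 0 ρ t)).arg)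
      (𝓝[>] 0) (𝓝 (∑ j ∈ Finset.range m,
      ((V ((j + 1 : ℕ) + 1) - (V 0 + ρ * e)) / (V (j + 1 : ℕ) - (V 0 + ρ * e))).arg)) := by
    refine fun ε => tendsto_finsetSum _ fun j hj => ?_
    have hj' := Finset.mem_range.1 hj
    refine (continuousAt_arg_div fun hm => ?_).tendsto.comp (hc ε)
    have := h.edge_point_mem hρm hm
    exact h.not_dvd (by omega) (by push_cast; omega) this
  -- The two points approach the midpoint of edge `0`. The quotient for this edge tends to `-1`, and
  -- its imaginary part has the sign of `ε`, so its argument tends to `π` from one side and to `-π`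
  -- from the other. All other summands are continuous there.
  have hratio : ∀ ε t : ℝ, (V 1 - offset V ε 0 ρ t) / (V 0 - offset V ε 0 ρ t) =
      (-(ρ - (ε * t : ℝ) * Complex.I) / (ρ + (ε * t : ℝ) * Complex.I) : ℂ) := by
    intro ε t
    have e1 : V 0 - offset V ε 0 ρ t = -(ρ + (ε * t : ℝ) * Complex.I) * e := by
      simp only [offset, ← he]; ring
    have e2 : V 1 - offset V ε 0 ρ t = (ρ - (ε * t : ℝ) * Complex.I) * e := by
      simp only [offset, ← he]; linear_combination hedge
    rw [e1, e2, mul_div_mul_right _ _ he0, neg_div, div_neg]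
  have hlim : ∀ ε : ℝ, Tendsto (fun t : ℝ =>
      (-(ρ - (ε * t : ℝ) * Complex.I) / (ρ + (ε * t : ℝ) * Complex.I) : ℂ)) (𝓝[>] 0) (𝓝 (-1)) := by
    intro ε
    have hρc : (ρ : ℂ) ≠ 0 := by exact_mod_cast hρ0.ne'
    have : ContinuousAt (fun t : ℝ =>
        (-(ρ - (ε * t : ℝ) * Complex.I) / (ρ + (ε * t : ℝ) * Complex.I) : ℂ)) 0 := by
      refine ContinuousAt.div (by fun_prop) (by fun_prop) (by simpa using hρc)
    have h1 := this.tendsto.mono_left (nhdsWithin_le_nhds (s := Ioi 0))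
    simpa [hρc, neg_div] using h1
  have him : ∀ ε t : ℝ,
      (-(ρ - (ε * t : ℝ) * Complex.I) / (ρ + (ε * t : ℝ) * Complex.I) : ℂ).im =
        ε * (t * (2 * ρ / (ρ ^ 2 + (ε * t) ^ 2))) := by
    intro ε t
    simp [Complex.div_im, Complex.normSq_apply]
    ring
  have hplus : Tendsto (fun t => ((V 1 - offset V 1 0 ρ t) / (V 0 - offset V 1 0 ρ t)).arg)
      (𝓝[>] 0) (𝓝 Real.pi) := by
    simp only [hratio]
    refine (Complex.tendsto_arg_nhdsWithin_im_nonneg_of_re_neg_of_im_zero (z := -1)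
      (by simp) (by simp)).comp (tendsto_nhdsWithin_iff.2 ⟨hlim 1, ?_⟩)
    filter_upwards [self_mem_nhdsWithin] with t (ht : 0 < t)
    rw [him]
    positivity
  have hminus : Tendsto
      (fun t => ((V 1 - offset V (-1) 0 ρ t) / (V 0 - offset V (-1) 0 ρ t)).arg)
      (𝓝[>] 0) (𝓝 (-Real.pi)) := by
    simp only [hratio]
    refine (Complex.tendsto_arg_nhdsWithin_im_neg_of_re_neg_of_im_zero (z := -1)
      (by simp) (by simp)).comp (tendsto_nhdsWithin_iff.2 ⟨hlim (-1), ?_⟩)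
    filter_upwards [self_mem_nhdsWithin] with t (ht : 0 < t)
    rw [him, neg_one_mul, neg_lt_zero]
    positivity
  have := ((hother 1).add hplus).sub ((hother (-1)).add hminus)
  rw [add_sub_add_left_eq_sub, sub_neg_eq_add, ← two_mul] at this
  refine this.congr fun t => ?_
  simp only [winding, Finset.sum_range_succ' _ m]
  push_cast
  rfl

end IsSimpleLoop

end Billiard

/-! ### The Jordan curve theorem for polygons -/

namespace Billiard

open Filter Topology

/-- The points off the closed curve `Γ` whose component in the complement is bounded. -/
def boundedSide (Γ : Set ℂ) : Set ℂ :=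
  {x | x ∈ Γᶜ ∧ Bornology.IsBounded (connectedComponentIn Γᶜ x)}

/-- Near `c` the directions with angle in `(φ, φ + β)` point into `S` and the directions with
angle in `(φ + β, φ + 2π)` point into `T`. -/
def SectorAt (S T : Set ℂ) (c : ℂ) (φ β : ℝ) : Prop :=
  ∃ r > (0 : ℝ), ∀ s ∈ Ioo (0 : ℝ) r,
    (∀ θ ∈ Ioo (0 : ℝ) β, c + s * Complex.exp ((φ + θ : ℝ) * Complex.I) ∈ S) ∧
    ∀ θ ∈ Ioo β (2 * Real.pi), c + s * Complex.exp ((φ + θ : ℝ) * Complex.I) ∈ T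

/-- The local structure of a closed curve `Γ` with corners `K` that bounds a polygonal region
without holes: it has two sides, the interior angles are `β`, and these have the expected sum. -/
def HasPolygonalInside (n : ℕ) (Γ : Set ℂ) (V : ℤ → ℂ) : Prop :=
  ∃ β : ℂ → ℝ, ∑ᶠ z ∈ range V, β z = (n - 2) * Real.pi ∧
    (∀ j, β (V j) ∈ Ioo 0 (2 * Real.pi) ∧
      ∃ φ, SectorAt (boundedSide Γ) (Γ ∪ boundedSide Γ)ᶜ (V j) φ (β (V j))) ∧
    ∀ j, ∀ c ∈ openSegment ℝ (V j) (V (j + 1)), ∃ φ k : ℝ,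
      V (j + 1) - V j = k * Complex.exp (φ * Complex.I) ∧
      SectorAt (boundedSide Γ) (Γ ∪ boundedSide Γ)ᶜ c φ Real.pi

namespace IsSimpleLoop

variable {n : ℕ} {V : ℤ → ℂ}

lemma arg_neg_one_div {w : ℂ} (hw : 0 < w.im) : (-1 / w).arg = Real.pi - w.arg := by
  have hw0 : w ≠ 0 := by rintro rfl; simp at hw
  have h2 := Complex.arg_nonneg_iff.2 hw.le
  rw [arg_div_eq_sub (by simp) hw0, Complex.arg_neg_one]
  rw [Complex.arg_neg_one]
  constructor <;> linarith [Complex.arg_le_pi w, Real.pi_pos]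

/-- On the side `-1` angles are counted clockwise: `θ` in the conclusion corresponds to `2π - θ` in
`hT`. -/
lemma sectorAt_of_sides {S T : Set ℂ} {c : ℂ} {φ β : ℝ}
    (hS : ∃ r > (0 : ℝ), ∀ s ∈ Ioo (0 : ℝ) r, ∀ θ ∈ Ioo (0 : ℝ) β,
      c + s * Complex.exp ((φ + 1 * θ : ℝ) * Complex.I) ∈ S)
    (hT : ∃ r > (0 : ℝ), ∀ s ∈ Ioo (0 : ℝ) r, ∀ θ ∈ Ioo (0 : ℝ) (2 * Real.pi - β),
      c + s * Complex.exp ((φ + -1 * θ : ℝ) * Complex.I) ∈ T) : SectorAt S T c φ β := by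
  obtain ⟨r₁, hr₁, h₁⟩ := hS
  obtain ⟨r₂, hr₂, h₂⟩ := hT
  refine ⟨min r₁ r₂, lt_min hr₁ hr₂, fun s hs => ⟨fun θ hθ => ?_, fun θ hθ => ?_⟩⟩
  · simpa using h₁ s ⟨hs.1, hs.2.trans_le (min_le_left _ _)⟩ θ hθ
  · have := h₂ s ⟨hs.1, hs.2.trans_le (min_le_right _ _)⟩ (2 * Real.pi - θ)
      ⟨by linarith [hθ.2], by linarith [hθ.1]⟩
    convert this using 3
    rw [show ((φ + θ : ℝ) : ℂ) * Complex.I =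
      ((φ + -1 * (2 * Real.pi - θ) : ℝ) : ℂ) * Complex.I + 2 * Real.pi * Complex.I by
        push_cast; ring]
    exact Complex.exp_periodic _

/-- The Jordan curve theorem for polygons that are traversed counterclockwise and start at a
lowest vertex. -/
theorem hasPolygonalInside_of_left (h : IsSimpleLoop n V)
    (hlow : ∀ j : ℕ, 0 < j → j < n → 0 ≤ (V j - V 0).arg ∧ (V j - V 0).arg < Real.pi)
    (hleft : 0 < ((V (-1) - V 0) / (V 1 - V 0)).im) :
    HasPolygonalInside n (loopCurve V) V := by
  have h3 := h.three_le
  obtain ⟨L, hLv, hLe⟩ := h.exists_side_component (ε := 1) (Or.inl rfl)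
  obtain ⟨R, hRv, hRe⟩ := h.exists_side_component (ε := -1) (Or.inr rfl)
  -- the right side is unbounded
  have him : ∀ i, (V 0).im ≤ (V i).im := by
    intro i
    have h0 := Int.emod_nonneg i h.n_pos.ne'
    have h1 := Int.emod_lt_of_pos i h.n_pos
    have e : ((i % n).toNat : ℤ) = i % n := Int.toNat_of_nonneg h0
    have e1 : V i = V ((i % n).toNat : ℤ) :=
      h.eq_of_dvd (by rw [e]; exact Int.dvd_self_sub_emod)
    rw [e1]
    rcases Nat.eq_zero_or_pos (i % n).toNat with h2 | h2
    · rw [h2]; rfl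
    · have := Complex.arg_nonneg_iff.1 (hlow _ h2 (by omega)).1
      rwa [Complex.sub_im, sub_nonneg] at this
  have hcurve : ∀ x ∈ loopCurve V, (V 0).im ≤ x.im := by
    intro x hx
    obtain ⟨i, hi⟩ := mem_iUnion.1 hx
    exact (convex_halfSpace_im_ge (V 0).im).segment_subset (him _) (him _) hi
  have hb : 0 ≤ (V (-1) - V 0).arg ∧ (V (-1) - V 0).arg < Real.pi := by
    have e : V (-1) = V ((n - 1 : ℕ) : ℤ) := h.eq_of_dvd ⟨-1, by push_cast [show 1 ≤ n by omega]; ring⟩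
    rw [e]; exact hlow _ (by omega) (by omega)
  have ha : 0 ≤ (V 1 - V 0).arg ∧ (V 1 - V 0).arg < Real.pi := by
    exact_mod_cast hlow 1 (by omega) (by omega)
  have ha0 : V 1 - V 0 ≠ 0 := by simpa using h.edge_ne_zero 0
  have hb0 : V (-1) - V 0 ≠ 0 := by
    have := h.pred_edge_ne_zero 0
    rw [← neg_ne_zero]; simpa using this
  have hturn : turn V 0 = Real.pi - ((V (-1) - V 0).arg - (V 1 - V 0).arg) := by
    rw [← arg_div_eq_sub hb0 ha0 ⟨by linarith, by linarith⟩, ← arg_neg_one_div hleft, turn]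
    simp only [zero_add, zero_sub]
    rw [div_div_eq_mul_div, ← neg_sub (V (-1)) (V 0), div_neg]; ring_nf
  have hRunb : ¬ Bornology.IsBounded R := by
    obtain ⟨r, hr, hR⟩ := hRv 0
    -- The clockwise angle from the first edge to the direction `-i`. The curve lies nowhere below
    -- `V 0`, so the vertical ray downwards from `V 0` meets it only at its origin.
    have hang : edgeArg V 0 + Real.pi / 2 ∈ Ioo 0 (Real.pi - -1 * turn V 0) := by
      have : edgeArg V 0 = (V 1 - V 0).arg := by simp [edgeArg]
      rw [this, hturn]
      constructor <;> linarith [Real.pi_pos]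
    have hpt := hR (r / 2) ⟨by linarith, by linarith⟩ _ hang
    have e : V 0 + ((r / 2 : ℝ) : ℂ) *
        Complex.exp ((edgeArg V 0 + -1 * (edgeArg V 0 + Real.pi / 2) : ℝ) * Complex.I) =
        V 0 + (r / 2 : ℝ) * -Complex.I := by
      congr 2
      rw [show edgeArg V 0 + -1 * (edgeArg V 0 + Real.pi / 2) = -Real.pi / 2 by ring]
      push_cast
      rw [neg_div, Complex.exp_mul_I, Complex.cos_neg, Complex.sin_neg,
        Complex.cos_pi_div_two, Complex.sin_pi_div_two]
      ring
    rw [e] at hpt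
    set ray := (fun s : ℝ => V 0 + (s : ℂ) * -Complex.I) '' Ioi 0
    have hpre : IsPreconnected ray := isPreconnected_Ioi.image _ (by fun_prop)
    have hsub : ray ⊆ (loopCurve V)ᶜ := by
      rintro _ ⟨s, hs, rfl⟩ hmem
      have := hcurve _ hmem
      simp at this
      exact absurd hs (not_lt.2 this)
    have hrR : ray ⊆ R := by
      rw [← hpt.2]
      exact hpre.subset_connectedComponentIn
        (mem_image_of_mem _ (show (0 : ℝ) < r / 2 by linarith)) hsub
    intro hbd
    obtain ⟨M, hM⟩ := (hbd.subset hrR).exists_norm_le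
    have := hM _ (mem_image_of_mem _ (show (0 : ℝ) < |M| + ‖V 0‖ + 1 by positivity))
    have h5 := norm_sub_le_norm_add (((|M| + ‖V 0‖ + 1 : ℝ) : ℂ) * -Complex.I) (V 0)
    rw [norm_mul, norm_neg, Complex.norm_I, mul_one, Complex.norm_real, Real.norm_eq_abs,
      abs_of_pos (by positivity), add_comm _ (V 0)] at h5
    have h6 := le_abs_self M
    linarith
  have hRout : ∀ x, x ∈ R → comp V x = R → x ∈ (loopCurve V ∪ boundedSide (loopCurve V))ᶜ := by
    rintro x hx hxR (hm | hm)
    · rw [← hxR] at hx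
      exact connectedComponentIn_subset _ _ hx hm
    · exact hRunb (hxR ▸ hm.2)
  -- the left side is bounded
  have hLbd : Bornology.IsBounded L := by
    -- If both sides were unbounded, the winding number would vanish on both, against its jump by
    -- `2π`.
    by_contra hL
    have hρ : ‖V 1 - V 0‖ / 2 ∈ Ioo 0 ‖V (0 + 1) - V 0‖ := by
      have := norm_pos_iff.2 ha0
      simp only [zero_add]
      constructor <;> linarith
    have key : ∀ ε : ℝ, ∀ C : Set ℂ, (ε = 1 ∨ ε = -1) → ¬ Bornology.IsBounded C →
        (∃ r > (0 : ℝ), ∀ s ∈ Ioo (0 : ℝ) r,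
        ∀ θ ∈ Ioo (0 : ℝ) Real.pi,
        V 0 + (‖V 1 - V 0‖ / 2 : ℝ) * Complex.exp (edgeArg V 0 * Complex.I) +
          s * Complex.exp ((edgeArg V 0 + ε * θ : ℝ) * Complex.I) ∈ C ∧
        comp V (V 0 + (‖V 1 - V 0‖ / 2 : ℝ) * Complex.exp (edgeArg V 0 * Complex.I) +
          s * Complex.exp ((edgeArg V 0 + ε * θ : ℝ) * Complex.I)) = C) →
        ∀ᶠ t in 𝓝[>] 0, winding n V (offset V ε 0 (‖V 1 - V 0‖ / 2) t) = 0 := by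
      rintro ε C hε hC ⟨r, hr, hs⟩
      filter_upwards [Ioo_mem_nhdsGT hr] with t ht
      apply h.winding_eq_zero
      have := (hs t ht (Real.pi / 2)
        ⟨by linarith [Real.pi_pos], by linarith [Real.pi_pos]⟩).2
      rw [exp_side hε, Real.cos_pi_div_two, Real.sin_pi_div_two] at this
      rw [← this] at hC
      convert hC using 3
      rw [offset]; push_cast; ring
    have k1 := key 1 L (Or.inl rfl) hL (hLe 0 _ hρ)
    have k2 := key (-1) R (Or.inr rfl) hRunb (hRe 0 _ hρ)
    have := h.winding_jump rfl
    have h0 : Tendsto (fun _ : ℝ => (0 : ℝ)) (𝓝[>] 0) (𝓝 (2 * Real.pi)) := by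
      refine this.congr' ?_
      filter_upwards [k1, k2] with t t1 t2
      rw [t1, t2, sub_zero]
    have := tendsto_nhds_unique h0 tendsto_const_nhds
    linarith [Real.pi_pos]
  have hLin : ∀ x, x ∈ L → comp V x = L → x ∈ boundedSide (loopCurve V) := by
    intro x hx hxL
    refine ⟨?_, by change Bornology.IsBounded (comp V x); rwa [hxL]⟩
    rw [← hxL] at hx
    exact connectedComponentIn_subset _ _ hx
  -- The interior angle is needed as a function of the vertex rather than of its index; off the
  -- vertices it gets the irrelevant value `0`.
  have hfact : Function.FactorsThrough (fun j => Real.pi - turn V j) V := by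
    intro i j e
    have hd := h.dvd_of_eq e
    simp only [turn, e, h.eq_of_dvd (i := i + 1) (j := j + 1) (by simpa using hd),
      h.eq_of_dvd (i := i - 1) (j := j - 1) (by simpa using hd)]
  refine ⟨Function.extend V (fun j => Real.pi - turn V j) 0, ?_, fun j => ⟨?_, edgeArg V j, ?_⟩, ?_⟩
  · have hr : range V = ((Finset.range n).image fun i : ℕ => V i : Finset ℂ) := by
      ext x
      simp only [Finset.coe_image, Finset.coe_range]
      constructor
      · rintro ⟨i, rfl⟩
        have h0 := Int.emod_nonneg i h.n_pos.ne'
        have h1 := Int.emod_lt_of_pos i h.n_pos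
        have e : ((i % n).toNat : ℤ) = i % n := Int.toNat_of_nonneg h0
        exact ⟨(i % n).toNat, by rw [mem_Iio]; omega,
          (h.eq_of_dvd (by rw [e]; exact Int.dvd_self_sub_emod)).symm⟩
      · rintro ⟨i, _, rfl⟩; exact mem_range_self _
    rw [hr, finsum_mem_coe_finset, Finset.sum_image]
    · simp_rw [hfact.extend_apply]
      rw [Finset.sum_sub_distrib, h.sum_turn hlow hleft]
      simp; ring
    · intro i hi j hj e
      have hd := h.dvd_of_eq e
      simp only [Finset.coe_range, mem_Iio] at hi hj
      obtain ⟨k, hk⟩ := hd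
      have hk0 : k = 0 := by
        have : |(n : ℤ) * k| < n := by rw [← hk, abs_lt]; constructor <;> omega
        rw [abs_mul, abs_of_pos h.n_pos] at this
        exact Int.abs_lt_one_iff.1 (by nlinarith [h.n_pos])
      rw [hk0] at hk; omega
  · rw [hfact.extend_apply]
    have h1 := h.turn_lt_pi j
    have h2 := neg_pi_lt_turn V j
    constructor <;> linarith
  · rw [hfact.extend_apply]
    apply sectorAt_of_sides
    · obtain ⟨r, hr, hs⟩ := hLv j
      exact ⟨r, hr, fun s hs' θ hθ =>
        hLin _ (hs s hs' θ (by rwa [one_mul])).1 (hs s hs' θ (by rwa [one_mul])).2⟩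
    · obtain ⟨r, hr, hs⟩ := hRv j
      have e : 2 * Real.pi - (Real.pi - turn V j) = Real.pi - -1 * turn V j := by ring
      rw [e]
      exact ⟨r, hr, fun s hs' θ hθ => hRout _ (hs s hs' θ hθ).1 (hs s hs' θ hθ).2⟩
  · intro j c hc
    have he := h.edge_eq j
    refine ⟨edgeArg V j, ‖V (j + 1) - V j‖, he, ?_⟩
    rw [openSegment_eq_image'] at hc
    obtain ⟨u, hu, rfl⟩ := hc
    have hn := h.norm_edge_pos j
    have hρ : u * ‖V (j + 1) - V j‖ ∈ Ioo 0 ‖V (j + 1) - V j‖ :=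
      ⟨mul_pos hu.1 hn, by nlinarith [hu.2]⟩
    have ec : V j + u • (V (j + 1) - V j) = V j + (u * ‖V (j + 1) - V j‖ : ℝ) *
        Complex.exp (edgeArg V j * Complex.I) := by
      rw [Complex.real_smul]; push_cast; linear_combination (u : ℂ) * he
    dsimp only
    rw [ec]
    apply sectorAt_of_sides
    · obtain ⟨r, hr, hs⟩ := hLe j _ hρ
      exact ⟨r, hr, fun s hs' θ hθ => hLin _ (hs s hs' θ hθ).1 (hs s hs' θ hθ).2⟩
    · obtain ⟨r, hr, hs⟩ := hRe j _ hρ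
      rw [show 2 * Real.pi - Real.pi = Real.pi by ring]
      exact ⟨r, hr, fun s hs' θ hθ => hRout _ (hs s hs' θ hθ).1 (hs s hs' θ hθ).2⟩

lemma loopCurve_shift (V : ℤ → ℂ) (k : ℤ) : loopCurve (fun i => V (i + k)) = loopCurve V := by
  apply subset_antisymm <;> refine iUnion_subset fun i => ?_
  · dsimp only
    rw [add_right_comm]
    exact subset_iUnion (fun i => segment ℝ (V i) (V (i + 1))) (i + k)
  · refine subset_trans (by simp [sub_add_eq_add_sub])
      (subset_iUnion (fun i => segment ℝ (V (i + k)) (V (i + 1 + k))) (i - k))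

lemma loopCurve_reverse (V : ℤ → ℂ) : loopCurve (fun i => V (-i)) = loopCurve V := by
  apply subset_antisymm <;> refine iUnion_subset fun i => ?_
  · rw [segment_symm]
    refine subset_trans (by simp) (subset_iUnion (fun i => segment ℝ (V i) (V (i + 1))) (-(i + 1)))
  · rw [segment_symm]
    refine subset_trans (by simp)
      (subset_iUnion (fun i => segment ℝ (V (-i)) (V (-(i + 1)))) (-(i + 1)))

lemma hasPolygonalInside_of_shift {Γ : Set ℂ} (k : ℤ)
    (h : HasPolygonalInside n Γ fun i => V (i + k)) : HasPolygonalInside n Γ V := by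
  obtain ⟨β, h1, h2, h3⟩ := h
  refine ⟨β, ?_, fun j => by simpa using h2 (j - k), fun j => ?_⟩
  · rw [← h1]
    have e : range (fun i => V (i + k)) = range V := (Equiv.addRight k).surjective.range_comp V
    rw [e]
  · have := h3 (j - k)
    dsimp only at this
    rwa [show j - k + 1 + k = j + 1 by ring, sub_add_cancel] at this

/-- The notion does not see the orientation: the factor `k` of an edge may be negative, and its sign
absorbs the reversal. -/
lemma hasPolygonalInside_of_reverse {Γ : Set ℂ}
    (h : HasPolygonalInside n Γ fun i => V (-i)) : HasPolygonalInside n Γ V := by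
  obtain ⟨β, h1, h2, h3⟩ := h
  refine ⟨β, ?_, fun j => by simpa using h2 (-j), fun j c hc => ?_⟩
  · rw [← h1]
    have e : range (fun i => V (-i)) = range V := (Equiv.neg ℤ).surjective.range_comp V
    rw [e]
  · have := h3 (-(j + 1)) c (by rw [openSegment_symm]; simpa using hc)
    obtain ⟨φ, k, e, hs⟩ := this
    refine ⟨φ, -k, ?_, hs⟩
    dsimp only at e
    rw [show -(-(j + 1) + 1) = j by ring, neg_neg] at e
    push_cast
    linear_combination -e

/-- The Jordan curve theorem for polygons, with the sum of the interior angles. -/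
theorem hasPolygonalInside (h : IsSimpleLoop n V) : HasPolygonalInside n (loopCurve V) V := by
  have h3 := h.three_le
  -- The leftmost of the lowest vertices: all others are seen from it at arguments in `[0, π)`.
  obtain ⟨k, hk, hmin⟩ := (Finset.range n).exists_min_image
    (fun i : ℕ => toLex ((V i).im, (V i).re)) ⟨0, Finset.mem_range.2 (by omega)⟩
  apply hasPolygonalInside_of_shift (k : ℤ)
  rw [← loopCurve_shift V k]
  have hW := h.shift k
  set W : ℤ → ℂ := fun i => V (i + k) with hWdef
  have hlow' : ∀ i, W i ≠ W 0 → 0 ≤ (W i - W 0).arg ∧ (W i - W 0).arg < Real.pi := by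
    intro i hi
    have h0 := Int.emod_nonneg (i + k) h.n_pos.ne'
    have h1 := Int.emod_lt_of_pos (i + k) h.n_pos
    have e : (((i + k) % n).toNat : ℤ) = (i + k) % n := Int.toNat_of_nonneg h0
    have e1 : W i = V (((i + k) % n).toNat : ℤ) :=
      h.eq_of_dvd (by rw [e]; exact Int.dvd_self_sub_emod)
    have hle := hmin ((i + k) % n).toNat (Finset.mem_range.2 (by omega))
    have e2 : W 0 = V k := by simp [W]
    rw [← e1, ← e2, Prod.Lex.toLex_le_toLex] at hle
    simp only at hle
    have him : 0 ≤ (W i - W 0).im := by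
      rw [Complex.sub_im]
      rcases hle with h | h
      · linarith
      · linarith [h.1]
    refine ⟨Complex.arg_nonneg_iff.2 him, lt_of_le_of_ne (Complex.arg_le_pi _) fun e => ?_⟩
    rw [Complex.arg_eq_pi_iff, Complex.sub_re, Complex.sub_im] at e
    rcases hle with h | h
    · linarith [e.2]
    · linarith [h.2, e.1]
  have hne : ∀ j : ℤ, 0 < j → j < n → W j ≠ W 0 := fun j h0 hj e =>
    hW.not_dvd h0 hj (by simpa using hW.dvd_of_eq e)
  have hm1 : W (-1) ≠ W 0 := fun e => hW.not_dvd (k := 1) (by omega) (by omega)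
    (by rw [← dvd_neg]; simpa using hW.dvd_of_eq e)
  have ha0 : W 1 - W 0 ≠ 0 := sub_ne_zero.2 (hne 1 (by omega) (by omega))
  have hb0 : W (-1) - W 0 ≠ 0 := sub_ne_zero.2 hm1
  -- If the quotient were real, both edges at vertex `0` would have the same direction and the turn
  -- there would be `π`.
  have him : ((W (-1) - W 0) / (W 1 - W 0)).im ≠ 0 := by
    intro e
    have h1 := hlow' 1 (hne 1 (by omega) (by omega))
    have h2 := hlow' (-1) hm1
    have h4 : ((W (-1) - W 0) / (W 1 - W 0)).arg = _ := arg_div_eq_sub hb0 ha0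
      ⟨by linarith, by linarith⟩
    have h5 : ((W (-1) - W 0) / (W 1 - W 0)).arg = 0 := by
      rw [Complex.arg_eq_zero_iff]
      refine ⟨?_, e⟩
      by_contra! hre
      have := Complex.arg_eq_pi_iff.2 ⟨hre, e⟩
      linarith
    have h6 : turn W 0 = Real.pi := by
      rw [turn, zero_add, zero_sub, ← neg_sub (W (-1)), div_neg]
      rw [Complex.arg_eq_zero_iff] at h5
      rw [Complex.arg_eq_pi_iff]
      have hz : ((W (-1) - W 0) / (W 1 - W 0)) ≠ 0 := div_ne_zero hb0 ha0
      set z := (W (-1) - W 0) / (W 1 - W 0) with hzdef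
      have hzr : z = (z.re : ℂ) := Complex.ext (by simp) (by simp [h5.2])
      have e7 : (W 1 - W 0) / (W (-1) - W 0) = ((z.re⁻¹ : ℝ) : ℂ) := by
        rw [← inv_div, ← hzdef]; push_cast; rw [← hzr]
      have hpos : 0 < z.re := lt_of_le_of_ne h5.1 fun e => hz (by rw [hzr, ← e]; simp)
      rw [e7]
      simpa using hpos
    exact (hW.turn_lt_pi 0).ne h6
  rcases lt_or_gt_of_ne him with hneg | hpos
  -- The clockwise case: reversing the loop inverts the quotient, which changes the sign of its
  -- imaginary part.
  · apply hasPolygonalInside_of_reverse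
    rw [← loopCurve_reverse W]
    refine hW.reverse.hasPolygonalInside_of_left (fun j h0 hj => ?_) ?_
    · simp only [neg_zero]
      refine hlow' _ fun e => ?_
      exact hW.not_dvd (k := j) (by omega) (by omega)
        (by rw [← dvd_neg]; simpa using hW.dvd_of_eq e)
    · simp only [neg_neg, neg_zero]
      rw [← inv_div, Complex.inv_im]
      exact div_pos (by linarith) (Complex.normSq_pos.2 (div_ne_zero hb0 ha0))
  · exact hW.hasPolygonalInside_of_left
      (fun j h0 hj => hlow' _ (hne j (by omega) (by omega))) hpos

end IsSimpleLoop

end Billiard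

/-! ### Transfer to simple polygons in the plane -/

namespace Billiard

open Filter Topology

/-- The identification of the plane with `ℂ`. -/
noncomputable def toC : Plane ≃ₗᵢ[ℝ] ℂ := Complex.orthonormalBasisOneI.repr.symm

lemma toC_symm_apply (z : ℂ) : toC.symm z = !₂[z.re, z.im] := by
  ext i
  fin_cases i <;> simp [toC]

lemma toC_symm_exp (θ : ℝ) : toC.symm (Complex.exp (θ * Complex.I)) = Table.dir θ := by
  rw [toC_symm_apply, Complex.exp_ofReal_mul_I_re, Complex.exp_ofReal_mul_I_im, Table.dir]

lemma toC_dir (θ : ℝ) : toC (Table.dir θ) = Complex.exp (θ * Complex.I) := by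
  rw [← toC_symm_exp, LinearIsometryEquiv.apply_symm_apply]

/-- Near `c` the directions with angle in `(φ, φ + β)` point into `S` and the directions with
angle in `(φ + β, φ + 2π)` point into `T`. -/
def Sector (S T : Set Plane) (c : Plane) (φ β : ℝ) : Prop :=
  ∃ r > (0 : ℝ), ∀ s ∈ Ioo (0 : ℝ) r,
    (∀ θ ∈ Ioo (0 : ℝ) β, c + s • Table.dir (φ + θ) ∈ S) ∧
    ∀ θ ∈ Ioo β (2 * Real.pi), c + s • Table.dir (φ + θ) ∈ T

lemma SectorAt.toPlane {S T : Set ℂ} {c : Plane} {φ β : ℝ} (h : SectorAt S T (toC c) φ β) :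
    Sector (toC ⁻¹' S) (toC ⁻¹' T) c φ β := by
  obtain ⟨r, hr, hs⟩ := h
  refine ⟨r, hr, fun s hs' => ⟨fun θ hθ => ?_, fun θ hθ => ?_⟩⟩
  · have := (hs s hs').1 θ hθ
    rw [mem_preimage, map_add, map_smul, toC_dir, Complex.real_smul]
    exact this
  · have := (hs s hs').2 θ hθ
    rw [mem_preimage, map_add, map_smul, toC_dir, Complex.real_smul]
    exact this

namespace SimplePolygon

variable (γ : SimplePolygon)

lemma n_pos : 0 < γ.n := by have := γ.three_le; omega

/-- The index of a vertex, modulo the number of vertices. -/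
def cycIndex (i : ℤ) : Fin γ.n :=
  ⟨(i % γ.n).toNat, by
    have h := γ.n_pos
    have h0 := Int.emod_nonneg i (b := γ.n) (by omega)
    have h1 := Int.emod_lt_of_pos i (b := γ.n) (by omega)
    omega⟩

lemma val_cycIndex (i : ℤ) : ((γ.cycIndex i : ℕ) : ℤ) = i % γ.n := by
  have h := γ.n_pos
  exact Int.toNat_of_nonneg (Int.emod_nonneg i (by omega))

lemma cycIndex_succ (i : ℤ) : γ.cycIndex (i + 1) = finRotate γ.n (γ.cycIndex i) := by
  have key : ∀ (n : ℕ) (a b : Fin n), 1 < n → ((b : ℕ) : ℤ) = (a + 1) % n → b = finRotate n a := by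
    intro n a b hn h
    obtain ⟨m, rfl⟩ : ∃ m, n = m + 1 := ⟨n - 1, by omega⟩
    rw [finRotate_apply]
    apply Fin.ext
    rw [Fin.val_add, Fin.val_one', Nat.add_mod_mod]
    exact_mod_cast h
  refine key _ _ _ (by have := γ.three_le; omega) ?_
  rw [val_cycIndex, val_cycIndex, Int.emod_add_emod]

lemma cycIndex_coe (i : Fin γ.n) : γ.cycIndex (i : ℕ) = i := by
  apply Fin.ext
  have := γ.val_cycIndex (i : ℕ)
  rw [Int.emod_eq_of_lt (by omega) (by omega)] at this
  exact_mod_cast this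

/-- The periodic sequence of vertices, as complex numbers. -/
noncomputable def loop (i : ℤ) : ℂ := toC (γ.poly (γ.cycIndex i))

lemma edgePath_apply (i : Fin γ.n) (s : ℝ) :
    γ.poly.edgePath ℝ i s = γ.poly i + s • (γ.poly (finRotate γ.n i) - γ.poly i) := by
  rw [Polygon.edgePath, AffineMap.lineMap_apply, vsub_eq_sub, vadd_eq_add, add_comm]

lemma isSimpleLoop : IsSimpleLoop γ.n γ.loop where
  three_le := γ.three_le
  periodic i := by
    have : γ.cycIndex (i + γ.n) = γ.cycIndex i := by simp [cycIndex]
    rw [loop, loop, this]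
  inj i j s hs t ht e := by
    have h1 := γ.injective (γ.cycIndex i) (γ.cycIndex j) s hs t ht (by
      apply toC.injective
      rw [edgePath_apply, edgePath_apply, ← cycIndex_succ, ← cycIndex_succ]
      simpa [loop] using e)
    refine ⟨?_, h1.2⟩
    have h2 := congrArg (fun k : Fin γ.n => ((k : ℕ) : ℤ)) h1.1
    simp only [val_cycIndex] at h2
    exact (Int.ModEq.symm h2).dvd

lemma image_toC_segment (x y : Plane) : toC '' segment ℝ x y = segment ℝ (toC x) (toC y) :=
  image_segment ℝ toC.toLinearIsometry.toLinearMap.toAffineMap x y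

lemma edgeSet_eq_segment (i : Fin γ.n) :
    γ.poly.edgeSet ℝ i = segment ℝ (γ.poly i) (γ.poly (finRotate γ.n i)) :=
  affineSegment_eq_segment _ _ _

lemma curve_eq : γ.curve = ⋃ i, segment ℝ (γ.poly i) (γ.poly (finRotate γ.n i)) := by
  simp [curve, Polygon.boundary, edgeSet_eq_segment]

lemma image_curve : toC '' γ.curve = IsSimpleLoop.loopCurve γ.loop := by
  rw [curve_eq, image_iUnion, IsSimpleLoop.loopCurve]
  apply subset_antisymm <;> refine iUnion_subset fun i => ?_
  · rw [image_toC_segment]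
    refine subset_trans ?_ (subset_iUnion (fun i => segment ℝ (γ.loop i) (γ.loop (i + 1))) (i : ℕ))
    rw [loop, loop, cycIndex_succ, cycIndex_coe]
  · rw [loop, loop, cycIndex_succ, ← image_toC_segment]
    exact subset_iUnion (fun i => toC '' segment ℝ (γ.poly i) (γ.poly (finRotate γ.n i))) _

lemma isCompact_curve : IsCompact γ.curve := by
  rw [curve_eq]
  refine isCompact_iUnion fun i => ?_
  rw [segment_eq_image_lineMap]
  exact isCompact_Icc.image AffineMap.lineMap_continuous

lemma isOpen_compl_curve : IsOpen γ.curveᶜ := γ.isCompact_curve.isClosed.isOpen_compl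

lemma boundedSide_image (S : Set Plane) :
    boundedSide (toC '' S) = toC '' {x | x ∈ Sᶜ ∧
      Bornology.IsBounded (connectedComponentIn Sᶜ x)} := by
  have hc : (toC '' S)ᶜ = toC '' Sᶜ := (image_compl_eq toC.bijective).symm
  ext z
  obtain ⟨x, rfl⟩ := toC.surjective z
  have hm : ∀ T : Set Plane, toC x ∈ toC '' T ↔ x ∈ T := fun T => toC.injective.mem_set_image
  rw [hm]
  have e1 : toC x ∈ (toC '' S)ᶜ ↔ x ∈ Sᶜ := by rw [hc, hm]
  have e2 : x ∈ Sᶜ → connectedComponentIn (toC '' S)ᶜ (toC x) =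
      toC '' connectedComponentIn Sᶜ x := fun hx => by
    rw [hc]; exact (toC.toHomeomorph.image_connectedComponentIn hx).symm
  have e3 : ∀ T : Set Plane, Bornology.IsBounded (toC '' T) ↔ Bornology.IsBounded T := by
    intro T
    refine ⟨fun h => ?_, fun h => toC.lipschitz.isBounded_image h⟩
    have := toC.symm.lipschitz.isBounded_image h
    rwa [← image_comp, show (toC.symm ∘ toC : Plane → Plane) = id from
      funext toC.symm_apply_apply, image_id] at this
  constructor
  · rintro ⟨h1, h2⟩
    have h1' := e1.1 h1
    rw [e2 h1', e3] at h2
    exact ⟨h1', h2⟩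
  · rintro ⟨h1, h2⟩
    exact ⟨e1.2 h1, by rw [e2 h1, e3]; exact h2⟩

lemma preimage_inside : toC ⁻¹' boundedSide (IsSimpleLoop.loopCurve γ.loop) = γ.inside := by
  rw [← image_curve, boundedSide_image, preimage_image_eq _ toC.injective]
  rfl

lemma preimage_region :
    toC ⁻¹' (IsSimpleLoop.loopCurve γ.loop ∪ boundedSide (IsSimpleLoop.loopCurve γ.loop))ᶜ =
      γ.regionᶜ := by
  rw [preimage_compl, preimage_union, preimage_inside, ← image_curve,
    preimage_image_eq _ toC.injective]
  rfl

lemma vertices_injective : Function.Injective γ.poly.vertices := by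
  intro i j e
  refine (γ.injective i j 0 (by simp) 0 (by simp) ?_).1
  simpa [edgePath_apply] using e

lemma card_vertexSet : γ.vertexSet.card = γ.n := by
  rw [vertexSet, Finset.card_image_of_injective _ γ.vertices_injective]
  simp

/-- The local structure of a simple polygon: interior angles `β v` with the expected sum. -/
theorem exists_interiorAngle : ∃ β : Plane → ℝ,
    ∑ v ∈ γ.vertexSet, β v = (γ.n - 2) * Real.pi ∧
    (∀ v ∈ γ.vertexSet, β v ∈ Ioo 0 (2 * Real.pi) ∧
      ∃ φ, Sector γ.inside γ.regionᶜ v φ (β v)) ∧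
    ∀ i, ∀ c ∈ openSegment ℝ (γ.poly i) (γ.poly (finRotate γ.n i)), ∃ φ k : ℝ,
      γ.poly (finRotate γ.n i) - γ.poly i = k • Table.dir φ ∧
      Sector γ.inside γ.regionᶜ c φ Real.pi := by
  obtain ⟨β, h1, h2, h3⟩ := γ.isSimpleLoop.hasPolygonalInside
  have hloop : ∀ i : Fin γ.n, γ.loop (i : ℕ) = toC (γ.poly i) := fun i => by
    rw [loop, cycIndex_coe]
  refine ⟨fun v => β (toC v), ?_, fun v hv => ?_, fun i c hc => ?_⟩
  · have hr : range γ.loop = (γ.vertexSet.image toC : Finset ℂ) := by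
      ext x
      simp only [Finset.coe_image, vertexSet, Finset.coe_univ, image_univ]
      constructor
      · rintro ⟨i, rfl⟩; exact ⟨_, ⟨γ.cycIndex i, rfl⟩, rfl⟩
      · rintro ⟨_, ⟨i, rfl⟩, rfl⟩; exact ⟨(i : ℕ), hloop i⟩
    rw [← h1, hr, finsum_mem_coe_finset, Finset.sum_image fun _ _ _ _ e => toC.injective e]
  · obtain ⟨i, _, rfl⟩ := Finset.mem_image.1 hv
    obtain ⟨hb, φ, hs⟩ := h2 (i : ℕ)
    rw [hloop] at hb hs
    have := hs.toPlane
    rw [preimage_inside, preimage_region] at this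
    exact ⟨hb, φ, this⟩
  · have hrot : γ.loop ((i : ℕ) + 1) = toC (γ.poly (finRotate γ.n i)) := by
      rw [loop, cycIndex_succ, cycIndex_coe]
    obtain ⟨φ, k, e, hs⟩ := h3 (i : ℕ) (toC c) (by
      rw [hloop, hrot]
      exact image_openSegment ℝ toC.toLinearIsometry.toLinearMap.toAffineMap _ _ ▸
        mem_image_of_mem toC hc)
    refine ⟨φ, k, ?_, ?_⟩
    · apply toC.injective
      rw [map_sub, map_smul, toC_dir, Complex.real_smul, ← e, hloop, hrot]
    · have := hs.toPlane
      rwa [preimage_inside, preimage_region] at this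

lemma isOpen_inside : IsOpen γ.inside := by
  rw [isOpen_iff_mem_nhds]
  rintro x ⟨hx, hb⟩
  filter_upwards [(γ.isOpen_compl_curve.connectedComponentIn).mem_nhds
    (mem_connectedComponentIn hx)] with y hy
  exact ⟨connectedComponentIn_subset _ _ hy, by rwa [← connectedComponentIn_eq hy]⟩

lemma isClosed_region : IsClosed γ.region := by
  rw [← isOpen_compl_iff, isOpen_iff_mem_nhds]
  intro x hx
  have hxc : x ∈ γ.curveᶜ := fun h => hx (Or.inl h)
  filter_upwards [(γ.isOpen_compl_curve.connectedComponentIn).mem_nhds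
    (mem_connectedComponentIn hxc)] with y hy
  rintro (h | h)
  · exact connectedComponentIn_subset _ _ hy h
  · exact hx (Or.inr ⟨hxc, by rw [connectedComponentIn_eq hy]; exact h.2⟩)

/-- A point farther from the origin than the whole curve can be pushed outwards along its ray
without meeting the curve, so its component is unbounded. -/
lemma isBounded_region : Bornology.IsBounded γ.region := by
  obtain ⟨R, hR0, hR⟩ := γ.isCompact_curve.isBounded.exists_pos_norm_le
  refine (Metric.isBounded_closedBall (x := (0 : Plane)) (r := R)).subset ?_
  rintro x (hx | hx)
  · simpa using hR x hx
  by_contra hfar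
  simp only [mem_closedBall_zero_iff, not_le] at hfar
  have hpre : IsPreconnected ((fun s : ℝ => s • x) '' Ici 1) :=
    isPreconnected_Ici.image _ (by fun_prop)
  have hfar' : ∀ s : ℝ, 1 ≤ s → R < ‖s • x‖ := fun s hs => by
    rw [norm_smul, Real.norm_eq_abs, abs_of_nonneg (by linarith)]
    nlinarith [norm_nonneg x]
  have hsub : (fun s : ℝ => s • x) '' Ici 1 ⊆ γ.curveᶜ := by
    rintro _ ⟨s, hs, rfl⟩ hm
    exact absurd (hR _ hm) (not_le.2 (hfar' s hs))
  have hs := hpre.subset_connectedComponentIn ⟨1, by simp, one_smul ℝ x⟩ hsub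
  obtain ⟨M, hM⟩ := (hx.2.subset hs).exists_norm_le
  have hx0 : 0 < ‖x‖ := hR0.trans hfar
  have h1 := hM _ (mem_image_of_mem _ (show (1 : ℝ) ≤ 1 + |M| / ‖x‖ by
    have := div_nonneg (abs_nonneg M) hx0.le; linarith))
  rw [norm_smul, Real.norm_eq_abs, abs_of_nonneg (by positivity), add_mul,
    div_mul_cancel₀ _ hx0.ne'] at h1
  linarith [le_abs_self M]

lemma disjoint_curve_inside : Disjoint γ.curve γ.inside :=
  disjoint_left.2 fun _ h h' => h'.1 h

end SimplePolygon

end Billiard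

/-! ### Sides, corners and angles of a table -/

namespace Billiard

open Filter Topology

namespace Table

lemma dir_add_two_pi (θ : ℝ) : dir (θ + 2 * Real.pi) = dir θ := by
  simp [dir]

lemma dir_add_pi (θ : ℝ) : dir (θ + Real.pi) = -dir θ := by
  ext i; fin_cases i <;> simp [dir]

lemma norm_dir (θ : ℝ) : ‖dir θ‖ = 1 := by
  rw [← toC_symm_exp, LinearIsometryEquiv.norm_map, Complex.norm_exp_ofReal_mul_I]

variable (P : Table)

/-- The boundary polygons of `P`; `none` is the outer one. -/
def bd : Option (Fin P.q) → SimplePolygon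
  | none => P.outer
  | some i => P.obstacle i

/-- The boundary curve of `P`. -/
def boundary : Set Plane := ⋃ k, (P.bd k).curve

/-- The sides of `P`. -/
abbrev Side : Type := Σ k : Option (Fin P.q), Fin (P.bd k).n

variable {P}

/-- The first end point of a side. -/
def Side.src (e : P.Side) : Plane := (P.bd e.1).poly e.2

/-- The second end point of a side. -/
def Side.tgt (e : P.Side) : Plane := (P.bd e.1).poly (finRotate _ e.2)

/-- The interior points of a side. -/
def Side.interior (e : P.Side) : Set Plane := openSegment ℝ e.src e.tgt

/-- The points of a side. -/
def Side.closed (e : P.Side) : Set Plane := segment ℝ e.src e.tgt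

lemma isSide_iff {a b : Plane} : P.IsSide a b ↔ ∃ e : P.Side, a = e.src ∧ b = e.tgt := by
  constructor
  · rintro ⟨γ, rfl | ⟨k, rfl⟩, i, ha, hb⟩
    · exact ⟨⟨none, i⟩, ha, hb⟩
    · exact ⟨⟨some k, i⟩, ha, hb⟩
  · rintro ⟨⟨k, i⟩, ha, hb⟩
    refine ⟨P.bd k, ?_, i, ha, hb⟩
    cases k with
    | none => exact Or.inl rfl
    | some k => exact Or.inr ⟨k, rfl⟩

lemma corners_eq : P.corners = Finset.univ.biUnion fun k => (P.bd k).vertexSet := by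
  classical
  ext x
  simp only [corners, Finset.mem_union, Finset.mem_biUnion, Finset.mem_univ, true_and,
    Option.exists, bd]

lemma disjoint_curve {k k' : Option (Fin P.q)} (h : k ≠ k') :
    Disjoint (P.bd k).curve (P.bd k').curve := by
  have key : ∀ i : Fin P.q, Disjoint P.outer.curve (P.obstacle i).curve := fun i =>
    P.outer.disjoint_curve_inside.mono_right (subset_union_left.trans (P.obstacle_subset i))
  match k, k' with
  | none, none => exact absurd rfl h
  | none, some i => exact key i
  | some i, none => exact (key i).symm
  | some i, some j =>
    exact (P.obstacle_disjoint i j fun e => h (e ▸ rfl)).mono subset_union_left subset_union_left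

lemma _root_.Billiard.SimplePolygon.vertex_mem_curve (γ : SimplePolygon) {v : Plane}
    (hv : v ∈ γ.vertexSet) : v ∈ γ.curve := by
  obtain ⟨i, _, rfl⟩ := Finset.mem_image.1 hv
  rw [γ.curve_eq]
  exact mem_iUnion.2 ⟨i, left_mem_segment ℝ _ _⟩

lemma closed_subset_curve (e : P.Side) : e.closed ⊆ (P.bd e.1).curve := by
  rw [SimplePolygon.curve_eq]
  exact subset_iUnion (fun i => segment ℝ ((P.bd e.1).poly i) ((P.bd e.1).poly (finRotate _ i))) e.2

lemma boundary_eq : P.boundary = ⋃ e : P.Side, e.closed := by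
  simp only [boundary, SimplePolygon.curve_eq]
  rw [iUnion_sigma]
  rfl

lemma isCompact_boundary : IsCompact P.boundary :=
  isCompact_iUnion fun k => (P.bd k).isCompact_curve

lemma isClosed_carrier : IsClosed P.carrier :=
  P.outer.isClosed_region.sdiff (isOpen_iUnion fun i => (P.obstacle i).isOpen_inside)

lemma isBounded_carrier : Bornology.IsBounded P.carrier :=
  P.outer.isBounded_region.subset sdiff_subset

lemma fst_mem_corners (e : P.Side) : e.src ∈ P.corners := by
  rw [corners_eq]
  exact Finset.mem_biUnion.2 ⟨e.1, Finset.mem_univ _, Finset.mem_image.2 ⟨e.2, by simp, rfl⟩⟩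

lemma snd_mem_corners (e : P.Side) : e.tgt ∈ P.corners := by
  rw [corners_eq]
  exact Finset.mem_biUnion.2 ⟨e.1, Finset.mem_univ _, Finset.mem_image.2 ⟨_, by simp, rfl⟩⟩

lemma mem_closed_iff {e : P.Side} {x : Plane} :
    x ∈ e.closed ↔ x = e.src ∨ x = e.tgt ∨ x ∈ e.interior := by
  rw [Side.closed, Side.interior, ← insert_endpoints_openSegment]
  rfl

lemma mem_interior_iff {e : P.Side} {x : Plane} : x ∈ e.interior ↔
    ∃ s ∈ Ioo (0 : ℝ) 1, x = (P.bd e.1).poly.edgePath ℝ e.2 s := by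
  rw [Side.interior, openSegment_eq_image']
  simp only [SimplePolygon.edgePath_apply, mem_image, Side.src, Side.tgt, eq_comm]

lemma interior_subset_closed (e : P.Side) : e.interior ⊆ e.closed := openSegment_subset_segment _ _ _

/-- Different sides have no common interior points. -/
lemma side_eq_of_mem {e e' : P.Side} {x : Plane} (h : x ∈ e.interior) (h' : x ∈ e'.interior) :
    e = e' := by
  obtain ⟨k, i⟩ := e
  obtain ⟨k', i'⟩ := e'
  have hk : k = k' := by
    by_contra hne
    exact (disjoint_curve hne).ne_of_mem (closed_subset_curve _ (interior_subset_closed _ h))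
      (closed_subset_curve _ (interior_subset_closed _ h')) rfl
  subst hk
  obtain ⟨s, hs, e1⟩ := mem_interior_iff.1 h
  obtain ⟨t, ht, e2⟩ := mem_interior_iff.1 h'
  have := (P.bd k).injective i i' s ⟨hs.1.le, hs.2⟩ t ⟨ht.1.le, ht.2⟩ (e1.symm.trans e2)
  rw [this.1]

lemma corner_notMem_interior {v : Plane} (hv : v ∈ P.corners) (e : P.Side) : v ∉ e.interior := by
  intro h
  rw [corners_eq] at hv
  obtain ⟨k, _, hv⟩ := Finset.mem_biUnion.1 hv
  have hk : k = e.1 := by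
    by_contra hne
    exact (disjoint_curve hne).ne_of_mem ((P.bd k).vertex_mem_curve hv)
      (closed_subset_curve _ (interior_subset_closed _ h)) rfl
  subst hk
  obtain ⟨j, _, hj⟩ := Finset.mem_image.1 hv
  obtain ⟨s, hs, e1⟩ := mem_interior_iff.1 h
  have := ((P.bd e.1).injective e.2 j s ⟨hs.1.le, hs.2⟩ 0 (by simp) (by
    rw [← e1, ← hj, SimplePolygon.edgePath_apply, zero_smul, add_zero])).2
  exact hs.1.ne' this

lemma fst_ne_snd (e : P.Side) : e.src ≠ e.tgt := by
  intro h
  have := corner_notMem_interior (fst_mem_corners e) e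
  rw [Side.interior, h, openSegment_same] at this
  exact this rfl

lemma mem_boundary_cases {x : Plane} (hx : x ∈ P.boundary) :
    x ∈ P.corners ∨ ∃ e : P.Side, x ∈ e.interior := by
  rw [boundary_eq] at hx
  obtain ⟨e, he⟩ := mem_iUnion.1 hx
  rcases mem_closed_iff.1 he with rfl | rfl | h
  · exact Or.inl (fst_mem_corners e)
  · exact Or.inl (snd_mem_corners e)
  · exact Or.inr ⟨e, h⟩

lemma corner_mem_boundary {v : Plane} (hv : v ∈ P.corners) : v ∈ P.boundary := by
  rw [corners_eq] at hv
  obtain ⟨k, _, hv⟩ := Finset.mem_biUnion.1 hv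
  exact mem_iUnion.2 ⟨k, (P.bd k).vertex_mem_curve hv⟩

lemma side_mem_boundary {e : P.Side} {x : Plane} (hx : x ∈ e.interior) : x ∈ P.boundary := by
  rw [boundary_eq]
  exact mem_iUnion.2 ⟨e, interior_subset_closed e hx⟩

lemma eventually_mem_closed (y : Plane) :
    ∀ᶠ x in 𝓝 y, ∀ e : P.Side, x ∈ e.closed → y ∈ e.closed := by
  rw [eventually_all]
  intro e
  by_cases hy : y ∈ e.closed
  · exact Eventually.of_forall fun _ _ => hy
  · have hc : IsClosed e.closed := by
      rw [Side.closed, segment_eq_image_lineMap]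
      exact (isCompact_Icc.image AffineMap.lineMap_continuous).isClosed
    filter_upwards [hc.isOpen_compl.mem_nhds hy] with x hx hx'
    exact absurd hx' hx

lemma mem_interior_carrier {x : Plane} (h : x ∈ P.outer.inside)
    (h' : ∀ i, x ∉ (P.obstacle i).region) : x ∈ interior P.carrier := by
  have ho : IsOpen (P.outer.inside \ ⋃ i, (P.obstacle i).region) :=
    P.outer.isOpen_inside.sdiff
      (isClosed_iUnion_of_finite fun i => (P.obstacle i).isClosed_region)
  refine interior_maximal (fun y hy => ?_) ho ⟨h, by simpa using h'⟩
  refine ⟨Or.inr hy.1, fun hm => hy.2 ?_⟩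
  obtain ⟨i, hi⟩ := mem_iUnion.1 hm
  exact mem_iUnion.2 ⟨i, Or.inr hi⟩

lemma carrier_diff_interior_subset : P.carrier \ interior P.carrier ⊆ P.boundary := by
  rintro x ⟨⟨h1, h2⟩, h3⟩
  by_contra hb
  have hb' : ∀ k, x ∉ (P.bd k).curve := fun k hk => hb (mem_iUnion.2 ⟨k, hk⟩)
  apply h3
  refine mem_interior_carrier (h1.resolve_left (hb' none)) fun i hi => ?_
  exact h2 (mem_iUnion.2 ⟨i, hi.resolve_left (hb' (some i))⟩)

lemma _root_.Billiard.Sector.mono_nhds {S T S' T' : Set Plane} {c : Plane} {φ β : ℝ}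
    (h : Sector S T c φ β) (hS : ∀ᶠ x in 𝓝 c, x ∈ S → x ∈ S') (hT : ∀ᶠ x in 𝓝 c, x ∈ T → x ∈ T') :
    Sector S' T' c φ β := by
  obtain ⟨r, hr, hs⟩ := h
  obtain ⟨r', hr', hb⟩ := Metric.eventually_nhds_iff.1 (hS.and hT)
  have hd : ∀ s ∈ Ioo 0 (min r r'), ∀ θ, dist (c + s • dir θ) c < r' := fun s hs θ => by
    rw [dist_self_add_left, norm_smul, norm_dir, mul_one, Real.norm_eq_abs, abs_of_pos hs.1]
    exact hs.2.trans_le (min_le_right _ _)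
  have hle : ∀ s ∈ Ioo 0 (min r r'), s ∈ Ioo 0 r := fun s hs =>
    ⟨hs.1, hs.2.trans_le (min_le_left _ _)⟩
  exact ⟨min r r', lt_min hr hr', fun s hs' =>
    ⟨fun θ hθ => (hb (hd s hs' _)).1 ((hs s (hle s hs')).1 θ hθ),
      fun θ hθ => (hb (hd s hs' _)).2 ((hs s (hle s hs')).2 θ hθ)⟩⟩

lemma _root_.Billiard.Sector.symm {S T : Set Plane} {c : Plane} {φ β : ℝ}
    (h : Sector S T c φ β) : Sector T S c (φ + β) (2 * Real.pi - β) := by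
  obtain ⟨r, hr, hs⟩ := h
  refine ⟨r, hr, fun s hs' => ⟨fun θ hθ => ?_, fun θ hθ => ?_⟩⟩
  · rw [add_assoc]
    exact (hs s hs').2 _ ⟨by linarith [hθ.1], by linarith [hθ.2]⟩
  · have := (hs s hs').1 (β + θ - 2 * Real.pi) ⟨by linarith [hθ.1], by linarith [hθ.2]⟩
    rw [← dir_add_two_pi] at this
    convert this using 4
    ring

/-- The obstacles are closed and avoid the outer curve, so near `c` only the outer polygon matters.
-/
lemma sector_outer {c : Plane} {φ β : ℝ} (hc : c ∈ P.outer.curve)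
    (h : Sector P.outer.inside P.outer.regionᶜ c φ β) :
    Sector (interior P.carrier) P.carrierᶜ c φ β := by
  refine h.mono_nhds ?_ (Eventually.of_forall fun x hx hm => hx hm.1)
  have : ∀ i, ∀ᶠ x in 𝓝 c, x ∉ (P.obstacle i).region := fun i =>
    (P.obstacle i).isClosed_region.isOpen_compl.mem_nhds fun hm =>
      P.outer.disjoint_curve_inside.ne_of_mem hc (P.obstacle_subset i hm) rfl
  filter_upwards [eventually_all.2 this] with x hx hin
  exact mem_interior_carrier hin hx

/-- The table lies outside the obstacle, so the complementary sector appears. The other obstacles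
and the outer curve stay away from `c`. -/
lemma sector_obstacle {i : Fin P.q} {c : Plane} {φ β : ℝ} (hc : c ∈ (P.obstacle i).curve)
    (h : Sector (P.obstacle i).inside (P.obstacle i).regionᶜ c φ β) :
    Sector (interior P.carrier) P.carrierᶜ c (φ + β) (2 * Real.pi - β) := by
  refine h.symm.mono_nhds ?_
    (Eventually.of_forall fun x hx hm => hm.2 (mem_iUnion.2 ⟨i, hx⟩))
  have : ∀ j, ∀ᶠ x in 𝓝 c, x ∉ (P.obstacle i).region → x ∉ (P.obstacle j).region := fun j => by
    by_cases hij : i = j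
    · subst hij; exact Eventually.of_forall fun x hx => hx
    · filter_upwards [(P.obstacle j).isClosed_region.isOpen_compl.mem_nhds fun hm =>
        (P.obstacle_disjoint i j hij).ne_of_mem (Or.inl hc) hm rfl] with x hx _
      exact hx
  filter_upwards [eventually_all.2 this,
    P.outer.isOpen_inside.mem_nhds (P.obstacle_subset i (Or.inl hc))] with x hx hin hnot
  exact mem_interior_carrier hin fun j => hx j hnot

variable (P) in
/-- The local structure of `P` at its corners and sides, with the sum of the angles. -/
theorem exists_angle : ∃ α : Plane → ℝ,
    ∑ v ∈ P.corners, α v = Real.pi * ((P.corners.card : ℝ) + 2 * (P.q : ℝ) - 2) ∧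
    (∀ v ∈ P.corners, α v ∈ Ioo 0 (2 * Real.pi) ∧
      ∃ φ, Sector (interior P.carrier) P.carrierᶜ v φ (α v)) ∧
    ∀ e : P.Side, ∀ c ∈ e.interior, ∃ φ k : ℝ, e.tgt - e.src = k • dir φ ∧
      Sector (interior P.carrier) P.carrierᶜ c φ Real.pi := by
  classical
  choose β hsum hvert hside using fun k => (P.bd k).exists_interiorAngle
  set a : Option (Fin P.q) → Plane → ℝ := fun k v => match k with
    | none => β none v
    | some i => 2 * Real.pi - β (some i) v with ha
  have hdisj : ∀ k k', k ≠ k' → Disjoint (P.bd k).vertexSet (P.bd k').vertexSet := by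
    intro k k' h
    rw [Finset.disjoint_left]
    intro v hv hv'
    exact (disjoint_curve h).ne_of_mem ((P.bd k).vertex_mem_curve hv)
      ((P.bd k').vertex_mem_curve hv') rfl
  -- The boundary curves are disjoint, so a corner belongs to only one of them and the sum has one
  -- nonzero term.
  have hα : ∀ k, ∀ v ∈ (P.bd k).vertexSet,
      (∑ k, if v ∈ (P.bd k).vertexSet then a k v else 0) = a k v := by
    intro k v hv
    rw [Finset.sum_eq_single k, if_pos hv]
    · intro k' _ hk'
      rw [if_neg]
      exact fun h => Finset.disjoint_left.1 (hdisj _ _ hk') h hv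
    · simp
  refine ⟨fun v => ∑ k, if v ∈ (P.bd k).vertexSet then a k v else 0, ?_, ?_, ?_⟩
  · rw [corners_eq, Finset.sum_biUnion fun k _ k' _ h => hdisj k k' h,
      Finset.card_biUnion fun k _ k' _ h => hdisj k k' h]
    simp_rw [SimplePolygon.card_vertexSet]
    have h1 : ∀ k, ∑ v ∈ (P.bd k).vertexSet,
        (∑ k, if v ∈ (P.bd k).vertexSet then a k v else 0) = ∑ v ∈ (P.bd k).vertexSet, a k v :=
      fun k => Finset.sum_congr rfl fun v hv => hα k v hv
    simp_rw [h1]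
    rw [Fintype.sum_option, Fintype.sum_option]
    have h2 : ∑ v ∈ (P.bd none).vertexSet, a none v = _ := hsum none
    -- The sum is `2πn - (n - 2) π`, since the angles of the table at an obstacle complement its
    -- interior angles.
    have h3 : ∀ i, ∑ v ∈ (P.bd (some i)).vertexSet, a (some i) v =
        ((P.bd (some i)).n + 2) * Real.pi := by
      intro i
      simp only [ha]
      rw [Finset.sum_sub_distrib, hsum (some i), Finset.sum_const,
        SimplePolygon.card_vertexSet, nsmul_eq_mul]
      ring
    rw [h2]
    simp_rw [h3]
    rw [← Finset.sum_mul, Finset.sum_add_distrib]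
    simp only [Finset.sum_const, Finset.card_univ, Fintype.card_fin, nsmul_eq_mul]
    push_cast
    ring
  · intro v hv
    rw [corners_eq] at hv
    obtain ⟨k, _, hv⟩ := Finset.mem_biUnion.1 hv
    dsimp only
    rw [hα k v hv]
    obtain ⟨hb, φ, hs⟩ := hvert k v hv
    cases k with
    | none => exact ⟨hb, φ, sector_outer (P.outer.vertex_mem_curve hv) hs⟩
    | some i =>
      exact ⟨⟨by simp only [ha]; linarith [hb.2], by simp only [ha]; linarith [hb.1]⟩, _,
        sector_obstacle ((P.obstacle i).vertex_mem_curve hv) hs⟩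
  · rintro ⟨k, i⟩ c hc
    obtain ⟨φ, m, he, hs⟩ := hside k i c hc
    have hcc := closed_subset_curve _ (interior_subset_closed _ hc)
    cases k with
    | none => exact ⟨φ, m, he, sector_outer hcc hs⟩
    | some j =>
      refine ⟨φ + Real.pi, -m, ?_, ?_⟩
      · rw [dir_add_pi, smul_neg, neg_smul, neg_neg]; exact he
      · have := sector_obstacle hcc hs
        rwa [show 2 * Real.pi - Real.pi = Real.pi by ring] at this

lemma _root_.Billiard.Sector.mem_closure {S T : Set Plane} {c : Plane} {φ β : ℝ}
    (h : Sector S T c φ β) (hβ : β < 2 * Real.pi) : c ∈ closure T := by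
  obtain ⟨r, hr, hs⟩ := h
  rw [Metric.mem_closure_iff]
  intro ε hε
  have hm : 0 < min r ε := lt_min hr hε
  refine ⟨_, (hs (min r ε / 2) ⟨by linarith, by linarith [min_le_left r ε]⟩).2
    ((β + 2 * Real.pi) / 2) ⟨by linarith, by linarith⟩, ?_⟩
  rw [dist_self_add_right, norm_smul, norm_dir, mul_one, Real.norm_eq_abs,
    abs_of_pos (by linarith)]
  linarith [min_le_right r ε]

/-- Every sector of the table at a boundary point is less than a full turn, so the point is a limit
of points outside the table. -/
lemma boundary_disjoint_interior {x : Plane} (hx : x ∈ P.boundary) : x ∉ interior P.carrier := by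
  obtain ⟨α, _, hv, hs⟩ := P.exists_angle
  have : x ∈ closure P.carrierᶜ := by
    rcases mem_boundary_cases hx with h | ⟨e, h⟩
    · obtain ⟨hb, φ, h⟩ := hv x h
      exact h.mem_closure hb.2
    · obtain ⟨φ, k, _, h⟩ := hs e x h
      exact h.mem_closure (by linarith [Real.pi_pos])
  rwa [closure_compl] at this

/-- The angles of the directions that point from `v` into the interior of `P`. -/
def inwardAngles (P : Table) (v : Plane) : Set ℝ :=
  {θ | ∃ ε > 0, ∀ s ∈ Ioo (0 : ℝ) ε, v + s • dir θ ∈ interior P.carrier}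

lemma angle_def (v : Plane) :
    P.angle v = volume.real (inwardAngles P v ∩ Ioc (-Real.pi) Real.pi) := by
  rw [angle]
  congr 1
  ext θ
  exact and_comm

lemma inwardAngles_add_int {v : Plane} {θ : ℝ} (k : ℤ) :
    θ + k * (2 * Real.pi) ∈ inwardAngles P v ↔ θ ∈ inwardAngles P v := by
  have : Function.Periodic dir (2 * Real.pi) := dir_add_two_pi
  have h := this.int_mul k θ
  simp only [inwardAngles, mem_ofPred_eq]
  rw [h]

lemma _root_.Billiard.Sector.mem_inwardAngles {v : Plane} {φ β : ℝ}
    (h : Sector (interior P.carrier) P.carrierᶜ v φ β) {θ : ℝ} (hθ : θ ∈ Ioo 0 β) :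
    φ + θ ∈ inwardAngles P v := by
  obtain ⟨r, hr, hs⟩ := h
  exact ⟨r, hr, fun s hs' => (hs s hs').1 θ hθ⟩

lemma _root_.Billiard.Sector.notMem_inwardAngles {v : Plane} {φ β : ℝ}
    (h : Sector (interior P.carrier) P.carrierᶜ v φ β) {θ : ℝ} (hθ : θ ∈ Ioo β (2 * Real.pi)) :
    φ + θ ∉ inwardAngles P v := by
  obtain ⟨r, hr, hs⟩ := h
  rintro ⟨ε, hε, hin⟩
  have hm : 0 < min r ε := lt_min hr hε
  exact (hs (min r ε / 2) ⟨by linarith, by linarith [min_le_left r ε]⟩).2 θ hθ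
    (interior_subset (hin _ ⟨by linarith, by linarith [min_le_right r ε]⟩))

lemma _root_.Billiard.Sector.inwardAngles_cases {v : Plane} {φ β : ℝ}
    (h : Sector (interior P.carrier) P.carrierᶜ v φ β) {θ : ℝ} (hθ : θ ∈ inwardAngles P v) :
    ∃ k : ℤ, θ + k * (2 * Real.pi) - φ ∈ Icc 0 β := by
  obtain ⟨k, hk, -⟩ := existsUnique_add_zsmul_mem_Ico (a := 2 * Real.pi) Real.two_pi_pos θ φ
  rw [zsmul_eq_mul] at hk
  refine ⟨k, by linarith [hk.1], ?_⟩
  by_contra! hc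
  refine h.notMem_inwardAngles (θ := θ + k * (2 * Real.pi) - φ) ⟨hc, by linarith [hk.2]⟩ ?_
  rw [add_sub_cancel]
  exact (inwardAngles_add_int k).2 hθ

/-- Modulo `2π` the set is an open interval, possibly with some end points, so it differs from an
open set by a countable one. -/
lemma measurableSet_inwardAngles {v : Plane} (hv : v ∈ P.corners) :
    MeasurableSet (inwardAngles P v) := by
  obtain ⟨α, _, hα, _⟩ := P.exists_angle
  obtain ⟨hb, φ, hs⟩ := hα v hv
  set O : Set ℝ := ⋃ k : ℤ, Ioo (φ - k * (2 * Real.pi)) (φ - k * (2 * Real.pi) + α v)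
  have hO : O ⊆ inwardAngles P v := by
    refine iUnion_subset fun k θ hθ => ?_
    rw [← inwardAngles_add_int k]
    have := hs.mem_inwardAngles (θ := θ + k * (2 * Real.pi) - φ)
      ⟨by linarith [hθ.1], by linarith [hθ.2]⟩
    rwa [add_sub_cancel] at this
  have hc : (inwardAngles P v \ O).Countable := by
    refine Countable.mono (s₂ := range (fun k : ℤ => φ - k * (2 * Real.pi)) ∪
      range (fun k : ℤ => φ - k * (2 * Real.pi) + α v)) ?_
      ((countable_range _).union (countable_range _))
    rintro θ ⟨h1, h2⟩
    obtain ⟨k, hk⟩ := hs.inwardAngles_cases h1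
    have h3 : θ ∉ Ioo (φ - k * (2 * Real.pi)) (φ - k * (2 * Real.pi) + α v) :=
      fun h => h2 (mem_iUnion.2 ⟨k, h⟩)
    by_contra h4
    simp only [mem_union, mem_range, not_or, not_exists] at h4
    exact h3 ⟨lt_of_le_of_ne (by linarith [hk.1]) (h4.1 k),
      lt_of_le_of_ne (by linarith [hk.2]) fun e => h4.2 k e.symm⟩
  rw [← union_sdiff_cancel hO]
  exact (MeasurableSet.iUnion fun k => measurableSet_Ioo).union hc.measurableSet

/-- A `2π`-periodic set has the same measure in all windows of length `2π`. In the window that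
starts at `φ` the set is an interval of length `β`, up to end points. -/
lemma angle_eq {v : Plane} (hv : v ∈ P.corners) {φ β : ℝ} (hβ : β ∈ Ioo 0 (2 * Real.pi))
    (h : Sector (interior P.carrier) P.carrierᶜ v φ β) : P.angle v = β := by
  have hT : (0 : ℝ) < 2 * Real.pi := Real.two_pi_pos
  have key : volume (inwardAngles P v ∩ Ioc (-Real.pi) (-Real.pi + 2 * Real.pi)) =
      volume (inwardAngles P v ∩ Ioc φ (φ + 2 * Real.pi)) := by
    refine (isAddFundamentalDomain_Ioc hT (-Real.pi)).measure_set_eq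
      (isAddFundamentalDomain_Ioc hT φ) (measurableSet_inwardAngles hv) ?_
    rintro ⟨g, hg⟩
    obtain ⟨k, rfl⟩ := AddSubgroup.mem_zmultiples_iff.1 hg
    ext θ
    have : (k • (2 * Real.pi) + θ) = θ + k * (2 * Real.pi) := by rw [zsmul_eq_mul, add_comm]
    change k • (2 * Real.pi) + θ ∈ inwardAngles P v ↔ _
    rw [this, inwardAngles_add_int]
  rw [angle_def, Measure.real, show Ioc (-Real.pi) Real.pi =
    Ioc (-Real.pi) (-Real.pi + 2 * Real.pi) by congr 1; ring, key]
  have h1 : Ioo φ (φ + β) ⊆ inwardAngles P v ∩ Ioc φ (φ + 2 * Real.pi) := fun θ hθ => by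
    refine ⟨?_, hθ.1, by linarith [hθ.2, hβ.2]⟩
    have := h.mem_inwardAngles (θ := θ - φ) ⟨by linarith [hθ.1], by linarith [hθ.2]⟩
    rwa [add_sub_cancel] at this
  have h2 : inwardAngles P v ∩ Ioc φ (φ + 2 * Real.pi) ⊆ Icc φ (φ + β) ∪ {φ + 2 * Real.pi} := by
    rintro θ ⟨hin, hθ⟩
    rcases hθ.2.lt_or_eq with hlt | rfl
    · left
      refine ⟨hθ.1.le, ?_⟩
      by_contra! hc
      refine h.notMem_inwardAngles (θ := θ - φ) ⟨by linarith, by linarith⟩ ?_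
      rwa [add_sub_cancel]
    · exact Or.inr rfl
  have h3 : volume (inwardAngles P v ∩ Ioc φ (φ + 2 * Real.pi)) = ENNReal.ofReal β := by
    apply le_antisymm
    · refine (measure_mono h2).trans ((measure_union_le _ _).trans ?_)
      simp
    · refine le_trans ?_ (measure_mono h1)
      simp
  rw [h3, ENNReal.toReal_ofReal hβ.1.le]

variable (P) in
/-- The sum of the angles of a polygon with obstacles. -/
theorem sum_angle :
    ∑ v ∈ P.corners, P.angle v = Real.pi * ((P.corners.card : ℝ) + 2 * (P.q : ℝ) - 2) := by
  obtain ⟨α, h, hα, _⟩ := P.exists_angle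
  rw [← h]
  refine Finset.sum_congr rfl fun v hv => ?_
  obtain ⟨hb, φ, hs⟩ := hα v hv
  exact angle_eq hv hb hs

end Table

end Billiard

/-! ### Orbits with itineraries, time reversal and unfolding -/

namespace Billiard

open Filter Topology

namespace Table

variable {P : Table}

/-- The linear reflection in the direction of a side. -/
noncomputable def Side.refl (e : P.Side) : Plane ≃ₗᵢ[ℝ] Plane :=
  (Submodule.span ℝ {e.tgt - e.src}).reflection

/-- `P.Orbit w x u t y u'`: the billiard orbit that starts at `x` with velocity `u` and is
reflected at the sides in the list `w` reaches the point `y` with velocity `u'` at time `t`. -/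
inductive Orbit (P : Table) : List P.Side → Plane → Plane → ℝ → Plane → Plane → Prop
  | flight (x u : Plane) (t : ℝ) (hfree : P.FreeFlight x u t) : Orbit P [] x u t (x + t • u) u
  | bounce (e : P.Side) (w : List P.Side) (x u : Plane) (t t' : ℝ) (y u' : Plane)
      (hfree : P.FreeFlight x u t) (hmem : x + t • u ∈ e.interior)
      (hnext : Orbit P w (x + t • u) (e.refl u) t' y u') : Orbit P (e :: w) x u (t + t') y u'

lemma orbit_nil {x u y u' : Plane} {t : ℝ} :
    P.Orbit [] x u t y u' ↔ P.FreeFlight x u t ∧ y = x + t • u ∧ u' = u := by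
  constructor
  · rintro ⟨⟩; exact ⟨by assumption, rfl, rfl⟩
  · rintro ⟨h, rfl, rfl⟩; exact .flight _ _ _ h

lemma orbit_cons {e : P.Side} {w : List P.Side} {x u y u' : Plane} {t : ℝ} :
    P.Orbit (e :: w) x u t y u' ↔ ∃ t₁ t₂, t = t₁ + t₂ ∧ P.FreeFlight x u t₁ ∧
      x + t₁ • u ∈ e.interior ∧ P.Orbit w (x + t₁ • u) (e.refl u) t₂ y u' := by
  constructor
  · intro h
    cases h with
    | bounce _ _ _ _ t t' _ _ h1 h2 h3 => exact ⟨t, t', rfl, h1, h2, h3⟩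
  · rintro ⟨t₁, t₂, rfl, h1, h2, h3⟩; exact .bounce _ _ _ _ _ _ _ _ h1 h2 h3

lemma orbitReaches_iff {v x u : Plane} {t : ℝ} :
    P.OrbitReaches v x u t ↔ ∃ w u', P.Orbit w x u t v u' := by
  constructor
  · intro h
    induction h with
    | arrive x u t hfree hv => exact ⟨[], u, hv ▸ .flight x u t hfree⟩
    | bounce x u a b t t' hfree hside hmem _ ih =>
      obtain ⟨w, u', hw⟩ := ih
      obtain ⟨e, rfl, rfl⟩ := isSide_iff.1 hside
      exact ⟨e :: w, u', .bounce e w x u t t' v u' hfree hmem hw⟩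
  · rintro ⟨w, u', h⟩
    induction h with
    | flight x u t hfree => exact .arrive x u t hfree rfl
    | bounce e w x u t t' y u' hfree hmem _ ih =>
      exact .bounce x u e.src e.tgt t t' hfree (isSide_iff.2 ⟨e, rfl, rfl⟩) hmem ih

namespace Orbit

variable {w : List P.Side} {x u y u' : Plane} {t : ℝ}

lemma pos (h : P.Orbit w x u t y u') : 0 < t := by
  induction h with
  | flight x u t hfree => exact hfree.1
  | bounce e w x u t t' y u' hfree _ _ ih => exact add_pos hfree.1 ih

lemma norm_eq (h : P.Orbit w x u t y u') : ‖u'‖ = ‖u‖ := by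
  induction h with
  | flight x u t hfree => rfl
  | bounce e w x u t t' y u' hfree _ _ ih => rw [ih, LinearIsometryEquiv.norm_map]

end Orbit

lemma FreeFlight.reverse {x u : Plane} {t : ℝ} (h : P.FreeFlight x u t) :
    P.FreeFlight (x + t • u) (-u) t := by
  refine ⟨h.1, fun s hs => ?_⟩
  have := h.2 (t - s) ⟨by linarith [hs.2], by linarith [hs.1]⟩
  convert this using 1
  rw [sub_smul, smul_neg]; abel

lemma Side.refl_refl (e : P.Side) (u : Plane) : e.refl (e.refl u) = u :=
  Submodule.reflection_reflection _ u

namespace Orbit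

variable {w : List P.Side} {x u y u' : Plane} {t : ℝ}

lemma snoc {t' : ℝ} (h : P.Orbit w x u t y u') (e : P.Side) (hy : y ∈ e.interior)
    (hf : P.FreeFlight y (e.refl u') t') :
    P.Orbit (w ++ [e]) x u (t + t') (y + t' • e.refl u') (e.refl u') := by
  induction h with
  | flight x u t hfree =>
    exact .bounce e [] x u t t' _ _ hfree hy (.flight _ _ _ hf)
  | bounce e' w x u t t'' y u' hfree hmem _ ih =>
    rw [add_assoc]
    exact .bounce e' _ x u t _ _ _ hfree hmem (ih hy hf)

/-- Reflections are involutions, so a billiard orbit run backwards is a billiard orbit. This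
exchanges orbits that arrive at a corner with orbits that leave it. -/
lemma reverse (h : P.Orbit w x u t y u') : P.Orbit w.reverse y (-u') t x (-u) := by
  induction h with
  | flight x u t hfree =>
    have := Orbit.flight _ _ _ hfree.reverse
    rwa [smul_neg, add_neg_cancel_right] at this
  | bounce e w x u t t' y u' hfree hmem _ ih =>
    have h2 : e.refl (-(e.refl u)) = -u := by rw [map_neg, e.refl_refl]
    have := ih.snoc e hmem (t' := t) (by rw [h2]; exact hfree.reverse)
    rw [h2, smul_neg, add_neg_cancel_right] at this
    rw [List.reverse_cons, add_comm]
    exact this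

lemma split {w₁ w₂ : List P.Side} {e : P.Side} (h : P.Orbit (w₁ ++ e :: w₂) x u t y u') :
    ∃ t₁ t₂ x₁ u₁, t = t₁ + t₂ ∧ P.Orbit w₁ x u t₁ x₁ u₁ ∧ x₁ ∈ e.interior ∧
      P.Orbit w₂ x₁ (e.refl u₁) t₂ y u' := by
  induction w₁ generalizing x u t with
  | nil =>
    obtain ⟨t₁, t₂, rfl, h1, h2, h3⟩ := orbit_cons.1 h
    exact ⟨t₁, t₂, _, _, rfl, .flight _ _ _ h1, h2, h3⟩
  | cons e' w₁ ih =>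
    obtain ⟨t₁, t₂, rfl, h1, h2, h3⟩ := orbit_cons.1 h
    obtain ⟨s₁, s₂, x₁, u₁, rfl, g1, g2, g3⟩ := ih h3
    exact ⟨t₁ + s₁, s₂, x₁, u₁, by ring, .bounce _ _ _ _ _ _ _ _ h1 h2 g1, g2, g3⟩

end Orbit

/-- The linear part of the isometry that unfolds the orbits with bounces `w`. -/
noncomputable def unfoldLin : List P.Side → Plane ≃ₗᵢ[ℝ] Plane
  | [] => LinearIsometryEquiv.refl ℝ Plane
  | e :: w => (unfoldLin w).trans e.refl

/-- The translation part of the isometry that unfolds the orbits with bounces `w`. -/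
noncomputable def unfoldShift : List P.Side → Plane
  | [] => 0
  | e :: w => e.refl (unfoldShift w) + (e.src - e.refl e.src)

/-- The isometry that unfolds the orbits with bounces `w` to straight lines. -/
noncomputable def unfold (w : List P.Side) (y : Plane) : Plane := unfoldLin w y + unfoldShift w

lemma measurePreserving_unfold (w : List P.Side) :
    MeasurePreserving (unfold w) volume volume :=
  (measurePreserving_add_right volume (unfoldShift w)).comp (unfoldLin w).measurePreserving

lemma Side.refl_direction (e : P.Side) : e.refl (e.tgt - e.src) = e.tgt - e.src :=
  Submodule.reflection_mem_subspace_eq_self (Submodule.mem_span_singleton_self _)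

lemma mem_interior_iff' {e : P.Side} {x : Plane} :
    x ∈ e.interior ↔ ∃ s ∈ Ioo (0 : ℝ) 1, e.src + s • (e.tgt - e.src) = x := by
  rw [Side.interior, openSegment_eq_image']; rfl

lemma refl_sub_of_mem {e : P.Side} {x : Plane} (hx : x ∈ e.interior) :
    e.refl (x - e.src) = x - e.src := by
  obtain ⟨s, _, rfl⟩ := mem_interior_iff'.1 hx
  rw [add_sub_cancel_left, map_smul, e.refl_direction]

/-- The affine reflection in the line of a side fixes the point of impact and undoes the change of
velocity. Applied to everything after the bounce, it straightens the path. -/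
lemma Orbit.unfold_eq {w : List P.Side} {x u y u' : Plane} {t : ℝ} (h : P.Orbit w x u t y u') :
    unfold w y = x + t • u ∧ unfoldLin w u' = u := by
  induction h with
  | flight x u t hfree => simp [unfold, unfoldLin, unfoldShift]
  | bounce e w x u t t' y u' hfree hmem _ ih =>
    obtain ⟨h1, h2⟩ := ih
    constructor
    · have h3 : unfold (e :: w) y = e.refl (unfold w y) + (e.src - e.refl e.src) := by
        simp only [unfold, unfoldLin, unfoldShift, LinearIsometryEquiv.trans_apply, map_add]
        abel
      have h4 := refl_sub_of_mem hmem
      rw [map_sub] at h4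
      rw [h3, h1, map_add, map_smul, e.refl_refl, add_smul]
      have h5 : e.refl (x + t • u) = x + t • u - e.src + e.refl e.src := by
        rw [← h4]; abel
      rw [h5]; abel
    · rw [unfoldLin, LinearIsometryEquiv.trans_apply, h2, e.refl_refl]

lemma FreeFlight.unique {x u : Plane} {t₁ t₂ : ℝ} (h₁ : P.FreeFlight x u t₁)
    (h₂ : P.FreeFlight x u t₂) (b₁ : x + t₁ • u ∉ interior P.carrier)
    (b₂ : x + t₂ • u ∉ interior P.carrier) : t₁ = t₂ := by
  rcases lt_trichotomy t₁ t₂ with h | h | h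
  · exact absurd (h₂.2 t₁ ⟨h₁.1, h⟩) b₁
  · exact h
  · exact absurd (h₁.2 t₂ ⟨h₂.1, h⟩) b₂

lemma side_notMem_interior {e : P.Side} {x : Plane} (hx : x ∈ e.interior) :
    x ∉ interior P.carrier :=
  boundary_disjoint_interior (side_mem_boundary hx)

lemma corner_notMem_interior_carrier {v : Plane} (hv : v ∈ P.corners) :
    v ∉ interior P.carrier :=
  boundary_disjoint_interior (corner_mem_boundary hv)

namespace Orbit

/-- The itinerary of an orbit up to its arrival at a corner is determined by its start. -/
lemma unique_of_corner {w w' : List P.Side} {x u y y' u₁ u₂ : Plane} {t t' : ℝ}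
    (h : P.Orbit w x u t y u₁) (h' : P.Orbit w' x u t' y' u₂) (hy : y ∈ P.corners)
    (hy' : y' ∈ P.corners) : w = w' ∧ t = t' := by
  induction h generalizing w' t' with
  | flight x u t hfree =>
    cases h' with
    | flight _ _ _ hfree' =>
      exact ⟨rfl, hfree.unique hfree' (corner_notMem_interior_carrier hy)
        (corner_notMem_interior_carrier hy')⟩
    | bounce e w' _ _ s s' _ _ hfree' hmem' hnext' =>
      have := hfree.unique hfree' (corner_notMem_interior_carrier hy)
        (side_notMem_interior hmem')
      subst this
      exact absurd hmem' (corner_notMem_interior hy e)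
  | bounce e w x u t s y u₁ hfree hmem hnext ih =>
    cases h' with
    | flight _ _ _ hfree' =>
      have := hfree.unique hfree' (side_notMem_interior hmem)
        (corner_notMem_interior_carrier hy')
      subst this
      exact absurd hmem (corner_notMem_interior hy' e)
    | bounce e' w' _ _ t' s' _ _ hfree' hmem' hnext' =>
      have := hfree.unique hfree' (side_notMem_interior hmem) (side_notMem_interior hmem')
      subst this
      have := side_eq_of_mem hmem hmem'
      subst this
      obtain ⟨rfl, rfl⟩ := ih hnext' hy
      exact ⟨rfl, rfl⟩

/-- The itinerary of an orbit up to a point in the interior is determined by its start and time. -/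
lemma unique_of_interior {w w' : List P.Side} {x u y y' u₁ u₂ : Plane} {t : ℝ}
    (h : P.Orbit w x u t y u₁) (h' : P.Orbit w' x u t y' u₂) (hy : y ∈ interior P.carrier) :
    w = w' := by
  induction h generalizing w' with
  | flight x u t hfree =>
    cases w' with
    | nil => rfl
    | cons e w' =>
      obtain ⟨t₁, t₂, rfl, h1, h2, h3⟩ := orbit_cons.1 h'
      exact absurd (hfree.2 t₁ ⟨h1.1, by linarith [h3.pos]⟩) (side_notMem_interior h2)
  | bounce e w x u t s y u₁ hfree hmem hnext ih =>
    cases w' with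
    | nil =>
      obtain ⟨h1, -, -⟩ := orbit_nil.1 h'
      exact absurd (h1.2 t ⟨hfree.1, by linarith [hnext.pos]⟩) (side_notMem_interior hmem)
    | cons e' w' =>
      obtain ⟨t₁, t₂, e0, h1, h2, h3⟩ := orbit_cons.1 h'
      have := hfree.unique h1 (side_notMem_interior hmem) (side_notMem_interior h2)
      subst this
      have := side_eq_of_mem hmem h2
      subst this
      have := add_left_cancel e0
      subst this
      rw [ih h3 hy]

end Orbit

/-- A flight does not lead from a side to itself. -/
lemma FreeFlight.side_ne {x u : Plane} {t : ℝ} {e e' : P.Side} (h : P.FreeFlight x u t)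
    (hx : x ∈ e.interior) (hx' : x + t • u ∈ e'.interior) : e ≠ e' := by
  rintro rfl
  have hc : Convex ℝ e.interior := convex_openSegment _ _
  have h1 := hc hx hx' (show (0 : ℝ) ≤ 1 / 2 by norm_num) (show (0 : ℝ) ≤ 1 / 2 by norm_num)
    (by norm_num)
  have h2 : (1 / 2 : ℝ) • x + (1 / 2 : ℝ) • (x + t • u) = x + (t / 2) • u := by module
  rw [h2] at h1
  exact side_notMem_interior h1 (h.2 (t / 2) ⟨by linarith [h.1], by linarith [h.1]⟩)

end Table

end Billiard

/-! ### Orbits of bounded length have boundedly many bounces -/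

namespace Billiard

open Filter Topology

namespace Table

variable {P : Table}

open InnerProductGeometry in
/-- On a flight the angle between the velocity and the direction from a fixed point decreases by
the angle of view. -/
lemma angle_flight {c x u : Plane} {t : ℝ} (ht : 0 < t) (hu : u ≠ 0) :
    InnerProductGeometry.angle (x - c) u = InnerProductGeometry.angle (x - c) (x + t • u - c) + InnerProductGeometry.angle (x + t • u - c) u := by
  have h := EuclideanGeometry.angle_add_angle_add_angle_eq_pi (p₁ := x) (p₂ := x + t • u) c
    (by simpa using ⟨ht.ne', hu⟩)
  simp only [EuclideanGeometry.angle, vsub_eq_sub] at h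
  rw [show x - (x + t • u) = -(t • u) by abel, ← neg_sub (x + t • u) c, angle_neg_neg,
    angle_smul_left_of_pos _ _ ht, ← neg_sub x c, add_sub_cancel_left, angle_neg_left,
    angle_smul_right_of_pos _ _ ht] at h
  rw [angle_comm (x - c) (x + t • u - c), angle_comm (x + t • u - c) u]
  linarith

/-- The vector from the end point `c` of a side to the other one. -/
noncomputable def Side.ray (e : P.Side) (c : Plane) : Plane := e.src + e.tgt - c - c

lemma mem_interior_iff_ray {e : P.Side} {c : Plane} (hc : c = e.src ∨ c = e.tgt) {x : Plane} :
    x ∈ e.interior ↔ ∃ s ∈ Ioo (0 : ℝ) 1, c + s • e.ray c = x := by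
  rw [mem_interior_iff']
  rcases hc with rfl | rfl
  · have : e.ray e.src = e.tgt - e.src := by rw [Side.ray]; abel
    rw [this]
  · have : e.ray e.tgt = e.src - e.tgt := by rw [Side.ray]; abel
    rw [this]
    constructor
    · rintro ⟨s, hs, rfl⟩
      exact ⟨1 - s, ⟨by linarith [hs.2], by linarith [hs.1]⟩, by module⟩
    · rintro ⟨s, hs, rfl⟩
      exact ⟨1 - s, ⟨by linarith [hs.2], by linarith [hs.1]⟩, by module⟩

open InnerProductGeometry in
-- Two sides that leave a common corner in the same direction would overlap near it.
lemma angle_ray_pos {e e' : P.Side} {c : Plane} (hc : c = e.src ∨ c = e.tgt)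
    (hc' : c = e'.src ∨ c = e'.tgt) (hne : e ≠ e') : 0 < InnerProductGeometry.angle (e.ray c) (e'.ray c) := by
  refine lt_of_le_of_ne (angle_nonneg _ _) fun h0 => ?_
  obtain ⟨_, r, hr, h⟩ := angle_eq_zero_iff.1 h0.symm
  apply hne
  set s := min (1 / 2) (r / 2)
  have hs0 : 0 < s := lt_min (by norm_num) (by linarith)
  have hs1 : s < 1 := (min_le_left _ _).trans_lt (by norm_num)
  have hsr : s / r < 1 := by
    rw [div_lt_one hr]; exact (min_le_right _ _).trans_lt (by linarith)
  refine side_eq_of_mem (x := c + s • e.ray c)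
    ((mem_interior_iff_ray hc).2 ⟨s, ⟨hs0, hs1⟩, rfl⟩)
    ((mem_interior_iff_ray hc').2 ⟨s / r, ⟨div_pos hs0 hr, hsr⟩, ?_⟩)
  rw [h, smul_smul, div_mul_cancel₀ _ hr.ne']

open InnerProductGeometry in
lemma exists_angle_bound (c : Plane) : ∃ β > 0, ∀ e e' : P.Side, (c = e.src ∨ c = e.tgt) →
    (c = e'.src ∨ c = e'.tgt) → e ≠ e' → β ≤ InnerProductGeometry.angle (e.ray c) (e'.ray c) := by
  have h : ∀ᶠ β in 𝓝[>] (0 : ℝ), ∀ e e' : P.Side, (c = e.src ∨ c = e.tgt) →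
      (c = e'.src ∨ c = e'.tgt) → e ≠ e' → β ≤ InnerProductGeometry.angle (e.ray c) (e'.ray c) := by
    rw [eventually_all]
    intro e
    rw [eventually_all]
    intro e'
    by_cases hc : (c = e.src ∨ c = e.tgt) ∧ (c = e'.src ∨ c = e'.tgt) ∧ e ≠ e'
    · filter_upwards [Ioo_mem_nhdsGT (angle_ray_pos hc.1 hc.2.1 hc.2.2)] with β hβ _ _ _
      exact hβ.2.le
    · exact Eventually.of_forall fun β h1 h2 h3 => absurd ⟨h1, h2, h3⟩ hc
  obtain ⟨β, hβ, hpos⟩ := (h.and self_mem_nhdsWithin).exists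
  exact ⟨β, hpos, hβ⟩

/-- `P.ShortBound S δ M`: an orbit of length less than `δ` that starts at a point of `S` on a side
has at most `M` bounces. -/
def ShortBound (P : Table) (S : Set Plane) (δ : ℝ) (M : ℕ) : Prop :=
  ∀ (w : List P.Side) (e : P.Side) (x u : Plane) (t : ℝ) (y u' : Plane), x ∈ S → x ∈ e.interior →
    ‖u‖ = 1 → P.Orbit w x u t y u' → t < δ → w.length ≤ M

lemma dist_flight {x u c : Plane} {t : ℝ} (hu : ‖u‖ = 1) (ht : 0 < t) :
    dist (x + t • u) c ≤ dist x c + t := by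
  have : dist (x + t • u) x = t := by
    rw [dist_self_add_left, norm_smul, hu, mul_one, Real.norm_eq_abs, abs_of_pos ht]
  linarith [dist_triangle (x + t • u) x c]

open InnerProductGeometry in
-- Near `c` all sides that are met end at `c`. A flight from one to another lowers the angle between
-- `x - c` and the velocity by the angle between these sides, which is at least `β`. A bounce keeps
-- it, because at the point of impact `x - c` is parallel to the side.
lemma length_mul_le_angle {c : Plane} {r β : ℝ} (hc : c ∈ P.corners)
    (hr : ∀ x, dist x c < r → ∀ e : P.Side, x ∈ e.closed → c ∈ e.closed)
    (hβ : ∀ e e' : P.Side, (c = e.src ∨ c = e.tgt) →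
      (c = e'.src ∨ c = e'.tgt) → e ≠ e' → β ≤ InnerProductGeometry.angle (e.ray c) (e'.ray c))
    {w : List P.Side} {e : P.Side} {x u : Plane} {t : ℝ} {y u' : Plane} (hx : x ∈ e.interior)
    (hu : ‖u‖ = 1) (h : P.Orbit w x u t y u') (hd : dist x c + t < r) :
    w.length * β ≤ InnerProductGeometry.angle (x - c) u := by
  have hend : ∀ e : P.Side, ∀ x ∈ e.interior, dist x c < r → c = e.src ∨ c = e.tgt := by
    intro e x hx hd
    rcases mem_closed_iff.1 (hr x hd e (interior_subset_closed e hx)) with h | h | h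
    · exact Or.inl h
    · exact Or.inr h
    · exact absurd h (corner_notMem_interior hc e)
  induction w generalizing e x u t with
  | nil => simpa using angle_nonneg _ _
  | cons e' w ih =>
    obtain ⟨t₁, t₂, rfl, h1, h2, h3⟩ := orbit_cons.1 h
    have hu0 : u ≠ 0 := by rintro rfl; simp at hu
    have hd' := dist_flight (x := x) (c := c) hu h1.1
    have e1 := hend e x hx (by linarith [h1.1, h3.pos])
    have e2 := hend e' _ h2 (by linarith [h3.pos])
    have ih' := ih h2 (by rw [LinearIsometryEquiv.norm_map, hu]) h3 (by linarith)
    have hβ' := hβ e e' e1 e2 (h1.side_ne hx h2)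
    obtain ⟨s, hs, hsx⟩ := (mem_interior_iff_ray e1).1 hx
    obtain ⟨s', hs', hsx'⟩ := (mem_interior_iff_ray e2).1 h2
    have hx1 : x - c = s • e.ray c := by rw [← hsx, add_sub_cancel_left]
    have hx2 : x + t₁ • u - c = s' • e'.ray c := by rw [← hsx', add_sub_cancel_left]
    have hview : InnerProductGeometry.angle (x - c) (x + t₁ • u - c) = InnerProductGeometry.angle (e.ray c) (e'.ray c) := by
      rw [hx1, hx2, angle_smul_left_of_pos _ _ hs.1, angle_smul_right_of_pos _ _ hs'.1]
    have hrefl : InnerProductGeometry.angle (x + t₁ • u - c) (e'.refl u) = InnerProductGeometry.angle (x + t₁ • u - c) u := by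
      have hfix : e'.refl (x + t₁ • u - c) = x + t₁ • u - c := by
        rw [hx2, map_smul]
        congr 1
        have : e'.ray c = e'.tgt - e'.src ∨ e'.ray c = -(e'.tgt - e'.src) := by
          rcases e2 with rfl | rfl
          · left; rw [Side.ray]; abel
          · right; rw [Side.ray]; abel
        rcases this with h | h <;> rw [h]
        · exact e'.refl_direction
        · rw [map_neg, e'.refl_direction]
      conv_lhs => rw [← hfix]
      exact LinearIsometry.angle_map e'.refl.toLinearIsometry _ _
    rw [angle_flight h1.1 hu0, hview]
    rw [hrefl] at ih'
    rw [List.length_cons]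
    push_cast
    linarith

/-- At a corner the angle starts at most at `π` and loses `β` with each bounce. Near an interior
point of a side only that side can be met, and a flight does not return to it. -/
lemma shortBound_nhds {y : Plane} (hy : y ∈ P.boundary) :
    ∃ S ∈ 𝓝 y, ∃ δ > 0, ∃ M, P.ShortBound S δ M := by
  obtain ⟨r, hr, hball⟩ := Metric.eventually_nhds_iff.1 (P.eventually_mem_closed y)
  refine ⟨Metric.ball y (r / 2), Metric.ball_mem_nhds _ (by linarith), r / 2, by linarith, ?_⟩
  rcases mem_boundary_cases hy with hc | ⟨e₀, he₀⟩
  · obtain ⟨β, hβ, hb⟩ := P.exists_angle_bound y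
    refine ⟨⌈Real.pi / β⌉₊, fun w e x u t z u' hxS hx hu h ht => ?_⟩
    have hd : dist x y < r / 2 := hxS
    have := length_mul_le_angle hc (fun x hx => hball hx) hb hx hu h (by linarith)
    have h2 : (w.length : ℝ) ≤ Real.pi / β := by
      rw [le_div_iff₀ hβ]; exact this.trans (InnerProductGeometry.angle_le_pi _ _)
    exact_mod_cast h2.trans (Nat.le_ceil _)
  · refine ⟨0, fun w e x u t z u' hxS hx hu h ht => ?_⟩
    have hd : dist x y < r / 2 := hxS
    have hside : ∀ e : P.Side, ∀ x ∈ e.interior, dist x y < r → e = e₀ := by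
      intro e x hx hd
      rcases mem_closed_iff.1 (hball hd e (interior_subset_closed e hx)) with h | h | h
      · exact absurd (h ▸ he₀) (corner_notMem_interior (fst_mem_corners e) e₀)
      · exact absurd (h ▸ he₀) (corner_notMem_interior (snd_mem_corners e) e₀)
      · exact side_eq_of_mem h he₀
    cases w with
    | nil => simp
    | cons e' w =>
      obtain ⟨t₁, t₂, rfl, h1, h2, h3⟩ := orbit_cons.1 h
      have hd' := dist_flight (x := x) (c := y) hu h1.1
      exact absurd ((hside e x hx (by linarith)).trans
        (hside e' _ h2 (by linarith [h3.pos])).symm) (h1.side_ne hx h2)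

variable (P) in
lemma exists_shortBound : ∃ δ > 0, ∃ M, P.ShortBound P.boundary δ M := by
  refine isCompact_boundary.induction_on (p := fun S => ∃ δ > 0, ∃ M, P.ShortBound S δ M)
    ⟨1, one_pos, 0, fun w e x u t y u' hx => hx.elim⟩ ?_ ?_ ?_
  · rintro S T hST ⟨δ, hδ, M, h⟩
    exact ⟨δ, hδ, M, fun w e x u t y u' hx => h w e x u t y u' (hST hx)⟩
  · rintro S T ⟨δ, hδ, M, h⟩ ⟨δ', hδ', M', h'⟩
    refine ⟨min δ δ', lt_min hδ hδ', max M M', fun w e x u t y u' hx he hu ho ht => ?_⟩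
    rcases hx with hx | hx
    · exact (h w e x u t y u' hx he hu ho (ht.trans_le (min_le_left _ _))).trans (le_max_left _ _)
    · exact (h' w e x u t y u' hx he hu ho (ht.trans_le (min_le_right _ _))).trans
        (le_max_right _ _)
  · intro y hy
    obtain ⟨S, hS, h⟩ := shortBound_nhds hy
    exact ⟨S, mem_nhdsWithin_of_mem_nhds hS, h⟩

variable (P) in
/-- The number of bounces of an orbit is bounded in terms of its length. -/
theorem exists_bounce_bound (l : ℝ) : ∃ N : ℕ, ∀ (w : List P.Side) (x u : Plane) (t : ℝ)
    (y u' : Plane), ‖u‖ = 1 → P.Orbit w x u t y u' → t ≤ l → w.length ≤ N := by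
  obtain ⟨δ, hδ, M, hM⟩ := P.exists_shortBound
  have key : ∀ k : ℕ, ∃ N, P.ShortBound P.boundary (k * δ) N := by
    intro k
    induction k with
    | zero => exact ⟨0, fun w e x u t y u' _ _ _ h ht => by
        have := h.pos; simp at ht; linarith⟩
    | succ k ih =>
      obtain ⟨N, hN⟩ := ih
      -- A longer orbit splits into `M + 1` bounces, one bounce, and a rest with more than `N`
      -- bounces. The first part takes at least time `δ`, which leaves less than `k * δ` for the
      -- rest.
      refine ⟨N + M + 2, fun w e x u t y u' hx he hu h ht => ?_⟩
      by_contra! hlen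
      have hsplit : w = w.take (M + 1) ++ w[M + 1] :: w.drop (M + 2) := by
        rw [← List.drop_eq_getElem_cons, List.take_append_drop]
      rw [hsplit] at h
      obtain ⟨t₁, t₂, x₁, u₁, rfl, h1, h2, h3⟩ := h.split
      have ht₁ : δ ≤ t₁ := by
        by_contra! hlt
        have := hM _ e x u t₁ x₁ u₁ hx he hu h1 hlt
        rw [List.length_take] at this
        omega
      have := hN _ _ _ _ t₂ y u' (side_mem_boundary h2) h2
        (by rw [LinearIsometryEquiv.norm_map, h1.norm_eq, hu]) h3
        (by push_cast at ht; linarith)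
      rw [List.length_drop] at this
      omega
  obtain ⟨k, hk⟩ := exists_nat_gt (l / δ)
  rw [div_lt_iff₀ hδ] at hk
  obtain ⟨N, hN⟩ := key k
  -- The bound so far is for orbits that start on a side; the extra bounce is the first arrival at
  -- one.
  refine ⟨N + 1, fun w x u t y u' hu h ht => ?_⟩
  cases w with
  | nil => simp
  | cons e w =>
    obtain ⟨t₁, t₂, rfl, h1, h2, h3⟩ := orbit_cons.1 h
    have := hN w e _ _ t₂ y u' (side_mem_boundary h2) h2
      (by rw [LinearIsometryEquiv.norm_map, hu]) h3 (by linarith [h1.1])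
    simpa using this

/-! ### Counting singular orbits by itineraries -/

lemma mem_singularDirections {z u v : Plane} {l : ℝ} : u ∈ P.singularDirections z l v ↔
    ‖u‖ = 1 ∧ ∃ w t u', t ≤ l ∧ P.Orbit w z u t v u' := by
  simp only [singularDirections, orbitReaches_iff]
  constructor
  · rintro ⟨hu, t, ht, w, u', h⟩; exact ⟨hu, w, t, u', ht, h⟩
  · rintro ⟨hu, w, t, u', ht, h⟩; exact ⟨hu, t, ht, w, u', h⟩

/-- The directions of the orbits with bounces `w` from `z` to `v` of length at most `l`. -/
def directions (P : Table) (w : List P.Side) (z : Plane) (l : ℝ) (v : Plane) : Set Plane :=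
  {u | ‖u‖ = 1 ∧ ∃ t u', t ≤ l ∧ P.Orbit w z u t v u'}

/-- Unfolding along `w` sends `v` to `z + t u`. So `w` determines the vector `t u`, hence the unit
vector `u`. -/
lemma directions_subsingleton (w : List P.Side) (z : Plane) (l : ℝ) (v : Plane) :
    (directions P w z l v).Subsingleton := by
  rintro u ⟨hu, t, a, _, h⟩ u₂ ⟨hu₂, t₂, a₂, _, h₂⟩
  have h1 : t • u = t₂ • u₂ :=
    add_left_cancel (h.unfold_eq.1.symm.trans h₂.unfold_eq.1)
  have h2 : t = t₂ := by
    have := congrArg norm h1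
    rwa [norm_smul, norm_smul, hu, hu₂, Real.norm_eq_abs, Real.norm_eq_abs, abs_of_pos h.pos,
      abs_of_pos h₂.pos, mul_one, mul_one] at this
  rw [← h2] at h1
  exact smul_right_injective Plane h.pos.ne' h1

/-- The itineraries with at most `N` bounces. -/
noncomputable def words (P : Table) (N : ℕ) : Finset (List P.Side) :=
  (List.finite_length_le P.Side N).toFinset

lemma mem_words {N : ℕ} {w : List P.Side} : w ∈ words P N ↔ w.length ≤ N := by
  simp [words]

lemma singularDirections_eq {l : ℝ} {N : ℕ} (hN : ∀ (w : List P.Side) (x u : Plane) (t : ℝ)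
    (y u' : Plane), ‖u‖ = 1 → P.Orbit w x u t y u' → t ≤ l → w.length ≤ N) (z v : Plane) :
    P.singularDirections z l v = ⋃ w ∈ words P N, directions P w z l v := by
  ext u
  simp only [mem_singularDirections, mem_iUnion]
  constructor
  · rintro ⟨hu, w, t, u', ht, h⟩
    exact ⟨w, mem_words.2 (hN w _ _ _ _ _ hu h ht), hu, t, u', ht, h⟩
  · rintro ⟨w, _, hu, t, u', ht, h⟩
    exact ⟨hu, w, t, u', ht, h⟩

variable (P) in
theorem finite_singularDirections (z : Plane) (l : ℝ) (v : Plane) :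
    (P.singularDirections z l v).Finite := by
  obtain ⟨N, hN⟩ := P.exists_bounce_bound l
  rw [singularDirections_eq hN]
  exact (words P N).finite_toSet.biUnion fun w _ => (directions_subsingleton w z l v).finite

open Classical in
/-- The number of singular orbits is the number of possible itineraries. -/
lemma gcAt_eq {l : ℝ} {N : ℕ} (hN : ∀ (w : List P.Side) (x u : Plane) (t : ℝ)
    (y u' : Plane), ‖u‖ = 1 → P.Orbit w x u t y u' → t ≤ l → w.length ≤ N) (z : Plane)
    {v : Plane} (hv : v ∈ P.corners) :
    P.gcAt z l v = ∑ w ∈ words P N, if (directions P w z l v).Nonempty then 1 else 0 := by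
  rw [gcAt, singularDirections_eq hN, ← Finset.card_filter]
  choose! f hf using fun w (h : (directions P w z l v).Nonempty) => h
  have himg : (⋃ w ∈ words P N, directions P w z l v) =
      f '' ((words P N).filter fun w => (directions P w z l v).Nonempty) := by
    ext u
    simp only [mem_iUnion, mem_image, Finset.coe_filter]
    constructor
    · rintro ⟨w, hw, hu⟩
      exact ⟨w, ⟨hw, ⟨u, hu⟩⟩, directions_subsingleton w z l v (hf w ⟨u, hu⟩) hu⟩
    · rintro ⟨w, ⟨hw, hne⟩, rfl⟩
      exact ⟨w, hw, hf w hne⟩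
  rw [himg, InjOn.ncard_image, ncard_coe_finset]
  intro w hw w' hw' e
  simp only [Finset.coe_filter] at hw hw'
  obtain ⟨_, t, u', _, h⟩ := hf w hw.2
  obtain ⟨_, t', u'', _, h'⟩ := hf w' hw'.2
  rw [e] at h
  exact (h.unique_of_corner h' hv hv).1

end Table

end Billiard

/-! ### Continuation of nonsingular orbits -/

namespace Billiard

open Filter Topology

namespace Table

variable {P : Table}

lemma exists_dir {u : Plane} (hu : ‖u‖ = 1) (φ : ℝ) :
    ∃ θ ∈ Ico 0 (2 * Real.pi), u = dir (φ + θ) := by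
  have h1 : u = dir (toC u).arg := by
    apply toC.injective
    rw [toC_dir]
    conv_lhs => rw [← Complex.norm_mul_exp_arg_mul_I (toC u)]
    rw [LinearIsometryEquiv.norm_map, hu]; simp
  obtain ⟨k, hk, -⟩ := existsUnique_add_zsmul_mem_Ico (a := 2 * Real.pi) Real.two_pi_pos
    (toC u).arg φ
  rw [zsmul_eq_mul] at hk
  refine ⟨(toC u).arg + k * (2 * Real.pi) - φ, ⟨by linarith [hk.1], by linarith [hk.2]⟩, ?_⟩
  have : Function.Periodic dir (2 * Real.pi) := dir_add_two_pi
  rw [add_sub_cancel, this.int_mul k, ← h1]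

lemma dir_add (φ θ : ℝ) :
    dir (φ + θ) = Real.cos θ • dir φ + Real.sin θ • dir (φ + Real.pi / 2) := by
  ext i
  fin_cases i
  · simp [dir, Real.cos_add, Real.sin_add]; ring
  · simp [dir, Real.cos_add, Real.sin_add]; ring

lemma refl_dir {e : P.Side} {φ k : ℝ} (he : e.tgt - e.src = k • dir φ) (θ : ℝ) :
    e.refl (dir (φ + θ)) = dir (φ - θ) := by
  have hk : k ≠ 0 := by
    rintro rfl
    rw [zero_smul, sub_eq_zero] at he
    exact fst_ne_snd e he.symm
  have h1 : e.refl (dir φ) = dir φ := by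
    have := e.refl_direction
    rw [he, map_smul] at this
    exact smul_right_injective Plane hk this
  have h2 : e.refl (dir (φ + Real.pi / 2)) = -dir (φ + Real.pi / 2) := by
    apply Submodule.reflection_mem_subspace_orthogonalComplement_eq_neg
    rw [Submodule.mem_orthogonal_singleton_iff_inner_right, he, inner_smul_left]
    have : inner ℝ (dir φ) (dir (φ + Real.pi / 2)) = 0 := by
      simp [dir, PiLp.inner_apply, Fin.sum_univ_two, Real.cos_add_pi_div_two,
        Real.sin_add_pi_div_two]
      ring
    rw [this, mul_zero]
  rw [sub_eq_add_neg, dir_add φ θ, dir_add φ (-θ), map_add, map_smul, map_smul, h1, h2,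
    Real.cos_neg, Real.sin_neg, smul_neg, neg_smul]

/-- The velocity `u` at `x` points into the interior of `P`. -/
def PointsIn (P : Table) (x u : Plane) : Prop :=
  ∃ ε > 0, ∀ s ∈ Ioo (0 : ℝ) ε, x + s • u ∈ interior P.carrier

lemma FreeFlight.pointsIn {x u : Plane} {t : ℝ} (h : P.FreeFlight x u t) : P.PointsIn x u :=
  ⟨t, h.1, h.2⟩

/-- A velocity along a side does not point into the interior. -/
lemma not_pointsIn_along {e : P.Side} {x : Plane} (hx : x ∈ e.interior) (m : ℝ) :
    ¬ P.PointsIn x (m • (e.tgt - e.src)) := by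
  rintro ⟨ε, hε, h⟩
  obtain ⟨τ, hτ, rfl⟩ := mem_interior_iff'.1 hx
  have hc : Tendsto (fun s : ℝ => τ + s * m) (𝓝[>] 0) (𝓝 τ) := by
    have : ContinuousAt (fun s : ℝ => τ + s * m) 0 := by fun_prop
    simpa using this.tendsto.mono_left (nhdsWithin_le_nhds (s := Ioi 0))
  obtain ⟨s, h1, h2⟩ := ((hc.eventually (Ioo_mem_nhds hτ.1 hτ.2)).and
    (Ioo_mem_nhdsGT hε)).exists
  have hmem : e.src + (τ + s * m) • (e.tgt - e.src) ∈ e.interior := mem_interior_iff'.2 ⟨_, h1, rfl⟩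
  have hin := h s h2
  rw [smul_smul, add_assoc, ← add_smul] at hin
  exact side_notMem_interior hmem hin

/-- After a bounce the velocity points into the interior. -/
lemma pointsIn_refl {e : P.Side} {x u : Plane} {t : ℝ} (hu : ‖u‖ = 1) (h : P.FreeFlight x u t)
    (hx : x + t • u ∈ e.interior) : P.PointsIn (x + t • u) (e.refl u) := by
  obtain ⟨α, _, _, hs⟩ := P.exists_angle
  obtain ⟨φ, k, he, hsec⟩ := hs e _ hx
  have hback : P.PointsIn (x + t • u) (-u) := h.reverse.pointsIn
  -- The reversed incoming velocity points into the table. Its angle `θ` from the side is therefore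
  -- in `(0, π)`, and the outgoing velocity is at the angle `π - θ`, in the same half-disc.
  obtain ⟨θ, hθ, hdir⟩ := exists_dir (u := -u) (by rw [norm_neg, hu]) φ
  have hk : k ≠ 0 := by
    rintro rfl
    rw [zero_smul, sub_eq_zero] at he
    exact fst_ne_snd e he.symm
  have hline : ∀ c : ℝ, -u ≠ c • dir φ := by
    intro c hc
    have : dir φ = k⁻¹ • (e.tgt - e.src) := by rw [he, smul_smul, inv_mul_cancel₀ hk, one_smul]
    rw [this, smul_smul] at hc
    rw [hc] at hback
    exact not_pointsIn_along hx _ hback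
  have h0 : θ ≠ 0 := by
    rintro rfl
    exact hline 1 (by rw [hdir, add_zero, one_smul])
  have hpi : θ ≠ Real.pi := by
    rintro rfl
    exact hline (-1) (by rw [hdir, dir_add_pi, neg_one_smul])
  have hlt : θ < Real.pi := by
    by_contra! hge
    refine hsec.notMem_inwardAngles (θ := θ) ⟨lt_of_le_of_ne hge hpi.symm, hθ.2⟩ ?_
    obtain ⟨ε, hε, hin⟩ := hback
    rw [hdir] at hin
    exact ⟨ε, hε, hin⟩
  have hpos : 0 < θ := lt_of_le_of_ne hθ.1 h0.symm
  have hrefl : e.refl u = dir (φ + (Real.pi - θ)) := by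
    have := refl_dir he θ
    rw [← hdir, map_neg] at this
    rw [show φ + (Real.pi - θ) = φ - θ + Real.pi by ring, dir_add_pi, ← this, neg_neg]
  rw [hrefl]
  exact hsec.mem_inwardAngles ⟨by linarith, by linarith⟩

/-- An orbit that points into the interior moves freely until it hits the boundary. -/
lemma PointsIn.exists_freeFlight {x u : Plane} (h : P.PointsIn x u) {t : ℝ} (ht : 0 < t) :
    P.FreeFlight x u t ∨ ∃ τ ∈ Ioo 0 t, P.FreeFlight x u τ ∧ x + τ • u ∈ P.boundary := by
  obtain ⟨ε, hε, hin⟩ := h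
  by_cases hall : ∀ s ∈ Ioo (0 : ℝ) t, x + s • u ∈ interior P.carrier
  · exact Or.inl ⟨ht, hall⟩
  push Not at hall
  obtain ⟨s₀, hs₀, hout⟩ := hall
  right
  have hcont : Continuous fun s : ℝ => x + s • u := by fun_prop
  -- The times outside the interior, from `ε` on: `x` itself may be a boundary point, and without
  -- the cut-off there need be no first positive one.
  set S := Icc ε s₀ ∩ (fun s : ℝ => x + s • u) ⁻¹' (interior P.carrier)ᶜ
  have hScomp : IsCompact S := isCompact_Icc.inter_right
    (isOpen_interior.isClosed_compl.preimage hcont)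
  have hεs : ε ≤ s₀ := by
    by_contra! hlt
    exact hout (hin s₀ ⟨hs₀.1, hlt⟩)
  obtain ⟨τ, hτ, hmin⟩ := hScomp.exists_isLeast ⟨s₀, ⟨hεs, le_rfl⟩, hout⟩
  have hτ0 : 0 < τ := hε.trans_le hτ.1.1
  have hfree : P.FreeFlight x u τ := by
    refine ⟨hτ0, fun s hs => ?_⟩
    by_contra hns
    have hsε : ε ≤ s := by
      by_contra! hlt
      exact hns (hin s ⟨hs.1, hlt⟩)
    exact absurd (hmin ⟨⟨hsε, hs.2.le.trans hτ.1.2⟩, hns⟩) (not_le.2 hs.2)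
  refine ⟨τ, ⟨hτ0, hτ.1.2.trans_lt hs₀.2⟩, hfree, carrier_diff_interior_subset ⟨?_, hτ.2⟩⟩
  have h1 : τ ∈ closure (Ioo 0 τ) := by
    rw [closure_Ioo hτ0.ne]; exact ⟨hτ0.le, le_rfl⟩
  have h2 := map_mem_closure (f := fun s : ℝ => x + s • u) hcont h1
    (fun s hs => interior_subset (hfree.2 s hs))
  rwa [isClosed_carrier.closure_eq] at h2

lemma FreeFlight.mem_carrier {x u : Plane} {t : ℝ} (h : P.FreeFlight x u t) :
    x + t • u ∈ P.carrier := by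
  have hcont : Continuous fun s : ℝ => x + s • u := by fun_prop
  have h1 : t ∈ closure (Ioo 0 t) := by
    rw [closure_Ioo h.1.ne]; exact ⟨h.1.le, le_rfl⟩
  have h2 := map_mem_closure (f := fun s : ℝ => x + s • u) hcont h1
    (fun s hs => interior_subset (h.2 s hs))
  rwa [isClosed_carrier.closure_eq] at h2

lemma Orbit.mem_carrier {w : List P.Side} {x u y u' : Plane} {t : ℝ} (h : P.Orbit w x u t y u') :
    y ∈ P.carrier := by
  induction h with
  | flight x u t hfree => exact hfree.mem_carrier
  | bounce _ _ _ _ _ _ _ _ _ _ _ ih => exact ih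

/-- As no corner is met, each flight that ends before time `t` ends in a bounce, after which the
orbit again points into the table. So either time `t` is reached or there are arbitrarily many
bounces. -/
lemma PointsIn.exists_orbit_or {x u : Plane} (h : P.PointsIn x u) (hu : ‖u‖ = 1) {t : ℝ}
    (ht : 0 < t) (hns : ∀ v ∈ P.corners, ∀ w t' u', t' ≤ t → ¬ P.Orbit w x u t' v u') (N : ℕ) :
    (∃ w y u', P.Orbit w x u t y u') ∨
      ∃ w t' y u', w.length = N ∧ t' ≤ t ∧ P.Orbit w x u t' y u' := by
  induction N generalizing x u t with
  | zero =>
    right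
    obtain ⟨ε, hε, hin⟩ := h
    exact ⟨[], min ε t, _, _, rfl, min_le_right _ _, .flight x u _
      ⟨lt_min hε ht, fun s hs => hin s ⟨hs.1, hs.2.trans_le (min_le_left _ _)⟩⟩⟩
  | succ N ih =>
    rcases h.exists_freeFlight ht with hfree | ⟨τ, hτ, hfree, hb⟩
    · exact Or.inl ⟨_, _, _, .flight x u t hfree⟩
    rcases mem_boundary_cases hb with hc | ⟨e, he⟩
    · exact absurd (.flight x u τ hfree) (hns _ hc [] τ u hτ.2.le)
    · have hns' : ∀ v ∈ P.corners, ∀ w t' u', t' ≤ t - τ →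
          ¬ P.Orbit w (x + τ • u) (e.refl u) t' v u' := fun v hv w t' u' ht' h' =>
        hns v hv (e :: w) (τ + t') u' (by linarith) (.bounce _ _ _ _ _ _ _ _ hfree he h')
      rcases ih (pointsIn_refl hu hfree he) (by rw [LinearIsometryEquiv.norm_map, hu])
        (by linarith [hτ.2] : 0 < t - τ) hns' with ⟨w, y, u', h'⟩ | ⟨w, t', y, u', hw, ht', h'⟩
      · left
        refine ⟨e :: w, y, u', ?_⟩
        have := Orbit.bounce _ _ _ _ _ _ _ _ hfree he h'
        rwa [add_sub_cancel] at this
      · right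
        exact ⟨e :: w, τ + t', y, u', by simp [hw], by linarith,
          .bounce _ _ _ _ _ _ _ _ hfree he h'⟩

/-- A nonsingular orbit can be continued for all times. -/
theorem PointsIn.exists_orbit {x u : Plane} (h : P.PointsIn x u) (hu : ‖u‖ = 1) {t : ℝ}
    (ht : 0 < t) (hns : ∀ v ∈ P.corners, u ∉ P.singularDirections x t v) :
    ∃ w y u', P.Orbit w x u t y u' := by
  obtain ⟨N, hN⟩ := P.exists_bounce_bound t
  -- One bounce more than the bound admits rules out the second alternative.
  rcases h.exists_orbit_or hu ht (fun v hv w t' u' ht' ho =>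
    hns v hv (mem_singularDirections.2 ⟨hu, w, t', u', ht', ho⟩)) (N + 1) with
    h' | ⟨w, t', y, u', hw, ht', h'⟩
  · exact h'
  · have := hN w x u t' y u' hu h' ht'
    omega

end Table

end Billiard

/-! ### Measurability and areas -/

namespace Billiard

open Filter Topology

namespace Table

variable {P : Table}

lemma _root_.IsSigmaCompact.measurableSet {X : Type*} [TopologicalSpace X] [T2Space X]
    [MeasurableSpace X] [BorelSpace X] {s : Set X} (h : IsSigmaCompact s) : MeasurableSet s := by
  obtain ⟨K, hK, rfl⟩ := h
  exact MeasurableSet.iUnion fun i => (hK i).measurableSet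

-- Leaving the interior at some time in `[1/(n+1), t - 1/(n+1)]` is the projection of a closed
-- condition in a finite-dimensional space, hence a σ-compact one. The countable union over `n`
-- covers all failures.
variable (P) in
lemma measurableSet_freeFlight :
    MeasurableSet {q : Plane × Plane × ℝ | P.FreeFlight q.1 q.2.1 q.2.2} := by
  set F : ℕ → Set ((Plane × Plane × ℝ) × ℝ) := fun n =>
    {r | 1 / (n + 1 : ℝ) ≤ r.2} ∩ ({r | r.2 + 1 / (n + 1 : ℝ) ≤ r.1.2.2} ∩
      (fun r => r.1.1 + r.2 • r.1.2.1) ⁻¹' (interior P.carrier)ᶜ)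
  have hF : ∀ n, IsClosed (F n) := fun n =>
    (isClosed_le (by fun_prop) (by fun_prop)).inter
      ((isClosed_le (by fun_prop) (by fun_prop)).inter
        (isOpen_interior.isClosed_compl.preimage (by fun_prop)))
  have hm : ∀ n, MeasurableSet (Prod.fst '' F n) := fun n =>
    ((isSigmaCompact_univ.of_isClosed_subset (hF n) (subset_univ _)).image
      continuous_fst).measurableSet
  have heq : {q : Plane × Plane × ℝ | P.FreeFlight q.1 q.2.1 q.2.2} =
      {q | 0 < q.2.2} \ ⋃ n, Prod.fst '' F n := by
    ext ⟨x, u, t⟩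
    constructor
    · rintro ⟨h1, h2⟩
      refine ⟨h1, fun hmem => ?_⟩
      obtain ⟨n, ⟨⟨x', u', t'⟩, s⟩, ⟨a1, a2, a3⟩, e⟩ := mem_iUnion.1 hmem
      obtain ⟨rfl, rfl, rfl⟩ : x' = x ∧ u' = u ∧ t' = t := by simpa using e
      have : 0 < 1 / (n + 1 : ℝ) := by positivity
      simp only [mem_ofPred_eq] at a1 a2 h2
      exact a3 (h2 s ⟨by linarith, by linarith⟩)
    · rintro ⟨h1, h2⟩
      refine ⟨h1, fun s hs => ?_⟩
      by_contra hns
      obtain ⟨n, hn⟩ := exists_nat_one_div_lt (show 0 < min s (t - s) from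
        lt_min hs.1 (sub_pos.2 hs.2))
      refine h2 (mem_iUnion.2 ⟨n, ⟨⟨x, u, t⟩, s⟩, ⟨(hn.trans_le (min_le_left _ _)).le, ?_, hns⟩,
        rfl⟩)
      have := hn.trans_le (min_le_right _ _)
      simp only [mem_ofPred_eq]
      linarith
  rw [heq]
  exact (measurableSet_lt measurable_const (by fun_prop)).diff (MeasurableSet.iUnion hm)

lemma measurableSet_side (e : P.Side) : MeasurableSet e.interior := by
  have : e.interior = e.closed \ {e.src, e.tgt} := by
    ext x
    constructor
    · intro h
      refine ⟨interior_subset_closed e h, ?_⟩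
      rintro (rfl | rfl)
      · exact corner_notMem_interior (fst_mem_corners e) e h
      · exact corner_notMem_interior (snd_mem_corners e) e h
    · rintro ⟨h1, h2⟩
      rcases mem_closed_iff.1 h1 with rfl | rfl | h
      · exact absurd (Or.inl rfl) h2
      · exact absurd (Or.inr rfl) h2
      · exact h
  rw [this]
  have hc : IsCompact e.closed := by
    rw [Side.closed, segment_eq_image_lineMap]
    exact isCompact_Icc.image AffineMap.lineMap_continuous
  exact hc.measurableSet.diff (by measurability)

/-- The oriented area spanned by two vectors. -/
def cross (a b : Plane) : ℝ := a 0 * b 1 - a 1 * b 0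

/-- The time at which the line through `x` with velocity `u` meets the line of the side `e`. -/
noncomputable def Side.hitTime (e : P.Side) (x u : Plane) : ℝ :=
  -cross (e.tgt - e.src) (x - e.src) / cross (e.tgt - e.src) u

/-- The time of the first bounce is an explicit measurable function of the initial data. So
`orbitSet` can be built from preimages, without projecting along that time. -/
lemma hitTime_eq {e : P.Side} {x u : Plane} {t : ℝ} (h : P.FreeFlight x u t)
    (hx : x + t • u ∈ e.interior) : t = e.hitTime x u := by
  obtain ⟨s, hs, he⟩ := mem_interior_iff'.1 hx
  set d := e.tgt - e.src with hd
  have hd0 : d ≠ 0 := sub_ne_zero.2 (fst_ne_snd e).symm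
  have h1 : cross d (x - e.src) + t * cross d u = 0 := by
    have h2 : x - e.src = s • d - t • u := by rw [eq_sub_iff_add_eq, sub_add_eq_add_sub, ← he]; abel
    rw [h2]
    simp [cross]; ring
  -- Here the orbit would arrive along the side itself, which a flight through the interior cannot
  -- do.
  by_cases hc : cross d u = 0
  · exfalso
    have hpar : ∃ m : ℝ, -u = m • d := by
      have hn : d 0 ^ 2 + d 1 ^ 2 ≠ 0 := by
        intro h0
        apply hd0
        ext i
        fin_cases i
        · have : d 0 = 0 := by nlinarith [sq_nonneg (d 0), sq_nonneg (d 1)]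
          simpa using this
        · have : d 1 = 0 := by nlinarith [sq_nonneg (d 0), sq_nonneg (d 1)]
          simpa using this
      refine ⟨-(d 0 * u 0 + d 1 * u 1) / (d 0 ^ 2 + d 1 ^ 2), ?_⟩
      unfold cross at hc
      ext i
      fin_cases i
      · simp; field_simp; linear_combination (d 1) * hc
      · simp; field_simp; linear_combination (-d 0) * hc
    obtain ⟨m, hm⟩ := hpar
    have := h.reverse.pointsIn
    rw [hm] at this
    exact not_pointsIn_along hx m this
  · rw [Side.hitTime, eq_div_iff hc]; linarith

/-- The initial conditions and times of the orbits with bounces `w`. -/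
def orbitSet (P : Table) (w : List P.Side) : Set (Plane × Plane × ℝ) :=
  {q | ∃ y u', P.Orbit w q.1 q.2.1 q.2.2 y u'}

lemma measurableSet_orbitSet (w : List P.Side) : MeasurableSet (orbitSet P w) := by
  induction w with
  | nil =>
    convert P.measurableSet_freeFlight using 1
    ext ⟨x, u, t⟩
    exact ⟨fun ⟨y, u', h⟩ => (orbit_nil.1 h).1, fun h => ⟨_, _, .flight _ _ _ h⟩⟩
  | cons e w ih =>
    have hT : Measurable fun q : Plane × Plane × ℝ => e.hitTime q.1 q.2.1 := by
      unfold Side.hitTime cross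
      fun_prop
    have heq : orbitSet P (e :: w) =
        (fun q : Plane × Plane × ℝ => (q.1, q.2.1, e.hitTime q.1 q.2.1)) ⁻¹'
          {q | P.FreeFlight q.1 q.2.1 q.2.2} ∩
        ((fun q : Plane × Plane × ℝ => q.1 + e.hitTime q.1 q.2.1 • q.2.1) ⁻¹' e.interior ∩
        (fun q : Plane × Plane × ℝ => (q.1 + e.hitTime q.1 q.2.1 • q.2.1, e.refl q.2.1,
          q.2.2 - e.hitTime q.1 q.2.1)) ⁻¹' orbitSet P w) := by
      ext ⟨x, u, t⟩
      constructor
      · rintro ⟨y, u', h⟩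
        obtain ⟨t₁, t₂, rfl, h1, h2, h3⟩ := orbit_cons.1 h
        have e1 := hitTime_eq h1 h2
        refine ⟨?_, ?_, ⟨y, u', ?_⟩⟩
        · change P.FreeFlight x u (e.hitTime x u); rwa [← e1]
        · change x + e.hitTime x u • u ∈ e.interior; rwa [← e1]
        · change P.Orbit w (x + e.hitTime x u • u) (e.refl u) (t₁ + t₂ - e.hitTime x u) y u'
          rwa [← e1, add_sub_cancel_left]
      · rintro ⟨h1, h2, ⟨y, u', h3⟩⟩
        exact ⟨y, u', orbit_cons.2 ⟨e.hitTime x u, t - e.hitTime x u, (add_sub_cancel _ _).symm,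
          h1, h2, h3⟩⟩
    rw [heq]
    have hr : Measurable (e.refl : Plane → Plane) := e.refl.continuous.measurable
    exact (P.measurableSet_freeFlight.preimage (by fun_prop)).inter
      (((measurableSet_side e).preimage (by fun_prop)).inter (ih.preimage (by fun_prop)))

/-- The direction from `v` to `p`. -/
noncomputable def heading (v p : Plane) : Plane := dir (toC (p - v)).arg

lemma norm_smul_heading (v p : Plane) : ‖p - v‖ • heading v p = p - v := by
  apply toC.injective
  rw [heading, map_smul, toC_dir, Complex.real_smul, ← toC.norm_map (p - v),
    Complex.norm_mul_exp_arg_mul_I]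

lemma heading_of_eq {v p u : Plane} {t : ℝ} (ht : 0 < t) (hu : ‖u‖ = 1) (hp : p = v + t • u) :
    ‖p - v‖ = t ∧ heading v p = u := by
  have h1 : p - v = t • u := by rw [hp, add_sub_cancel_left]
  have h2 : ‖p - v‖ = t := by
    rw [h1, norm_smul, hu, mul_one, Real.norm_eq_abs, abs_of_pos ht]
  have h3 := norm_smul_heading v p
  rw [h2, h1] at h3
  exact ⟨h2, smul_right_injective Plane ht.ne' h3⟩

lemma measurable_heading (v : Plane) : Measurable (heading v) := by
  have h1 : Measurable dir := by
    have : dir = fun θ : ℝ => toC.symm (Complex.exp (θ * Complex.I)) :=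
      funext fun θ => (toC_symm_exp θ).symm
    rw [this]
    exact (toC.symm.continuous.comp (by fun_prop)).measurable
  have h2 : Measurable (toC : Plane → ℂ) := toC.continuous.measurable
  exact h1.comp (Complex.measurable_arg.comp (h2.comp (by fun_prop)))

/-- The inverse of `unfold w`. -/
noncomputable def refold (w : List P.Side) (p : Plane) : Plane :=
  (unfoldLin w).symm (p - unfoldShift w)

lemma refold_unfold (w : List P.Side) (y : Plane) : refold w (unfold w y) = y := by
  simp [refold, unfold]

lemma measurePreserving_refold (w : List P.Side) :
    MeasurePreserving (refold w) volume volume :=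
  (unfoldLin w).symm.measurePreserving.comp (measurePreserving_sub_right volume (unfoldShift w))

/-- The unfolded end points of the orbits from `v` of length at most `l` with bounces `w`. -/
def reach (P : Table) (v : Plane) (l : ℝ) (w : List P.Side) : Set Plane :=
  {p | 0 < ‖p - v‖ ∧ ‖p - v‖ ≤ l ∧ (v, heading v p, ‖p - v‖) ∈ orbitSet P w ∧
    refold w p ∈ interior P.carrier}

lemma measurableSet_reach (v : Plane) (l : ℝ) (w : List P.Side) :
    MeasurableSet (reach P v l w) := by
  have h1 : Measurable fun p : Plane => (v, heading v p, ‖p - v‖) :=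
    measurable_const.prodMk ((measurable_heading v).prodMk (by fun_prop))
  have h2 : Measurable fun p : Plane => ‖p - v‖ := by fun_prop
  exact (h2 measurableSet_Ioi).inter ((h2 measurableSet_Iic).inter
    (((measurableSet_orbitSet w).preimage h1).inter
    (isOpen_interior.measurableSet.preimage (measurePreserving_refold w).measurable)))

lemma Orbit.refold_eq {w : List P.Side} {v p y u' : Plane}
    (h : P.Orbit w v (heading v p) ‖p - v‖ y u') : refold w p = y := by
  have := h.unfold_eq.1
  rw [norm_smul_heading, add_sub_cancel] at this
  rw [← this, refold_unfold]

/-- The point `p` prescribes both direction and time of the orbit from `v`. Since the orbit ends in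
the interior, these determine the itinerary. -/
lemma disjoint_reach (v : Plane) (l : ℝ) {w w' : List P.Side} (hne : w ≠ w') :
    Disjoint (reach P v l w) (reach P v l w') := by
  rw [disjoint_left]
  rintro p ⟨_, _, ⟨y, u', h⟩, hi⟩ ⟨_, _, ⟨y', u'', h'⟩, _⟩
  rw [h.refold_eq] at hi
  exact hne (h.unique_of_interior h' hi)

/-- The points in the interior from which an orbit with bounces `w` of length at most `l` arrives
at `v`. -/
def source (P : Table) (v : Plane) (l : ℝ) (w : List P.Side) : Set Plane :=
  {z | z ∈ interior P.carrier ∧ (directions P w z l v).Nonempty}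

/-- The reversed orbit leaves `v`, has the reversed itinerary, and ends at `z`. Unfolding places `z`
at the point reached by the straight line. -/
lemma source_eq (v : Plane) (l : ℝ) (w : List P.Side) :
    source P v l w = unfold w.reverse ⁻¹' reach P v l w.reverse := by
  ext z
  constructor
  · rintro ⟨hz, u, hu, t, u', ht, h⟩
    have hr := h.reverse
    obtain ⟨h1, h2⟩ := heading_of_eq hr.pos (by rw [norm_neg, h.norm_eq, hu]) hr.unfold_eq.1
    refine ⟨by rw [h1]; exact hr.pos, by rw [h1]; exact ht, ⟨z, -u, ?_⟩, by rwa [refold_unfold]⟩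
    change P.Orbit w.reverse v (heading v _) ‖unfold w.reverse z - v‖ z (-u)
    rw [h1, h2]
    exact hr
  · rintro ⟨h1, h2, ⟨y, u', h⟩, h4⟩
    rw [refold_unfold] at h4
    have hy := h.refold_eq
    rw [refold_unfold] at hy
    subst hy
    have hr := h.reverse
    rw [List.reverse_reverse] at hr
    refine ⟨h4, -u', ?_, _, _, h2, hr⟩
    rw [norm_neg, h.norm_eq]
    exact norm_dir _

lemma measurableSet_source (v : Plane) (l : ℝ) (w : List P.Side) :
    MeasurableSet (source P v l w) := by
  rw [source_eq]
  exact (measurableSet_reach _ _ _).preimage (measurePreserving_unfold _).measurable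

lemma volume_source (v : Plane) (l : ℝ) (w : List P.Side) :
    volume (source P v l w) = volume (reach P v l w.reverse) := by
  rw [source_eq]
  exact (measurePreserving_unfold _).measure_preimage (measurableSet_reach _ _ _).nullMeasurableSet

lemma volume_line (a d : Plane) : volume (range fun t : ℝ => a + t • d) = 0 := by
  have hne : AffineSubspace.mk' a (Submodule.span ℝ {d}) ≠ ⊤ := by
    intro h
    have h1 := congrArg AffineSubspace.direction h
    rw [AffineSubspace.direction_mk', AffineSubspace.direction_top] at h1
    have h2 := finrank_span_le_card (R := ℝ) ({d} : Set Plane)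
    rw [h1, finrank_top] at h2
    simp at h2
  refine measure_mono_null ?_ (Measure.addHaar_affineSubspace volume _ hne)
  rintro _ ⟨t, rfl⟩
  rw [SetLike.mem_coe, AffineSubspace.mem_mk', vsub_eq_sub, add_sub_cancel_left]
  exact Submodule.smul_mem _ _ (Submodule.mem_span_singleton_self d)

lemma volume_boundary : volume P.boundary = 0 := by
  rw [boundary_eq]
  refine measure_iUnion_null fun e => measure_mono_null ?_ (volume_line e.src (e.tgt - e.src))
  rw [Side.closed, segment_eq_image']
  rintro _ ⟨s, _, rfl⟩
  exact ⟨s, rfl⟩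

/-- The sector of radius `l` at `v`. -/
def sectorSet (P : Table) (v : Plane) (l : ℝ) : Set Plane :=
  {p | 0 < ‖p - v‖ ∧ ‖p - v‖ ≤ l ∧ (toC (p - v)).arg ∈ inwardAngles P v}

lemma Orbit.pointsIn {w : List P.Side} {x u y u' : Plane} {t : ℝ} (h : P.Orbit w x u t y u') :
    P.PointsIn x u := by
  cases h with
  | flight _ _ _ hfree => exact hfree.pointsIn
  | bounce _ _ _ _ _ _ _ _ hfree _ _ => exact hfree.pointsIn

lemma reach_subset (v : Plane) (l : ℝ) (w : List P.Side) : reach P v l w ⊆ sectorSet P v l := by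
  rintro p ⟨h1, h2, ⟨y, u', h⟩, _⟩
  exact ⟨h1, h2, h.pointsIn⟩

/-- For a point `p` of the sector the orbit from `v` in the direction of `p` can be followed for
time `‖p - v‖`, unless it is singular. The exceptional set `X` consists of finitely many lines in
singular directions and of the points that refold to the boundary, so it is null. -/
lemma volume_iUnion_reach {l : ℝ} {N : ℕ} (hN : ∀ (w : List P.Side) (x u : Plane) (t : ℝ)
    (y u' : Plane), ‖u‖ = 1 → P.Orbit w x u t y u' → t ≤ l → w.length ≤ N) (v : Plane) :
    volume (⋃ w ∈ words P N, reach P v l w) = volume (sectorSet P v l) := by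
  apply le_antisymm (measure_mono (iUnion₂_subset fun w _ => reach_subset v l w))
  set X : Set Plane := (⋃ w ∈ words P N, refold w ⁻¹' P.boundary) ∪
    ⋃ c ∈ P.corners, ⋃ u ∈ P.singularDirections v l c, range fun t : ℝ => v + t • u
  have hX : volume X = 0 := by
    refine measure_union_null ?_ ?_
    · refine (measure_biUnion_null_iff (words P N).countable_toSet).2 fun w _ => ?_
      exact (measurePreserving_refold w).quasiMeasurePreserving.preimage_null volume_boundary
    · refine (measure_biUnion_null_iff P.corners.countable_toSet).2 fun c _ => ?_
      exact (measure_biUnion_null_iff (P.finite_singularDirections v l c).countable).2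
        fun u _ => volume_line v u
  have hsub : sectorSet P v l ⊆ (⋃ w ∈ words P N, reach P v l w) ∪ X := by
    rintro p ⟨h1, h2, h3⟩
    by_contra hp
    simp only [X, mem_union, mem_iUnion, not_or, not_exists] at hp
    obtain ⟨hp1, hp2, hp3⟩ := hp
    have hpv : p = v + ‖p - v‖ • heading v p := by rw [norm_smul_heading, add_sub_cancel]
    have hin : P.PointsIn v (heading v p) := h3
    obtain ⟨w, y, u', h⟩ := hin.exists_orbit (norm_dir _) h1 fun c hc hs => by
      refine hp3 c hc (heading v p) ?_ ⟨_, hpv.symm⟩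
      rw [mem_singularDirections] at hs ⊢
      obtain ⟨hu, w, t, u', ht, ho⟩ := hs
      exact ⟨hu, w, t, u', ht.trans h2, ho⟩
    have hw : w ∈ words P N := mem_words.2 (hN w _ _ _ _ _ (norm_dir _) h h2)
    have hy := h.refold_eq
    by_cases hi : y ∈ interior P.carrier
    · exact hp1 w hw ⟨h1, h2, ⟨y, u', h⟩, by rwa [hy]⟩
    · exact hp2 w hw (by
        rw [mem_preimage, hy]
        exact carrier_diff_interior_subset ⟨h.mem_carrier, hi⟩)
  refine (measure_mono hsub).trans ((measure_union_le _ _).trans ?_)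
  rw [hX, add_zero]

lemma lintegral_radius {l : ℝ} (hl : 0 ≤ l) :
    ∫⁻ r in Ioc 0 l, ENNReal.ofReal r = ENNReal.ofReal (l ^ 2 / 2) := by
  rw [← ofReal_integral_eq_lintegral_ofReal, ← intervalIntegral.integral_of_le hl, integral_id]
  · congr 1; ring
  · exact (continuous_id.integrableOn_Icc).mono_set Ioc_subset_Icc_self
  · filter_upwards [ae_restrict_mem measurableSet_Ioc] with r hr using hr.1.le

lemma volume_sectorSet {v : Plane} (hv : v ∈ P.corners) {l : ℝ} (hl : 0 ≤ l) :
    volume (sectorSet P v l) = ENNReal.ofReal (P.angle v * l ^ 2 / 2) := by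
  set E := inwardAngles P v
  have hE : MeasurableSet E := measurableSet_inwardAngles hv
  set W : Set ℂ := {z | 0 < ‖z‖ ∧ ‖z‖ ≤ l ∧ z.arg ∈ E}
  have hW : MeasurableSet W := (measurable_norm measurableSet_Ioi).inter
    ((measurable_norm measurableSet_Iic).inter (hE.preimage Complex.measurable_arg))
  have hmp : MeasurePreserving (fun p : Plane => toC (p - v)) volume volume :=
    toC.measurePreserving.comp (measurePreserving_sub_right volume v)
  have h1 : sectorSet P v l = (fun p : Plane => toC (p - v)) ⁻¹' W := by
    ext p
    simp only [sectorSet, W, mem_preimage, mem_ofPred_eq, LinearIsometryEquiv.norm_map, E]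
  rw [h1, hmp.measure_preimage hW.nullMeasurableSet, ← lintegral_indicator_one hW,
    ← Complex.lintegral_comp_polarCoord_symm]
  have h2 : ∀ p ∈ polarCoord.target,
      ENNReal.ofReal p.1 • W.indicator (1 : ℂ → ENNReal) (Complex.polarCoord.symm p) =
        (Ioc 0 l).indicator (fun r => ENNReal.ofReal r) p.1 * E.indicator 1 p.2 := by
    rintro ⟨r, θ⟩ ⟨hr, hθ⟩
    simp only [mem_Ioi] at hr
    have hr' : 0 < r := hr
    have harg : (Complex.polarCoord.symm (r, θ)).arg = θ := by
      rw [Complex.polarCoord_symm_apply]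
      exact_mod_cast Complex.arg_mul_cos_add_sin_mul_I hr' ⟨hθ.1, hθ.2.le⟩
    have hnorm : ‖Complex.polarCoord.symm (r, θ)‖ = r := by
      rw [Complex.norm_polarCoord_symm]; exact abs_of_pos hr'
    have hiff : Complex.polarCoord.symm (r, θ) ∈ W ↔ r ≤ l ∧ θ ∈ E := by
      simp only [W, mem_ofPred_eq, harg, hnorm, hr', true_and]
    by_cases h3 : r ≤ l <;> by_cases h4 : θ ∈ E
    · rw [indicator_of_mem (hiff.2 ⟨h3, h4⟩), indicator_of_mem (show r ∈ Ioc 0 l from ⟨hr', h3⟩),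
        indicator_of_mem h4]
      simp
    · rw [indicator_of_notMem (fun h => h4 (hiff.1 h).2), indicator_of_notMem h4]; simp
    · rw [indicator_of_notMem (fun h => h3 (hiff.1 h).1),
        indicator_of_notMem (show r ∉ Ioc 0 l from fun h => h3 h.2)]; simp
    · rw [indicator_of_notMem (fun h => h4 (hiff.1 h).2), indicator_of_notMem h4]; simp
  rw [setLIntegral_congr_fun polarCoord.open_target.measurableSet h2, polarCoord_target,
    Measure.volume_eq_prod, ← Measure.prod_restrict,
    lintegral_prod_mul
      (Measurable.aemeasurable (ENNReal.measurable_ofReal.indicator measurableSet_Ioc))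
      (measurable_one.indicator hE).aemeasurable,
    lintegral_indicator_one hE, lintegral_indicator measurableSet_Ioc,
    Measure.restrict_restrict measurableSet_Ioc,
    inter_eq_left.2 (show Ioc (0 : ℝ) l ⊆ Ioi 0 from fun r hr => hr.1), lintegral_radius hl,
    Measure.restrict_apply hE, angle_def]
  -- Polar coordinates omit the angle `π`, which is negligible.
  have h5 : volume (E ∩ Ioo (-Real.pi) Real.pi) = volume (E ∩ Ioc (-Real.pi) Real.pi) :=
    measure_congr (ae_eq_set_inter (ae_eq_refl E) Ioo_ae_eq_Ioc)
  rw [h5, mul_comm, mul_div_assoc, ENNReal.ofReal_mul measureReal_nonneg,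
    ofReal_measureReal ((measure_mono inter_subset_right).trans_lt measure_Ioc_lt_top).ne]

/-- Reversal permutes the itineraries with at most `N` bounces, so the areas of the sets `reach` are
summed over all of them. -/
lemma sum_volume_source {v : Plane} (hv : v ∈ P.corners) {l : ℝ} (hl : 0 ≤ l) {N : ℕ}
    (hN : ∀ (w : List P.Side) (x u : Plane) (t : ℝ)
    (y u' : Plane), ‖u‖ = 1 → P.Orbit w x u t y u' → t ≤ l → w.length ≤ N) :
    ∑ w ∈ words P N, volume (source P v l w) = ENNReal.ofReal (P.angle v * l ^ 2 / 2) := by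
  simp_rw [volume_source]
  rw [Finset.sum_bij (t := words P N) (g := fun w => volume (reach P v l w))
    (fun w _ => w.reverse)
    (fun w hw => by rw [mem_words] at hw ⊢; rwa [List.length_reverse])
    (fun _ _ _ _ e => List.reverse_injective e)
    (fun w hw => ⟨w.reverse, by rw [mem_words] at hw ⊢; rwa [List.length_reverse],
      List.reverse_reverse w⟩) (fun _ _ => rfl),
    ← measure_biUnion_finset (fun w _ w' _ h => disjoint_reach v l h)
      (fun w _ => measurableSet_reach v l w), volume_iUnion_reach hN, volume_sectorSet hv hl]

variable (P) in
lemma carrier_ae_eq : P.carrier =ᵐ[volume] interior P.carrier := by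
  refine (ae_eq_of_subset_of_measure_ge interior_subset ?_ isOpen_interior.nullMeasurableSet ?_).symm
  · have h : P.carrier ⊆ interior P.carrier ∪ P.boundary := fun x hx => by
      by_cases hi : x ∈ interior P.carrier
      · exact Or.inl hi
      · exact Or.inr (carrier_diff_interior_subset ⟨hx, hi⟩)
    refine (measure_mono h).trans ((measure_union_le _ _).trans ?_)
    rw [volume_boundary, add_zero]
  · exact (isBounded_carrier.measure_lt_top).ne

/-- The mean number of singular orbits that end at a given corner. -/
theorem integral_gcAt {v : Plane} (hv : v ∈ P.corners) {l : ℝ} (hl : 0 ≤ l) :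
    IntegrableOn (fun z => (P.gcAt z l v : ℝ)) P.carrier volume ∧
      2 * ∫ z in P.carrier, (P.gcAt z l v : ℝ) = P.angle v * l ^ 2 := by
  classical
  obtain ⟨N, hN⟩ := P.exists_bounce_bound l
  have hsum := sum_volume_source hv hl hN
  have hfin : ∀ w ∈ words P N, volume (source P v l w) ≠ ⊤ := fun w hw h =>
    ENNReal.ofReal_ne_top (hsum ▸ ENNReal.sum_eq_top.2 ⟨w, hw, h⟩)
  -- The sets `source` contain only interior points, so the identity is claimed only there; the
  -- boundary of the table is null.
  have heq : EqOn (fun z => (P.gcAt z l v : ℝ))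
      (fun z => ∑ w ∈ words P N, (source P v l w).indicator (1 : Plane → ℝ) z)
      (interior P.carrier) := by
    intro z hz
    simp only
    rw [gcAt_eq hN z hv]
    push_cast
    refine Finset.sum_congr rfl fun w _ => ?_
    by_cases hne : (directions P w z l v).Nonempty
    · rw [if_pos hne, indicator_of_mem (show z ∈ source P v l w from ⟨hz, hne⟩)]; rfl
    · rw [if_neg hne, indicator_of_notMem (fun h => hne h.2)]
  have hint : ∀ w ∈ words P N, IntegrableOn ((source P v l w).indicator (1 : Plane → ℝ))
      (interior P.carrier) volume := fun w hw =>
    ((integrable_indicator_iff (measurableSet_source v l w)).2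
      (integrableOn_const (hfin w hw))).integrableOn
  have hon : IntegrableOn (fun z => (P.gcAt z l v : ℝ)) (interior P.carrier) volume :=
    (integrableOn_congr_fun heq isOpen_interior.measurableSet).2 (integrable_finsetSum _ hint)
  refine ⟨hon.congr_set_ae P.carrier_ae_eq, ?_⟩
  rw [setIntegral_congr_set P.carrier_ae_eq,
    setIntegral_congr_fun isOpen_interior.measurableSet heq, integral_finsetSum _ hint]
  have hw : ∀ w ∈ words P N, ∫ z in interior P.carrier,
      (source P v l w).indicator (1 : Plane → ℝ) z = (volume (source P v l w)).toReal := by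
    intro w _
    rw [integral_indicator_one (measurableSet_source v l w), measureReal_restrict_apply
      (measurableSet_source v l w), inter_eq_left.2 fun z hz => hz.1]
    rfl
  rw [Finset.sum_congr rfl hw, ← ENNReal.toReal_sum hfin, hsum, ENNReal.toReal_ofReal]
  · ring
  · have : 0 ≤ P.angle v := measureReal_nonneg
    positivity

end Table

end Billiard

/-! ### The counting formula -/

theorem mainTheorem9 (P : Billiard.Table) (l : ℝ) (hl : 0 ≤ l) :
    (∀ z ∈ P.carrier, ∀ v ∈ P.corners, (P.singularDirections z l v).Finite) ∧
    (∀ K ⊆ P.corners,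
      IntegrableOn (fun z => ∑ v ∈ K, (P.gcAt z l v : ℝ)) P.carrier volume ∧
      2 * ∫ z in P.carrier, ∑ v ∈ K, (P.gcAt z l v : ℝ) = (∑ v ∈ K, P.angle v) * l ^ 2) ∧
    IntegrableOn (fun z => (P.gc z l : ℝ)) P.carrier volume ∧
    2 * ∫ z in P.carrier, (P.gc z l : ℝ)
      = Real.pi * ((P.corners.card : ℝ) + 2 * (P.q : ℝ) - 2) * l ^ 2 := by
  have hK : ∀ K ⊆ P.corners,
      IntegrableOn (fun z => ∑ v ∈ K, (P.gcAt z l v : ℝ)) P.carrier volume ∧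
      2 * ∫ z in P.carrier, ∑ v ∈ K, (P.gcAt z l v : ℝ) = (∑ v ∈ K, P.angle v) * l ^ 2 := by
    intro K hK
    have hint := fun v (hv : v ∈ K) => (Billiard.Table.integral_gcAt (hK hv) hl).1
    refine ⟨integrable_finsetSum _ hint, ?_⟩
    rw [integral_finsetSum _ hint, Finset.mul_sum, Finset.sum_mul]
    exact Finset.sum_congr rfl fun v hv => (Billiard.Table.integral_gcAt (hK hv) hl).2
  refine ⟨fun z _ v _ => P.finite_singularDirections z l v, hK, ?_⟩
  have h := hK P.corners subset_rfl
  rw [P.sum_angle] at h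
  simpa only [Billiard.Table.gc, Nat.cast_sum] using h
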